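/- **Conventions.** On $\mathbb C^3$ let $g$ be the Euclidean metric and $\Omega=dz_1\wedge dz_2\wedge dz_3$. A real 3-plane is special Lagrangian (SL) if, for one of its orientations, $\operatorname{Re}\Omega$ restricts to its volume form. A smooth map $F$ from a 3-manifold to $\mathbb C^3$ is an SL immersion if it is an immersion with SL tangent planes. **The construction.** Let $\alpha_1,\alpha_2,\alpha_3>0$ with $\frac1{\alpha_1}=\frac1{\alpha_2}+\frac1{\alpha_3}$. Put $$a_1=-\alpha_1^{-1/2}(\alpha_2\alpha_3)^{1/2},\quad a_2=\alpha_2^{-1/2}(\alpha_3\alpha_1)^{1/2},\quad a_3=\alpha_3^{-1/2}(\alpha_1\alpha_2)^{1/2},$$ and $\lambda=(a_1^2-a_2a_3)^{1/2}$. Let $$M=\begin{pmatrix}-2a_1&0&0&0&-\sqrt{\alpha_3}&-\sqrt{\alpha_2}\\0&-2a_2&0&\sqrt{\alpha_3}&0&\sqrt{\alpha_1}\\0&0&-2a_3&\sqrt{\alpha_2}&\sqrt{\alpha_1}&0\\0&\sqrt{\alpha_3}&\sqrt{\alpha_2}&2a_1&0&0\\-\sqrt{\alpha_3}&0&-\sqrt{\alpha_1}&0&2a_2&0\\-\sqrt{\alpha_2}&-\sqrt{\alpha_1}&0&0&0&2a_3\end{pmatrix},$$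 and let $(c,d)$ and $(e,f)$, with $c,d,e,f\in\mathbb R^3$ nonzero, be eigenvectors of $M$ with eigenvalues $\lambda$ and $3\lambda$. Put $\epsilon_1=i$, $\epsilon_2=\epsilon_3=1$. For $C,D,C',D'\in\mathbb C$ let $$w_j(t)=\epsilon_j\sqrt{\alpha_j}\,e^{ia_jt},$$ $$p_j(t)=\epsilon_j\bigl(Cc_je^{i(a_j+\lambda/2)t}+\bar Cd_je^{i(a_j-\lambda/2)t}+De_je^{i(a_j+3\lambda/2)t}+\bar Df_je^{i(a_j-3\lambda/2)t}\bigr),$$ and let $q_j$ be given by the same formula with $C',D'$ in place of $C,D$. For $E_1,E_2,E_3\in\mathbb C$ let $r_j$ be the function that is $E_j$ plus a finite sum of nonconstant exponentials $e^{i\mu t}$ ($\mu\in\mathbb R\setminus\{0\}$) and satisfies $$r_1'=\tfrac12(\bar p_2\bar p_3+\bar q_2\bar q_3),\qquad r_2'=\tfrac12(\bar q_3\bar q_1-\bar p_1\bar p_3),\qquad r_3'=-\tfrac12(\bar p_1\bar q_2+\bar p_2\bar q_1).$$ Define $\Phi:\mathbb R^3\to\mathbb C^3$ by $$\begin{aligned}\Phi(y_1,y_2,t)=\bigl(&\tfrac12(y_1^2+y_2^2)w_1+y_1p_1+y_2q_1+r_1,\\&\tfrac12(y_1^2-y_2^2)w_2+y_1p_2-y_2q_2+r_2,\\&y_1y_2w_3+y_1q_3+y_2p_3+r_3\bigr),\end{aligned}$$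 and $N=\Phi(\mathbb R^3)$. The parameters $(E_1,E_2,E_3,C,D,C',D')$ are admissible if $$\operatorname{Im}(C\bar C')(c_1^2-c_2^2-c_3^2-d_1^2+d_2^2+d_3^2)+\operatorname{Im}(D\bar D')(e_1^2-e_2^2-e_3^2-f_1^2+f_2^2+f_3^2)=0.$$ **Theorem.** Let $s\in(0,\frac12)$ be rational, $s=p/q$ with $p,q$ coprime and $q>0$. Put $h=3$ if $3\mid p+q$, and $h=1$ otherwise. Then $$a_1=\tfrac1h(p^2-q^2),\quad a_2=\tfrac1h(q^2-2pq),\quad a_3=\tfrac1h(2pq-p^2),\quad l=\tfrac1h(p^2-pq+q^2)$$ are integers with $\gcd(a_1,a_2,a_3)=1$. There are unique $\alpha_1,\alpha_2,\alpha_3$ as above that give these $a_j$; eigenvectors $(c,d),(e,f)$ as above exist for them; and $\lambda=l$. For every choice of these eigenvectors the following hold. 1. For all admissible parameters, $\Phi(y_1,y_2,t+2\pi)=\Phi(-y_1,-y_2,t)$, and so $\Phi$ is $4\pi$-periodic in $t$. If $(C,D,C',D')\ne0$, then every $T$ with $\Phi(y_1,y_2,t+T)=\Phi(y_1,y_2,t)$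 for all $y_1,y_2,t$ is an integer multiple of $4\pi$. Hence $\Phi$ descends to a map $F$ on $S^1\times\mathbb R^2$ with image $N$, where $S^1\times\mathbb R^2$ is the quotient of $\mathbb R^3$ by the $\mathbb Z$-action $(y_1,y_2,t)\mapsto((-1)^ny_1,(-1)^ny_2,t+2\pi n)$, under the quotient map $(y_1,y_2,t)\mapsto(e^{it},(y_1+iy_2)e^{it/2})$. 2. For all admissible parameters, $N$ is closed in $\mathbb C^3$ and $F$ is smooth and proper. Moreover $F$ is an immersion on a dense set, and its tangent plane is SL wherever it is an immersion. So $N$ is a closed SL 3-fold, possibly with singularities. 3. For generic admissible parameters, $F$ is an SL immersion, so that $N$ is a nonsingular immersed SL 3-fold diffeomorphic to $S^1\times\mathbb R^2$. Here generic means that the exceptional parameters form a relatively closed, nowhere dense subset of the set of admissible parameters, of real codimension at least one: its Hausdorff dimension is smaller by at least $1$ than that of every nonempty relatively open subset of the admissible set. 4. The set $$N_0=\{(ie^{ia_1t}x_1,e^{ia_2t}x_2,e^{ia_3t}x_3):x_j,t\in\mathbb R,\ x_1\ge0,\ a_1x_1^2+a_2x_2^2+a_3x_3^2=0\}$$ is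 an SL $T^2$-cone: $N_0\setminus\{0\}$ is the image of an injective SL immersion of $(0,\infty)\times T^2$ that is homogeneous of degree one in the first variable. It is also the image of the SL immersion $$\Psi(r,e^{i\theta},e^{it})=r\,(i\sqrt{\alpha_1}e^{ia_1t},\sqrt{\alpha_2}\cos\theta\,e^{ia_2t},\sqrt{\alpha_3}\sin\theta\,e^{ia_3t}),\qquad r>0.$$ This $\Psi$ is injective if $a_1$ is odd. If $a_1$ is even (that is, if $p$ and $q$ are both odd), it identifies exactly the pairs $(r,\theta,t)$, $(r,\theta+\pi,t+\pi)$. 5. For all admissible parameters, $N$ is weakly asymptotic at infinity, to order $O(r^{1/2})$ with $r$ the radius function on $\mathbb C^3$, to a double cover of the $T^2$-cone $N_0$ parametrized by $\Psi$. Precisely, $\kappa:[(y_1,y_2,t)]\mapsto\bigl(\tfrac12|y|^2,e^{2i\varphi},e^{it}\bigr)$, where $y_1+iy_2=|y|e^{i\varphi}$, is a two-sheeted covering map from $S^1\times(\mathbb R^2\setminus\{0\})$ onto $(0,\infty)\times T^2$, and $|F-\Psi\circ\kappa|=O(|F|^{1/2})$ at infinity in $S^1\times\mathbb R^2$. -/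

import Mathlib

open scoped Manifold ContDiff Topology ComplexConjugate

noncomputable section

namespace SLFold

/-! ### Special Lagrangian geometry in `ℂ³` -/

/-- `ℂ³` with its Euclidean norm; `g = Re ⟪·,·⟫` is the flat metric. -/
abbrev C3 : Type := EuclideanSpace ℂ (Fin 3)

/-- The complex volume form `dz₁ ∧ dz₂ ∧ dz₃`, evaluated on three vectors. -/
def holVol (v : Fin 3 → C3) : ℂ := Matrix.det (Matrix.of fun i j => v i j)

/-- A real subspace `V` of `ℂ³` is a special Lagrangian plane if it is 3-dimensional and can be
oriented so that `Re Ω` restricts to its volume form: it has a `g`-orthonormal basis on which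
`Re Ω` takes the value `1`. (As `Re Ω` is then nowhere zero on the tangent planes of a
submanifold, the pointwise orientations fit together to an orientation of the submanifold.) -/
def IsSLPlane (V : Submodule ℝ C3) : Prop :=
  ∃ e : Fin 3 → C3, (∀ i j, (inner ℂ (e i) (e j) : ℂ).re = if i = j then 1 else 0) ∧
    Submodule.span ℝ (Set.range e) = V ∧ (holVol e).re = 1

section Maps

variable {E H M : Type*} [NormedAddCommGroup E] [NormedSpace ℝ E] [TopologicalSpace H]
  [TopologicalSpace M] [ChartedSpace H M]

/-- The image of the differential of `F : M → ℂ³` at `x`, a real subspace of `ℂ³`. -/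
def tangentImage (I : ModelWithCorners ℝ E H) (F : M → C3) (x : M) : Submodule ℝ C3 :=
  LinearMap.range (mfderiv I 𝓘(ℝ, C3) F x).toLinearMap

/-- `F` is an immersion at `x`. -/
def ImmersedAt (I : ModelWithCorners ℝ E H) (F : M → C3) (x : M) : Prop :=
  Function.Injective (mfderiv I 𝓘(ℝ, C3) F x)

/-- The smooth map `F` is, on the set `U`, a special Lagrangian immersion. -/
def IsSLImmersionOn (I : ModelWithCorners ℝ E H) (F : M → C3) (U : Set M) : Prop :=
  ContMDiff I 𝓘(ℝ, C3) ∞ F ∧ ∀ x ∈ U, ImmersedAt I F x ∧ IsSLPlane (tangentImage I F x)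

/-- The (possibly singular) parametrized submanifold `F` is special Lagrangian: `F` is smooth, it
is an immersion on a dense set, and its tangent plane is special Lagrangian wherever it is an
immersion. -/
def IsSLParametrized (I : ModelWithCorners ℝ E H) (F : M → C3) : Prop :=
  ContMDiff I 𝓘(ℝ, C3) ∞ F ∧ Dense {x | ImmersedAt I F x} ∧
    ∀ x, ImmersedAt I F x → IsSLPlane (tangentImage I F x)

end Maps

/-! ### `T²`-cones -/

/-- The 2-torus `S¹ × S¹`. -/
abbrev T2 : Type := Circle × Circle

/-- The cone `(r, x) ↦ r ℓ(x)` over a map `ℓ` from the 2-torus; it is used for `r ≥ 0`. -/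
def coneMap (ℓ : T2 → C3) (b : ℝ × T2) : C3 := b.1 • ℓ b.2

/-- The model with corners for `ℝ × T²`. -/
abbrev coneModel := 𝓘(ℝ, ℝ).prod ((𝓡 1).prod (𝓡 1))

/-- `S ⊆ ℂ³` is a special Lagrangian `T²`-cone: away from the vertex `0` it is an injectively
immersed special Lagrangian copy of `(0,∞) × T²`, on which dilations of `ℂ³` act by dilations of
the first factor. -/
def IsSLTorusCone (S : Set C3) : Prop :=
  ∃ ℓ : T2 → C3, S = coneMap ℓ '' {b | 0 ≤ b.1} ∧ Set.InjOn (coneMap ℓ) {b | 0 < b.1} ∧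
    IsSLImmersionOn coneModel (coneMap ℓ) {b | 0 < b.1}

/-! ### The construction -/

/-- The conditions on the positive constants `α₁, α₂, α₃`. -/
def IsAlpha (α : Fin 3 → ℝ) : Prop :=
  (∀ j, 0 < α j) ∧ 1 / α 0 = 1 / α 1 + 1 / α 2

/-- The frequencies `a₁, a₂, a₃` determined by `α₁, α₂, α₃`. -/
def freq (α : Fin 3 → ℝ) : Fin 3 → ℝ :=
  ![-(√(α 1 * α 2) / √(α 0)), √(α 2 * α 0) / √(α 1), √(α 0 * α 1) / √(α 2)]

/-- The number `λ ≥ 0` with `λ² = a₁² - a₂ a₃`. -/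
def lam (α : Fin 3 → ℝ) : ℝ := √(freq α 0 ^ 2 - freq α 1 * freq α 2)

/-- The matrix `M` of the linear system for `(β₁, β₂, β₃, β̄₁, β̄₂, β̄₃)`. -/
def evolMatrix (α : Fin 3 → ℝ) : Matrix (Fin 6) (Fin 6) ℝ :=
  !![-2 * freq α 0, 0, 0, 0, -√(α 2), -√(α 1);
     0, -2 * freq α 1, 0, √(α 2), 0, √(α 0);
     0, 0, -2 * freq α 2, √(α 1), √(α 0), 0;
     0, √(α 2), √(α 1), 2 * freq α 0, 0, 0;
     -√(α 2), 0, -√(α 0), 0, 2 * freq α 1, 0;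
     -√(α 1), -√(α 0), 0, 0, 0, 2 * freq α 2]

/-- `(x, y)`, with `x, y ∈ ℝ³` nonzero, is an eigenvector of `M` with eigenvalue `μ`. -/
def IsEigenpair (α : Fin 3 → ℝ) (μ : ℝ) (x y : Fin 3 → ℝ) : Prop :=
  x ≠ 0 ∧ y ≠ 0 ∧
    (evolMatrix α).mulVec ![x 0, x 1, x 2, y 0, y 1, y 2] = μ • ![x 0, x 1, x 2, y 0, y 1, y 2]

/-- The constants of the construction that are fixed throughout a family: `α₁, α₂, α₃` and the
eigenvectors `(c, d)` and `(e, f)`. -/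
structure Data where
  α : Fin 3 → ℝ
  c : Fin 3 → ℝ
  d : Fin 3 → ℝ
  e : Fin 3 → ℝ
  f : Fin 3 → ℝ

/-- `α` is admissible, and `(c, d)` and `(e, f)` are eigenvectors of `M` with eigenvalues `λ` and
`3λ`. -/
def Data.IsValid (S : Data) : Prop :=
  IsAlpha S.α ∧ IsEigenpair S.α (lam S.α) S.c S.d ∧ IsEigenpair S.α (3 * lam S.α) S.e S.f

/-- The parameters `((E₁, E₂, E₃), (C, D, C', D'))` of a family. -/
abbrev Params : Type := (Fin 3 → ℂ) × (Fin 4 → ℂ)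

/-- The phase factors `i, 1, 1`. -/
def phase : Fin 3 → ℂ := ![Complex.I, 1, 1]

/-- The exponential `e^{ixt}`. -/
def expi (x t : ℝ) : ℂ := Complex.exp (Complex.I * x * t)

namespace Data

variable (S : Data)

/-- The functions `w₁, w₂, w₃`. -/
def w (j : Fin 3) (t : ℝ) : ℂ := phase j * √(S.α j) * expi (freq S.α j) t

/-- The functions `p₁, p₂, p₃`, for constants `C, D`. For the constants `C', D'` they are the
functions `q₁, q₂, q₃`. -/
def p (C D : ℂ) (j : Fin 3) (t : ℝ) : ℂ :=
  phase j * (C * S.c j * expi (freq S.α j + lam S.α / 2) t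
    + conj C * S.d j * expi (freq S.α j - lam S.α / 2) t
    + D * S.e j * expi (freq S.α j + 3 * lam S.α / 2) t
    + conj D * S.f j * expi (freq S.α j - 3 * lam S.α / 2) t)

/-- The numbers `-3, -1, 1, 3`. -/
def mode : Fin 4 → ℝ := ![-3, -1, 1, 3]

/-- The Fourier coefficients of the conjugates of the `p_j`: up to the factor
`conj (phase j) * e^{-i a_j t}`, the function `conj (p_j)` is the sum over `m` of
`coeff C D j m * e^{i (mode m) λ t / 2}`. -/
def coeff (C D : ℂ) (j : Fin 3) : Fin 4 → ℂ :=
  ![conj D * S.e j, conj C * S.c j, C * S.d j, D * S.f j]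

/-- The frequency `a_j + (μ + ν) λ / 2`, for modes `μ, ν`. -/
def rFreq (j : Fin 3) (m n : Fin 4) : ℝ := freq S.α j + (mode m + mode n) * lam S.α / 2

/-- The functions `r₁, r₂, r₃`: the sums of exponentials, with constant terms `E₁, E₂, E₃`, that
satisfy `r₁' = (p̄₂ p̄₃ + q̄₂ q̄₃)/2`, `r₂' = (q̄₃ q̄₁ - p̄₁ p̄₃)/2`, `r₃' = -(p̄₁ q̄₂ + p̄₂ q̄₁)/2`. -/
def r (k : Params) (j : Fin 3) (t : ℝ) : ℂ :=
  let y := S.coeff (k.2 0) (k.2 1)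
  let y' := S.coeff (k.2 2) (k.2 3)
  let G : Fin 4 → Fin 4 → Fin 3 → ℂ := fun m n =>
    ![-Complex.I * (y 1 m * y 2 n + y' 1 m * y' 2 n),
      y 0 m * y 2 n - y' 0 m * y' 2 n,
      y 0 m * y' 1 n + y 1 m * y' 0 n]
  k.1 j + ∑ m, ∑ n, G m n j / (2 * S.rFreq j m n : ℝ) * expi (S.rFreq j m n) t

/-- The map `Φ : ℝ³ → ℂ³`. -/
def Phi (k : Params) (y₁ y₂ t : ℝ) : C3 :=
  let P := S.p (k.2 0) (k.2 1)
  let Q := S.p (k.2 2) (k.2 3)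
  !₂[(1 / 2 : ℂ) * (y₁ ^ 2 + y₂ ^ 2) * S.w 0 t + y₁ * P 0 t + y₂ * Q 0 t + S.r k 0 t,
     (1 / 2 : ℂ) * (y₁ ^ 2 - y₂ ^ 2) * S.w 1 t + y₁ * P 1 t - y₂ * Q 1 t + S.r k 1 t,
     (y₁ * y₂ : ℂ) * S.w 2 t + y₁ * Q 2 t + y₂ * P 2 t + S.r k 2 t]

/-- The subset `N` of `ℂ³`. -/
def N (k : Params) : Set C3 := {z | ∃ y₁ y₂ t : ℝ, z = S.Phi k y₁ y₂ t}

/-- The quadratic constraint on `C, D, C', D'`, with `E₁, E₂, E₃` free. -/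
def admissible : Set Params :=
  {k | (k.2 0 * conj (k.2 2)).im *
        (S.c 0 ^ 2 - S.c 1 ^ 2 - S.c 2 ^ 2 - S.d 0 ^ 2 + S.d 1 ^ 2 + S.d 2 ^ 2) +
      (k.2 1 * conj (k.2 3)).im *
        (S.e 0 ^ 2 - S.e 1 ^ 2 - S.e 2 ^ 2 - S.f 0 ^ 2 + S.f 1 ^ 2 + S.f 2 ^ 2) = 0}

end Data

/-! ### The quotient `ℝ³/ℤ = S¹ × ℝ²` -/

/-- `S¹ × ℝ²`, with `ℝ²` identified with `ℂ`. -/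
abbrev Cyl : Type := Circle × ℂ

/-- The model with corners for `S¹ × ℝ²`. -/
abbrev cylModel := (𝓡 1).prod 𝓘(ℝ, ℂ)

/-- The map `ℝ³ → S¹ × ℝ²`, `(y₁, y₂, t) ↦ (e^{it}, (y₁ + i y₂) e^{it/2})`, which is the quotient
by the action `(y₁, y₂, t) ↦ ((-1)ⁿ y₁, (-1)ⁿ y₂, t + 2πn)` of `ℤ`. -/
def toCyl (y₁ y₂ t : ℝ) : Cyl :=
  (Circle.exp t, (y₁ + y₂ * Complex.I) * expi (1 / 2) t)

/-- The map on `S¹ × ℝ²` whose composition with `toCyl` is `Ψ`, when `Ψ` is invariant under the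
action of `ℤ`: it is `Ψ` evaluated at the preimage under `toCyl` that has `t ∈ (-π, π]`. -/
def descend (Ψ : ℝ → ℝ → ℝ → C3) (x : Cyl) : C3 :=
  let t : ℝ := Complex.arg x.1
  let y : ℂ := x.2 * expi (-1 / 2) t
  Ψ y.re y.im t

/-- The member of the family with parameters `k`, as a map `S¹ × ℝ² → ℂ³`. -/
def Data.F (S : Data) (k : Params) : Cyl → C3 := descend (S.Phi k)

/-! ### The asymptotic cone and its double cover -/

/-- The cone `{(i e^{i a₁ t} x₁, e^{i a₂ t} x₂, e^{i a₃ t} x₃) : x₁ ≥ 0, ∑ a_j x_j² = 0}`. -/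
def cone (a : Fin 3 → ℝ) : Set C3 :=
  {z | ∃ (x : Fin 3 → ℝ) (t : ℝ), 0 ≤ x 0 ∧
    a 0 * x 0 ^ 2 + a 1 * x 1 ^ 2 + a 2 * x 2 ^ 2 = 0 ∧
    z = !₂[Complex.I * expi (a 0) t * x 0, expi (a 1) t * x 1, expi (a 2) t * x 2]}

/-- The torus `(e^{iθ}, e^{it}) ↦ (i √α₁ e^{i a₁ t}, √α₂ cos θ e^{i a₂ t}, √α₃ sin θ e^{i a₃ t})`,
for integers `a_j`. -/
def torus (α : Fin 3 → ℝ) (a : Fin 3 → ℤ) (x : T2) : C3 :=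
  !₂[Complex.I * √(α 0) * (x.2 : ℂ) ^ a 0,
     (√(α 1) * (x.1 : ℂ).re : ℝ) * (x.2 : ℂ) ^ a 1,
     (√(α 2) * (x.1 : ℂ).im : ℝ) * (x.2 : ℂ) ^ a 2]

/-- The map from `S¹ × (ℝ² \ 0)` to `(0,∞) × T²` that sends the class of `(y₁, y₂, t)` to
`(|y|²/2, e^{2iφ}, e^{it})`, where `y₁ + i y₂ = |y| e^{iφ}`. On the circle `y = 0` its first
component is `0`. -/
def endCover (x : Cyl) : ℝ × T2 :=
  (‖x.2‖ ^ 2 / 2, (Circle.exp (2 * Complex.arg x.2) * x.1⁻¹, x.1))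

/-! ### Arithmetic and genericity -/

/-- The integers `a₁, a₂, a₃, λ` attached to `s = p/q`. -/
def IsFamilyData (p q : ℤ) (a : Fin 3 → ℤ) (l : ℤ) : Prop :=
  let h : ℤ := if p + q ≡ 0 [ZMOD 3] then 3 else 1
  h * a 0 = p ^ 2 - q ^ 2 ∧ h * a 1 = q ^ 2 - 2 * p * q ∧ h * a 2 = 2 * p * q - p ^ 2 ∧
    h * l = p ^ 2 - p * q + q ^ 2

/-- The property `G` holds for generic elements of `P`, in the sense of real codimension one: the
set of exceptions is relatively closed in `P` and nowhere dense in it, and its dimension is smaller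
by at least one than that of every nonempty relatively open subset of `P`. -/
def HoldsGenerically {X : Type*} [EMetricSpace X] (P : Set X) (G : X → Prop) : Prop :=
  (∃ O : Set X, IsOpen O ∧ {x ∈ P | G x} = P ∩ O) ∧ P ⊆ closure {x ∈ P | G x} ∧
    ∀ U : Set X, IsOpen U → (P ∩ U).Nonempty → dimH {x ∈ P | ¬ G x} + 1 ≤ dimH (P ∩ U)

end SLFold

end

namespace SLFold

/-! ### Arithmetic of the family -/

/-! Everything rests on one evolution equation. If `u`, `v` in `ℂ³` have real Hermitian product and
`n = conjCross u v` is nonzero, then `n` is Hermitian-orthogonal to both and `Ω(u, v, n) = |n|²`, so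
`u, v, n` span an SL plane (`isSLPlane_span`). Hence a map on `ℝ³` with isotropic slices and `∂Φ/∂t
= c • conjCross (∂Φ/∂y₁) (∂Φ/∂y₂)`, `c > 0`, has SL tangent planes wherever it is an immersion, and
it is one exactly where the cross product is nonzero (`IsSLEvolution`). As `Φ` is quadratic in `y`,
comparing powers of `y` splits this equation into a nonlinear system for `w`, linear systems for `p`
and `q`, which eigenvectors of `M` solve, and quadratures for `r`. Orthogonality of the eigenvectors
reduces isotropy to the admissibility equation (`Data.isSLEvolution_Phi`).

Arithmetic gives the global shape. The `a j` and `l` are integers and `l` is odd, so after time `2π`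
the functions `w` and `r` repeat while `p` and `q`, whose frequencies lie in `ℤ + 1/2`, change sign.
The coprimality of the `a j` excludes periods outside `2πℤ`, and a nondegeneracy of the
eigenvectors, which comes from the irrationality of `√3` and `√21`, excludes odd multiples of `2π`.
At infinity the part of `Φ` quadratic in `y` is exactly `Ψ ∘ κ`, of size `|y|²`, and the rest is
`O(1 + |y|)`; this gives properness, closedness of the image and the rate `O(r^{1/2})`.

Genericity is a dimension count. There are 14 real parameters, and the admissible set has dimension
at least 13 near each of its points (`Data.thirteen_le_dimH_admissible`). Where `F` is not immersed,
`u = ∂Φ/∂y₁` and `v = ∂Φ/∂y₂` satisfy `u = 0`, `v = 0` or `u + σv = 0` with `σ` real and nonzero.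
Two components of the amplitudes determine the rotated constants, so each case lies in the image of
`C¹` maps from 12-dimensional spaces (`Data.dimH_exceptional_le`). The exceptional set is relatively
closed by compactness, because zeros of the cross product stay bounded in `y`. -/

theorem exists_familyData (p q : ℤ) :
    ∃ (a : Fin 3 → ℤ) (l : ℤ), IsFamilyData p q a l := by
  unfold IsFamilyData
  by_cases h : p + q ≡ 0 [ZMOD 3]
  · obtain ⟨m, hm⟩ := (Int.modEq_zero_iff_dvd).1 h
    obtain rfl : q = 3 * m - p := by linarith
    refine ⟨![-3 * m ^ 2 + 2 * m * p, 3 * m ^ 2 - 4 * m * p + p ^ 2, 2 * m * p - p ^ 2],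
      3 * m ^ 2 - 3 * m * p + p ^ 2, ?_⟩
    simp only [h, if_true]
    refine ⟨?_, ?_, ?_, ?_⟩ <;> (try simp) <;> ring
  · refine ⟨![p ^ 2 - q ^ 2, q ^ 2 - 2 * p * q, 2 * p * q - p ^ 2], p ^ 2 - p * q + q ^ 2, ?_⟩
    simp only [h, if_false, one_mul]
    exact ⟨rfl, rfl, rfl, trivial⟩

/-- A prime dividing all three `a j` divides neither `p` nor `q`, hence divides `q - 2p` and `2q -
p`, hence `3p`, so it is 3. Then `3 ∣ p + q`, the normalizing factor is 3, and the same argument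
gains a factor: `9 ∣ 3p`, a contradiction. -/
theorem IsFamilyData.gcd_eq_one {p q l : ℤ} {a : Fin 3 → ℤ} (hc : IsCoprime p q)
    (h : IsFamilyData p q a l) : Int.gcd (a 0) (Int.gcd (a 1) (a 2)) = 1 := by
  by_contra hg
  obtain ⟨P, hP, hd⟩ := Nat.exists_prime_and_dvd hg
  have hP' : Prime (P : ℤ) := Nat.prime_iff_prime_int.1 hP
  have h0 : (P : ℤ) ∣ (Int.gcd (a 0) (Int.gcd (a 1) (a 2)) : ℤ) := Int.natCast_dvd_natCast.2 hd
  have h12 : (P : ℤ) ∣ (Int.gcd (a 1) (a 2) : ℤ) := h0.trans (Int.gcd_dvd_right _ _)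
  have h1 : (P : ℤ) ∣ a 1 := h12.trans (Int.gcd_dvd_left _ _)
  have h2 : (P : ℤ) ∣ a 2 := h12.trans (Int.gcd_dvd_right _ _)
  replace h0 : (P : ℤ) ∣ a 0 := h0.trans (Int.gcd_dvd_left _ _)
  have hnot : ¬ ((P : ℤ) ∣ p ∧ (P : ℤ) ∣ q) := fun hh =>
    hP'.not_isUnit (hc.isUnit_of_dvd' hh.1 hh.2)
  unfold IsFamilyData at h
  set t : ℤ := if p + q ≡ 0 [ZMOD 3] then 3 else 1 with ht
  obtain ⟨e0, e1, e2, -⟩ := h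
  have d0 : (P : ℤ) ∣ p ^ 2 - q ^ 2 := e0 ▸ h0.mul_left t
  have d1 : (P : ℤ) ∣ q * (q - 2 * p) := by
    exact (h1.mul_left t).trans (dvd_of_eq (by rw [e1]; ring))
  have d2 : (P : ℤ) ∣ p * (2 * q - p) := by
    exact (h2.mul_left t).trans (dvd_of_eq (by rw [e2]; ring))
  have nq : ¬ (P : ℤ) ∣ q := fun hq => hnot ⟨hP'.dvd_of_dvd_pow (n := 2) (by
    exact (dvd_add d0 (hq.mul_left q)).trans (dvd_of_eq (by ring))), hq⟩
  have np : ¬ (P : ℤ) ∣ p := fun hp => nq <| hP'.dvd_of_dvd_pow (n := 2) (by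
    exact (dvd_sub (hp.mul_left p) d0).trans (dvd_of_eq (by ring)))
  have k1 := (hP'.dvd_or_dvd d1).resolve_left nq
  have k2 := (hP'.dvd_or_dvd d2).resolve_left np
  have k3 : (P : ℤ) ∣ 3 * p := by
    exact (dvd_sub k2 (k1.mul_left 2)).trans (dvd_of_eq (by ring))
  have k3 : (P : ℤ) ∣ 3 := (hP'.dvd_or_dvd k3).resolve_right np
  have hP3 : P = 3 := (Nat.prime_dvd_prime_iff_eq hP Nat.prime_three).1 (by exact_mod_cast k3)
  subst hP3
  have hmod : p + q ≡ 0 [ZMOD 3] := by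
    rw [Int.modEq_zero_iff_dvd]
    exact (dvd_add k1 (dvd_mul_right (3 : ℤ) p)).trans (dvd_of_eq (by ring))
  rw [if_pos hmod] at ht
  rw [ht] at e1 e2
  have co : ∀ x : ℤ, ¬ ((3 : ℕ) : ℤ) ∣ x → IsCoprime ((9 : ℤ)) x := fun x hx => by
    simpa using ((hP'.coprime_iff_not_dvd).2 hx).pow_left (m := 2)
  have g1 : (9 : ℤ) ∣ q - 2 * p := by
    refine (co q nq).dvd_of_dvd_mul_left ?_
    exact (mul_dvd_mul_left (3 : ℤ) h1).trans (dvd_of_eq (by rw [e1]; ring))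
  have g2 : (9 : ℤ) ∣ 2 * q - p := by
    refine (co p np).dvd_of_dvd_mul_left ?_
    exact (mul_dvd_mul_left (3 : ℤ) h2).trans (dvd_of_eq (by rw [e2]; ring))
  apply np
  have : (9 : ℤ) ∣ 3 * p := by
    exact (dvd_sub g2 (g1.mul_left 2)).trans (dvd_of_eq (by ring))
  push_cast
  omega

/-- The form `p² - pq + q²` is even only if `p` and `q` both are. Oddness of `l` makes the
frequencies `a j ± l/2` and `a j ± 3l/2` proper half-integers. -/
theorem IsFamilyData.odd {p q l : ℤ} {a : Fin 3 → ℤ} (hc : IsCoprime p q)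
    (h : IsFamilyData p q a l) : Odd l := by
  by_contra hl
  rw [Int.not_odd_iff_even] at hl
  have he : Even (p ^ 2 - p * q + q ^ 2) := h.2.2.2 ▸ hl.mul_left _
  have hnot : ¬ (Even p ∧ Even q) := fun hh =>
    Int.prime_two.not_isUnit (hc.isUnit_of_dvd' hh.1.two_dvd hh.2.two_dvd)
  simp only [Int.even_add, Int.even_sub, Int.even_pow, Int.even_mul] at he
  tauto

/-- The sign and size relations between the integers of a family. -/
structure IsFreq (a : Fin 3 → ℤ) (l : ℤ) : Prop where
  neg : a 0 < 0
  pos1 : 0 < a 1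
  pos2 : 0 < a 2
  sum : a 0 + a 1 + a 2 = 0
  l_pos : 0 < l
  l_sq : l ^ 2 = a 0 ^ 2 - a 1 * a 2
  odd : Odd l
  gcd : Int.gcd (a 0) (Int.gcd (a 1) (a 2)) = 1

theorem IsFamilyData.isFreq {p q l : ℤ} {a : Fin 3 → ℤ} (hp : 0 < p) (hpq : 2 * p < q)
    (hc : IsCoprime p q) (h : IsFamilyData p q a l) : IsFreq a l := by
  have hg := h.gcd_eq_one hc
  have ho := h.odd hc
  unfold IsFamilyData at h
  set t : ℤ := if p + q ≡ 0 [ZMOD 3] then 3 else 1 with ht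
  have tpos : 0 < t := by rw [ht]; split_ifs <;> norm_num
  obtain ⟨e0, e1, e2, e3⟩ := h
  refine ⟨?_, ?_, ?_, ?_, ?_, ?_, ho, hg⟩
  · by_contra! hh
    have := mul_nonneg tpos.le hh
    nlinarith
  · refine (mul_pos_iff_of_pos_left tpos).1 ?_
    rw [e1]; nlinarith
  · refine (mul_pos_iff_of_pos_left tpos).1 ?_
    rw [e2]; nlinarith
  · have : t * (a 0 + a 1 + a 2) = 0 := by linear_combination e0 + e1 + e2
    exact (mul_eq_zero.1 this).resolve_left tpos.ne'
  · refine (mul_pos_iff_of_pos_left tpos).1 ?_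
    rw [e3]; nlinarith
  · have : t ^ 2 * (l ^ 2 - (a 0 ^ 2 - a 1 * a 2)) = 0 := by
      linear_combination (t * l + (p ^ 2 - p * q + q ^ 2)) * e3 - (t * a 0 + (p ^ 2 - q ^ 2)) * e0
        + t * a 2 * e1 + (q ^ 2 - 2 * p * q) * e2
    have := (mul_eq_zero.1 this).resolve_left (by positivity)
    linarith

/-- Otherwise `√3 = |l| / |x|`. At `x = a j` the expression is the product of the differences of `a
j` from the other two frequencies, so the three frequencies are distinct. -/
theorem IsFreq.three_mul_sq_sub_ne_zero {a : Fin 3 → ℤ} {l : ℤ} (h : IsFreq a l) (x : ℤ) :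
    3 * (x : ℝ) ^ 2 - (l : ℝ) ^ 2 ≠ 0 := by
  intro hx
  have hl := h.l_pos
  have h3 : Irrational (√(3 : ℝ)) := by
    simpa using Nat.Prime.irrational_sqrt Nat.prime_three
  apply h3
  have hx0 : (x : ℝ) ≠ 0 := by
    intro h0
    rw [h0] at hx
    have : (l : ℝ) ≠ 0 := by exact_mod_cast hl.ne'
    apply this
    nlinarith [sq_nonneg (l : ℝ)]
  refine ⟨(|l| : ℚ) / |x|, ?_⟩
  symm
  rw [Real.sqrt_eq_iff_mul_self_eq (by norm_num) (by push_cast; positivity)]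
  push_cast
  rw [div_mul_div_comm, abs_mul_abs_self, abs_mul_abs_self, eq_div_iff (by positivity)]
  linarith

/-- Completing the square gives `(2x + 5y)² = 21y²`. This form is a factor of the determinants
`add1` and `add2` of `IsNondegenerate`. -/
theorem sq_add_five_mul_add_sq_ne_zero {x y : ℤ} (hy : y ≠ 0) :
    (x : ℝ) ^ 2 + 5 * x * y + (y : ℝ) ^ 2 ≠ 0 := by
  intro hx
  have h21 : Irrational (√(21 : ℝ)) := irrational_sqrt_ofNat_iff.2 (by
    rintro ⟨r, hr⟩
    have : r < 5 := by nlinarith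
    interval_cases r <;> omega)
  apply h21
  have hy0 : (y : ℝ) ≠ 0 := by exact_mod_cast hy
  refine ⟨(|2 * x + 5 * y| : ℚ) / |y|, ?_⟩
  symm
  rw [Real.sqrt_eq_iff_mul_self_eq (by norm_num) (by push_cast; positivity)]
  push_cast
  rw [div_mul_div_comm, abs_mul_abs_self, abs_mul_abs_self, eq_div_iff (by positivity)]
  linarith

/-! ### The frequencies -/

section Freq

variable {α : Fin 3 → ℝ}

theorem IsAlpha.sqrt_pos (h : IsAlpha α) (j : Fin 3) : 0 < √(α j) := Real.sqrt_pos.2 (h.1 j)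

theorem IsAlpha.mul_sqrt (h : IsAlpha α) :
    √(α 1) * √(α 2) = -freq α 0 * √(α 0) ∧ √(α 2) * √(α 0) = freq α 1 * √(α 1) ∧
      √(α 0) * √(α 1) = freq α 2 * √(α 2) := by
  have h0 := h.sqrt_pos 0
  have h1 := h.sqrt_pos 1
  have h2 := h.sqrt_pos 2
  simp only [freq, Matrix.cons_val_zero, Matrix.cons_val_one, Matrix.cons_val]
  rw [Real.sqrt_mul (h.1 1).le, Real.sqrt_mul (h.1 2).le, Real.sqrt_mul (h.1 0).le]
  refine ⟨?_, ?_, ?_⟩ <;> field_simp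

theorem IsAlpha.freq_mul (h : IsAlpha α) :
    freq α 0 * α 0 = -(√(α 0) * √(α 1) * √(α 2)) ∧ freq α 1 * α 1 = √(α 0) * √(α 1) * √(α 2) ∧
      freq α 2 * α 2 = √(α 0) * √(α 1) * √(α 2) := by
  obtain ⟨e0, e1, e2⟩ := h.mul_sqrt
  have s := fun j => Real.mul_self_sqrt (h.1 j).le
  refine ⟨?_, ?_, ?_⟩
  · linear_combination √(α 0) * e0 - freq α 0 * s 0
  · linear_combination -√(α 1) * e1 - freq α 1 * s 1
  · linear_combination -√(α 2) * e2 - freq α 2 * s 2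

theorem IsAlpha.freq_neg (h : IsAlpha α) : freq α 0 < 0 := by
  have h0 := h.sqrt_pos 0
  have h1 := h.sqrt_pos 1
  have h2 := h.sqrt_pos 2
  have := h.mul_sqrt.1
  by_contra! hh
  nlinarith [mul_pos h1 h2, mul_nonneg hh h0.le]

theorem IsAlpha.freq_pos1 (h : IsAlpha α) : 0 < freq α 1 := by
  have := h.mul_sqrt.2.1
  exact pos_of_mul_pos_left (this ▸ mul_pos (h.sqrt_pos 2) (h.sqrt_pos 0)) (h.sqrt_pos 1).le

theorem IsAlpha.freq_pos2 (h : IsAlpha α) : 0 < freq α 2 := by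
  have := h.mul_sqrt.2.2
  exact pos_of_mul_pos_left (this ▸ mul_pos (h.sqrt_pos 0) (h.sqrt_pos 1)) (h.sqrt_pos 2).le

/-- The frequencies are `-κ/α 0`, `κ/α 1`, `κ/α 2` with `κ = √(α 0) √(α 1) √(α 2)`, so this is the
relation between the reciprocals of the `α j`. -/
theorem IsAlpha.freq_sum (h : IsAlpha α) : freq α 0 + freq α 1 + freq α 2 = 0 := by
  obtain ⟨e0, e1, e2⟩ := h.freq_mul
  have h0 := (h.1 0).ne'
  have h1 := (h.1 1).ne'
  have h2 := (h.1 2).ne'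
  have hs := h.2
  field_simp at hs
  rw [eq_div_of_mul_eq h0 e0, eq_div_of_mul_eq h1 e1, eq_div_of_mul_eq h2 e2]
  field_simp
  linear_combination (√(α 0) * √(α 1) * √(α 2)) * (-hs)

/-- Inverts the passage from `α` to the frequencies; uniqueness of `α` rests on it. -/
theorem IsAlpha.eq_freq_mul (h : IsAlpha α) :
    α 0 = freq α 1 * freq α 2 ∧ α 1 = -freq α 0 * freq α 2 ∧ α 2 = -freq α 0 * freq α 1 := by
  obtain ⟨e0, e1, e2⟩ := h.mul_sqrt
  have s := fun j => Real.mul_self_sqrt (h.1 j).le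
  have h0 := (h.sqrt_pos 0)
  have h1 := (h.sqrt_pos 1)
  have h2 := (h.sqrt_pos 2)
  refine ⟨?_, ?_, ?_⟩
  · rw [← s 0]
    refine mul_left_cancel₀ (mul_pos h1 h2).ne' ?_
    linear_combination √(α 0) * √(α 1) * e1 + freq α 1 * √(α 1) * e2
  · rw [← s 1]
    refine mul_left_cancel₀ (mul_pos h0 h2).ne' ?_
    linear_combination √(α 0) * √(α 1) * e0 - freq α 0 * √(α 0) * e2
  · rw [← s 2]
    refine mul_left_cancel₀ (mul_pos h0 h1).ne' ?_
    linear_combination √(α 0) * √(α 2) * e0 - freq α 0 * √(α 0) * e1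

theorem IsAlpha.lam_sq (h : IsAlpha α) :
    lam α ^ 2 = freq α 0 ^ 2 - freq α 1 * freq α 2 := by
  unfold lam
  rw [Real.sq_sqrt]
  nlinarith [h.freq_sum, h.freq_pos1, h.freq_pos2, mul_pos h.freq_pos1 h.freq_pos2]

theorem IsAlpha.lam_pos (h : IsAlpha α) : 0 < lam α := by
  unfold lam
  refine Real.sqrt_pos.2 ?_
  have : freq α 0 = -(freq α 1 + freq α 2) := by linarith [h.freq_sum]
  rw [this]
  nlinarith [h.freq_pos1, h.freq_pos2, mul_pos h.freq_pos1 h.freq_pos2]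

theorem isAlpha_of_freq {a : Fin 3 → ℝ} (h0 : a 0 < 0) (h1 : 0 < a 1) (h2 : 0 < a 2)
    (hs : a 0 + a 1 + a 2 = 0) :
    IsAlpha ![a 1 * a 2, -a 0 * a 2, -a 0 * a 1] ∧
      ∀ j, freq ![a 1 * a 2, -a 0 * a 2, -a 0 * a 1] j = a j := by
  have h0' : 0 < -a 0 := by linarith
  have p0 := mul_pos h1 h2
  have p1 := mul_pos h0' h2
  have p2 := mul_pos h0' h1
  constructor
  · constructor
    · intro j; fin_cases j
      exacts [p0, p1, p2]
    · simp only [Matrix.cons_val_zero, Matrix.cons_val_one, Matrix.cons_val]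
      have := h0.ne
      field_simp
      linarith
  · have key : ∀ x y z : ℝ, 0 < x → 0 < y → 0 < z → √(x * y * (x * z)) / √(y * z) = x := by
      intro x y z hx hy hz
      rw [show x * y * (x * z) = x ^ 2 * (y * z) by ring, Real.sqrt_mul (by positivity),
        Real.sqrt_sq hx.le, mul_div_assoc, div_self (by positivity), mul_one]
    intro j
    fin_cases j
    · have := key _ _ _ h0' h2 h1
      simp only [freq, Fin.zero_eta, Matrix.cons_val_zero, Matrix.cons_val_one, Matrix.cons_val]
      rw [mul_comm (a 1) (a 2), this, neg_neg]
    · have := key _ _ _ h1 h0' h2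
      simp only [freq, Fin.mk_one, Matrix.cons_val_zero, Matrix.cons_val_one, Matrix.cons_val]
      rwa [mul_comm (-a 0) (a 1)]
    · have := key _ _ _ h2 h1 h0'
      simp only [freq, Fin.reduceFinMk, Matrix.cons_val_zero, Matrix.cons_val_one, Matrix.cons_val]
      rwa [mul_comm (a 1) (a 2), mul_comm (-a 0) (a 2), mul_comm (-a 0) (a 1)]

theorem existsUnique_alpha {a : Fin 3 → ℝ} (h0 : a 0 < 0) (h1 : 0 < a 1) (h2 : 0 < a 2)
    (hs : a 0 + a 1 + a 2 = 0) : ∃! α : Fin 3 → ℝ, IsAlpha α ∧ ∀ j, freq α j = a j := by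
  refine ⟨_, isAlpha_of_freq h0 h1 h2 hs, ?_⟩
  rintro α ⟨hα, hf⟩
  obtain ⟨e0, e1, e2⟩ := hα.eq_freq_mul
  simp only [hf] at e0 e1 e2
  funext j
  fin_cases j
  · simpa using e0
  · simpa using e1
  · simpa using e2

end Freq

/-! ### Eigenvectors of the evolution matrix -/

theorem evolMatrix_mulVec_eq_iff {α x y : Fin 3 → ℝ} {μ : ℝ} :
    (evolMatrix α).mulVec ![x 0, x 1, x 2, y 0, y 1, y 2] = μ • ![x 0, x 1, x 2, y 0, y 1, y 2] ↔
      (-2 * freq α 0 * x 0 - √(α 2) * y 1 - √(α 1) * y 2 = μ * x 0 ∧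
      -2 * freq α 1 * x 1 + √(α 2) * y 0 + √(α 0) * y 2 = μ * x 1 ∧
      -2 * freq α 2 * x 2 + √(α 1) * y 0 + √(α 0) * y 1 = μ * x 2) ∧
      √(α 2) * x 1 + √(α 1) * x 2 + 2 * freq α 0 * y 0 = μ * y 0 ∧
      -√(α 2) * x 0 - √(α 0) * x 2 + 2 * freq α 1 * y 1 = μ * y 1 ∧
      -√(α 1) * x 0 - √(α 0) * x 1 + 2 * freq α 2 * y 2 = μ * y 2 := by
  rw [funext_iff]
  simp only [Fin.forall_fin_succ, evolMatrix, Matrix.mulVec, dotProduct, Fin.sum_univ_succ]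
  simp [-neg_mul, -mul_eq_mul_left_iff]
  constructor
  · rintro ⟨h0, h1, h2, h3, h4, h5⟩
    refine ⟨⟨?_, ?_, ?_⟩, ?_, ?_, ?_⟩ <;> linarith
  · rintro ⟨⟨h0, h1, h2⟩, h3, h4, h5⟩
    refine ⟨?_, ?_, ?_, ?_, ?_, ?_⟩ <;> linarith

/-- The eigenvalue equation for `(x, y)` in terms of `S j = (x j + y j) / √(α j)` and
`D j = (x j - y j) / √(α j)`. -/
def IsNormalEigen (a : Fin 3 → ℝ) (μ : ℝ) (S D : Fin 3 → ℝ) : Prop :=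
  ∀ j, μ * S j = -a j * (D j + (D 0 + D 1 + D 2)) ∧ μ * D j = a j * (S 0 + S 1 + S 2 - 3 * S j)

/-- Exchanging `x` and `y` turns `M` into `-M`, so sums couple only to differences. Division by `√(α
j)` then removes all square roots through `mul_sqrt`, leaving coefficients linear in the
frequencies. -/
theorem IsAlpha.isNormalEigen_iff {α : Fin 3 → ℝ} (h : IsAlpha α) {x y S D : Fin 3 → ℝ} {μ : ℝ}
    (hx : ∀ j, x j = √(α j) * (S j + D j) / 2) (hy : ∀ j, y j = √(α j) * (S j - D j) / 2) :
    (evolMatrix α).mulVec ![x 0, x 1, x 2, y 0, y 1, y 2] = μ • ![x 0, x 1, x 2, y 0, y 1, y 2] ↔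
      IsNormalEigen (freq α) μ S D := by
  obtain ⟨e0, e1, e2⟩ := h.mul_sqrt
  have p0 := (h.sqrt_pos 0).ne'
  have p1 := (h.sqrt_pos 1).ne'
  have p2 := (h.sqrt_pos 2).ne'
  rw [evolMatrix_mulVec_eq_iff]
  simp only [hx, hy, IsNormalEigen, Fin.forall_fin_succ, Fin.succ_zero_eq_one, Fin.succ_one_eq_two,
    IsEmpty.forall_iff, and_true]
  constructor
  · rintro ⟨⟨h0, h1, h2⟩, h3, h4, h5⟩
    refine ⟨⟨?_, ?_⟩, ⟨?_, ?_⟩, ?_, ?_⟩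
    · refine mul_left_cancel₀ p0 ?_
      linear_combination -h0 - h3 + (D 1 + D 2) * e0
    · refine mul_left_cancel₀ p0 ?_
      linear_combination -h0 + h3 - (S 1 + S 2) * e0
    · refine mul_left_cancel₀ p1 ?_
      linear_combination -h1 - h4 - (D 0 + D 2) * e1
    · refine mul_left_cancel₀ p1 ?_
      linear_combination -h1 + h4 + (S 0 + S 2) * e1
    · refine mul_left_cancel₀ p2 ?_
      linear_combination -h2 - h5 - (D 0 + D 1) * e2
    · refine mul_left_cancel₀ p2 ?_
      linear_combination -h2 + h5 + (S 0 + S 1) * e2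
  · rintro ⟨⟨h0, h1⟩, ⟨h2, h3⟩, h4, h5⟩
    refine ⟨⟨?_, ?_, ?_⟩, ?_, ?_, ?_⟩
    · linear_combination -√(α 0) / 2 * (h0 + h1) - (S 1 + S 2 - D 1 - D 2) / 2 * e0
    · linear_combination -√(α 1) / 2 * (h2 + h3) + (S 0 + S 2 - D 0 - D 2) / 2 * e1
    · linear_combination -√(α 2) / 2 * (h4 + h5) + (S 0 + S 1 - D 0 - D 1) / 2 * e2
    · linear_combination -√(α 0) / 2 * (h0 - h1) + (S 1 + S 2 + D 1 + D 2) / 2 * e0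
    · linear_combination -√(α 1) / 2 * (h2 - h3) - (S 0 + S 2 + D 0 + D 2) / 2 * e1
    · linear_combination -√(α 2) / 2 * (h4 - h5) - (S 0 + S 1 + D 0 + D 1) / 2 * e2

theorem IsEigenpair.exists_isNormalEigen {α : Fin 3 → ℝ} (h : IsAlpha α) {x y : Fin 3 → ℝ} {μ : ℝ}
    (he : IsEigenpair α μ x y) :
    ∃ S D : Fin 3 → ℝ, (∀ j, x j = √(α j) * (S j + D j) / 2) ∧
      (∀ j, y j = √(α j) * (S j - D j) / 2) ∧ IsNormalEigen (freq α) μ S D := by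
  have hp := fun j => (h.sqrt_pos j).ne'
  have hx : ∀ j, x j = √(α j) * ((x j + y j) / √(α j) + (x j - y j) / √(α j)) / 2 := fun j => by
    have := hp j
    field_simp
    ring
  have hy : ∀ j, y j = √(α j) * ((x j + y j) / √(α j) - (x j - y j) / √(α j)) / 2 := fun j => by
    have := hp j
    field_simp
    ring
  exact ⟨fun j => (x j + y j) / √(α j), fun j => (x j - y j) / √(α j), hx, hy,
    (h.isNormalEigen_iff hx hy).1 he.2.2⟩

/-- The differences `a₁ - a₂, a₂ - a₀, a₀ - a₁`. -/
def cyclicDiff (a : Fin 3 → ℝ) : Fin 3 → ℝ := ![a 1 - a 2, a 2 - a 0, a 0 - a 1]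

theorem forall_fin3 {P : Fin 3 → Prop} (h0 : P 0) (h1 : P 1) (h2 : P 2) : ∀ j, P j := by
  intro j
  fin_cases j <;> assumption

theorem isNormalEigen_lam {a : Fin 3 → ℝ} {l : ℝ} (hs : a 0 + a 1 + a 2 = 0)
    (hl : l ^ 2 = a 0 ^ 2 - a 1 * a 2) :
    IsNormalEigen a l (fun j => a j ^ 2 * cyclicDiff a j) (fun j => -l * a j * cyclicDiff a j) := by
  have h0 : a 0 = -a 1 - a 2 := by linarith
  rw [h0] at hl
  refine forall_fin3 ?_ ?_ ?_ <;>
    simp only [cyclicDiff, Matrix.cons_val_zero, Matrix.cons_val_one, Matrix.cons_val, h0] <;>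
    constructor
  · ring
  · linear_combination -(-a 1 - a 2) * (a 1 - a 2) * hl
  · ring
  · linear_combination -(a 1) * (a 2 - (-a 1 - a 2)) * hl
  · ring
  · linear_combination -(a 2) * ((-a 1 - a 2) - a 1) * hl

theorem isNormalEigen_three_lam {a : Fin 3 → ℝ} {l : ℝ} (hs : a 0 + a 1 + a 2 = 0)
    (hl : l ^ 2 = a 0 ^ 2 - a 1 * a 2) :
    IsNormalEigen a (3 * l) (fun j => -a j * (a j ^ 2 + 2 * l ^ 2)) (fun j => 3 * l * a j ^ 2) := by
  have h0 : a 0 = -a 1 - a 2 := by linarith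
  rw [h0] at hl
  refine forall_fin3 ?_ ?_ ?_ <;> simp only [h0] <;> constructor
  · linear_combination (-6 * l * (-a 1 - a 2)) * hl
  · linear_combination 3 * (-a 1 - a 2) ^ 2 * hl
  · linear_combination (-6 * l * (a 1)) * hl
  · linear_combination 3 * (a 1) ^ 2 * hl
  · linear_combination (-6 * l * (a 2)) * hl
  · linear_combination 3 * (a 2) ^ 2 * hl

/-- Simplicity of the eigenvalue `l`. Eliminating `S` expresses each `D j` through the two sums `σ`
and `d`, with denominators that are products of differences of frequencies; it remains to see that
`d = 0`, which leaves only the scale `σ`. -/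
theorem IsNormalEigen.eq_of_lam {a S D : Fin 3 → ℝ} {l : ℝ} (hs : a 0 + a 1 + a 2 = 0)
    (hl : l ^ 2 = a 0 ^ 2 - a 1 * a 2) (hl0 : l ≠ 0) (hne : ∀ j, 3 * a j ^ 2 - l ^ 2 ≠ 0)
    (h : IsNormalEigen a l S D) :
    ∃ ρ : ℝ, ∀ j, S j = ρ * (a j ^ 2 * cyclicDiff a j) ∧ D j = ρ * (-l * a j * cyclicDiff a j) := by
  have h0 : a 0 = -a 1 - a 2 := by linarith
  have hD : ∀ j, (l ^ 2 - 3 * a j ^ 2) * D j =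
      a j * l * (S 0 + S 1 + S 2) + 3 * a j ^ 2 * (D 0 + D 1 + D 2) := fun j => by
    linear_combination l * (h j).2 - 3 * a j * (h j).1
  set σ := S 0 + S 1 + S 2
  set d := D 0 + D 1 + D 2 with hd
  set Δ := (a 0 - a 1) * (a 1 - a 2) * (a 2 - a 0) with hΔ
  have f0 : 3 * a 0 ^ 2 - l ^ 2 = (a 0 - a 1) * (a 0 - a 2) := by rw [hl, h0]; ring
  have f1 : 3 * a 1 ^ 2 - l ^ 2 = (a 1 - a 0) * (a 1 - a 2) := by rw [hl, h0]; ring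
  have f2 : 3 * a 2 ^ 2 - l ^ 2 = (a 2 - a 0) * (a 2 - a 1) := by rw [hl, h0]; ring
  have hΔ0 : Δ ≠ 0 := by
    have g0 := hne 0
    have g1 := hne 1
    rw [f0] at g0
    rw [f1] at g1
    have k0 := left_ne_zero_of_mul g0
    have k1 := right_ne_zero_of_mul g1
    have k2 : a 2 - a 0 ≠ 0 := fun hh => right_ne_zero_of_mul g0 (by linarith)
    exact mul_ne_zero (mul_ne_zero k0 k1) k2
  have hΔD : ∀ j, Δ * D j = cyclicDiff a j * (a j * l * σ + 3 * a j ^ 2 * d) := by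
    refine forall_fin3 ?_ ?_ ?_ <;>
      simp only [cyclicDiff, Matrix.cons_val_zero, Matrix.cons_val_one, Matrix.cons_val]
    · rw [← hD 0, ← neg_sub (3 * a 0 ^ 2), f0]; ring
    · rw [← hD 1, ← neg_sub (3 * a 1 ^ 2), f1]; ring
    · rw [← hD 2, ← neg_sub (3 * a 2 ^ 2), f2]; ring
  -- Summing `hΔD` over `j`, the terms in `σ` cancel because `∑ a j * cyclicDiff a j = 0`, and `∑ a
  -- j ^ 2 * cyclicDiff a j = -Δ` turns the rest into `Δ d = -3 Δ d`.
  have hd0 : d = 0 := by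
    have t0 := hΔD 0
    have t1 := hΔD 1
    have t2 := hΔD 2
    simp only [cyclicDiff, Matrix.cons_val_zero, Matrix.cons_val_one, Matrix.cons_val] at t0 t1 t2
    have : Δ * (4 * d) = 0 := by
      linear_combination t0 + t1 + t2 + Δ * hd + 3 * d * hΔ
    have := (mul_eq_zero.1 this).resolve_left hΔ0
    linarith
  have key : ∀ j, D j = -σ / Δ * (-l * a j * cyclicDiff a j) := fun j => by
    have := hΔD j
    rw [hd0] at this
    field_simp
    linear_combination this
  refine ⟨-σ / Δ, fun j => ⟨mul_left_cancel₀ hl0 ?_, key j⟩⟩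
  rw [(h j).1, ← hd, hd0]
  linear_combination -a j * key j

/-- Simplicity of the eigenvalue `3l`. After elimination of `S` the denominators are `G j = 3l² - a
j ^ 2 > 0`. As the `a j` are the roots of `x³ - l²x - e`, each `D j / a j` is a multiple of `a j`
plus `δ / G j` with a common `δ`, and it remains to see that `δ = 0`. -/
theorem IsNormalEigen.eq_of_three_lam {a S D : Fin 3 → ℝ} {l : ℝ} (hs : a 0 + a 1 + a 2 = 0)
    (hl : l ^ 2 = a 0 ^ 2 - a 1 * a 2) (hl0 : l ≠ 0) (ha : ∀ j, a j ≠ 0)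
    (h : IsNormalEigen a (3 * l) S D) :
    ∃ τ : ℝ, ∀ j, S j = τ * (-a j * (a j ^ 2 + 2 * l ^ 2)) ∧ D j = τ * (3 * l * a j ^ 2) := by
  have h0 : a 0 = -a 1 - a 2 := by linarith
  set σ := S 0 + S 1 + S 2 with hσ
  set d := D 0 + D 1 + D 2 with hd
  set G : Fin 3 → ℝ := fun j => 3 * l ^ 2 - a j ^ 2 with hG
  have hGpos : ∀ j, 0 < G j := by
    have p0 := (pow_pos (sq_pos_of_ne_zero (ha 0)) 1)
    have p1 := (pow_pos (sq_pos_of_ne_zero (ha 1)) 1)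
    have p2 := (pow_pos (sq_pos_of_ne_zero (ha 2)) 1)
    rw [h0] at p0
    refine forall_fin3 ?_ ?_ ?_ <;> simp only [hG] <;> rw [hl, h0] <;>
      nlinarith [sq_nonneg (a 1 - a 2), sq_nonneg (a 1 + a 2), sq_nonneg (a 1 + 2 * a 2),
        sq_nonneg (a 2 + 2 * a 1)]
  set e := a 0 * a 1 * a 2 with he
  have hcub : ∀ j, a j ^ 3 = l ^ 2 * a j + e := by
    refine forall_fin3 ?_ ?_ ?_ <;> rw [hl, he, h0] <;> ring
  set δ := l * σ + d * e / (2 * l ^ 2) with hδ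
  have hD : ∀ j, G j * D j = a j * l * σ + a j ^ 2 * d := fun j => by
    simp only [hG]
    linear_combination l * (h j).2 - a j * (h j).1
  have hD' : ∀ j, D j / a j = d * a j / (2 * l ^ 2) + δ / G j := fun j => by
    have g := (hGpos j).ne'
    have aj := ha j
    rw [div_add_div _ _ (by positivity) g, div_eq_div_iff aj (by positivity), hδ]
    field_simp
    have := hcub j
    have hg : G j = 3 * l ^ 2 - a j ^ 2 := rfl
    linear_combination 2 * l ^ 2 * hD j - a j ^ 2 * d * hg + a j * d * this
  -- The second eigenvalue equation, divided by `a j` and summed, gives `∑ D j / a j = 0`. As `∑ a j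
  -- = 0`, only `δ ∑ 1 / G j = 0` survives, and the sum is positive.
  have hδ0 : δ = 0 := by
    have t0 : 3 * l * (D 0 / a 0 + D 1 / a 1 + D 2 / a 2) = 0 := by
      have e' : ∀ j, 3 * l * (D j / a j) = σ - 3 * S j := fun j => by
        have aj := ha j
        rw [← mul_div_assoc, (h j).2, ← hσ]
        field_simp
      linear_combination e' 0 + e' 1 + e' 2 + 3 * hσ
    have t1 := (mul_eq_zero.1 t0).resolve_left (by positivity)
    rw [hD', hD', hD'] at t1
    have t2 : δ * (1 / G 0 + 1 / G 1 + 1 / G 2) = 0 := by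
      linear_combination t1 - d / (2 * l ^ 2) * hs
    refine (mul_eq_zero.1 t2).resolve_right ?_
    have := hGpos 0
    have := hGpos 1
    have := hGpos 2
    positivity
  have key : ∀ j, D j = d / (6 * l ^ 3) * (3 * l * a j ^ 2) := fun j => by
    have aj := ha j
    have := hD' j
    rw [hδ0, zero_div, add_zero, div_eq_iff aj] at this
    rw [this]
    field_simp
    ring
  refine ⟨d / (6 * l ^ 3), fun j => ⟨mul_left_cancel₀ (mul_ne_zero three_ne_zero hl0) ?_, key j⟩⟩
  rw [(h j).1, key j, ← hd]
  field_simp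
  ring

/-! ### Consequences for the data of a family -/

namespace Data

variable {S : Data}

/-- The numerical nondegeneracy of the eigenvectors. -/
structure IsNondegenerate (S : Data) : Prop where
  quad : S.c 0 ^ 2 - S.c 1 ^ 2 - S.c 2 ^ 2 - S.d 0 ^ 2 + S.d 1 ^ 2 + S.d 2 ^ 2 ≠ 0
  sub1 : (S.c 0 - S.d 0) * (S.e 1 - S.f 1) - (S.c 1 - S.d 1) * (S.e 0 - S.f 0) ≠ 0
  sub2 : (S.c 0 - S.d 0) * (S.e 2 - S.f 2) - (S.c 2 - S.d 2) * (S.e 0 - S.f 0) ≠ 0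
  add1 : (S.c 0 + S.d 0) * (S.e 1 + S.f 1) - (S.c 1 + S.d 1) * (S.e 0 + S.f 0) ≠ 0
  add2 : (S.c 0 + S.d 0) * (S.e 2 + S.f 2) - (S.c 2 + S.d 2) * (S.e 0 + S.f 0) ≠ 0

theorem lam_eq {a : Fin 3 → ℤ} {l : ℤ} (hf : IsFreq a l) (hS : S.IsValid)
    (ha : ∀ j, freq S.α j = a j) : lam S.α = l := by
  have h := hS.1.lam_sq
  rw [ha, ha, ha] at h
  have hl : (l : ℝ) ^ 2 = a 0 ^ 2 - a 1 * a 2 := by exact_mod_cast hf.l_sq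
  have hl0 : (0 : ℝ) < l := by exact_mod_cast hf.l_pos
  exact (pow_left_inj₀ hS.1.lam_pos.le hl0.le two_ne_zero).1 (h.trans hl.symm)

/-- With the explicit eigenvectors, `quad` is a nonzero factor times a sum of squares, the `sub`
determinants contain `a₀² + a₁² + a₂²`, and the `add` determinants contain `a₀² + 5a₀aᵢ + aᵢ²`. The
first fact lets the admissibility equation be solved for a parameter; the determinants let `(Z, W)`
be recovered from two components of `amp`. -/
theorem IsValid.isNondegenerate {a : Fin 3 → ℤ} {l : ℤ} (hf : IsFreq a l) (hS : S.IsValid)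
    (ha : ∀ j, freq S.α j = a j) : S.IsNondegenerate := by
  have hlam := lam_eq hf hS ha
  obtain ⟨hα, hc, he⟩ := hS
  have hl0 : (0 : ℝ) < l := by exact_mod_cast hf.l_pos
  have hs := hα.freq_sum
  have hl := hα.lam_sq
  obtain ⟨s, D, hcs, hds, hn⟩ := hc.exists_isNormalEigen hα
  obtain ⟨s', D', hes, hfs, hn'⟩ := he.exists_isNormalEigen hα
  obtain ⟨ρ, hρ⟩ := hn.eq_of_lam hs hl hα.lam_pos.ne' (fun j => by
    rw [ha, hlam]; exact hf.three_mul_sq_sub_ne_zero (a j))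
  obtain ⟨τ, hτ⟩ := hn'.eq_of_three_lam hs hl hα.lam_pos.ne'
    (forall_fin3 hα.freq_neg.ne hα.freq_pos1.ne' hα.freq_pos2.ne')
  have hρ0 : ρ ≠ 0 := by
    rintro rfl
    exact hc.1 (funext fun j => by rw [hcs, (hρ j).1, (hρ j).2]; simp)
  have hτ0 : τ ≠ 0 := by
    rintro rfl
    exact he.1 (funext fun j => by rw [hes, (hτ j).1, (hτ j).2]; simp)
  have n0 := hα.freq_neg
  have n1 := hα.freq_pos1
  have n2 := hα.freq_pos2
  have lp := hα.lam_pos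
  have s0 := (hα.sqrt_pos 0).ne'
  have s1 := (hα.sqrt_pos 1).ne'
  have s2 := (hα.sqrt_pos 2).ne'
  have csum : ∀ j, S.c j + S.d j = √(S.α j) * s j := fun j => by rw [hcs, hds]; ring
  have cdiff : ∀ j, S.c j - S.d j = √(S.α j) * D j := fun j => by rw [hcs, hds]; ring
  have esum : ∀ j, S.e j + S.f j = √(S.α j) * s' j := fun j => by rw [hes, hfs]; ring
  have ediff : ∀ j, S.e j - S.f j = √(S.α j) * D' j := fun j => by rw [hes, hfs]; ring
  have q1 : freq S.α 0 ^ 2 + 5 * freq S.α 0 * freq S.α 1 + freq S.α 1 ^ 2 ≠ 0 := by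
    rw [ha, ha]; exact sq_add_five_mul_add_sq_ne_zero hf.pos1.ne'
  have q2 : freq S.α 0 ^ 2 + 5 * freq S.α 0 * freq S.α 2 + freq S.α 2 ^ 2 ≠ 0 := by
    rw [ha, ha]; exact sq_add_five_mul_add_sq_ne_zero hf.pos2.ne'
  have sq : ∀ j, √(S.α j) ^ 2 = S.α j := fun j => Real.sq_sqrt (hα.1 j).le
  obtain ⟨m0, m1, m2⟩ := hα.freq_mul
  have a2 : freq S.α 2 = -freq S.α 0 - freq S.α 1 := by linarith
  have a2' : freq S.α 1 = -freq S.α 0 - freq S.α 2 := by linarith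
  refine ⟨?_, ?_, ?_, ?_, ?_⟩
  · have : S.c 0 ^ 2 - S.c 1 ^ 2 - S.c 2 ^ 2 - S.d 0 ^ 2 + S.d 1 ^ 2 + S.d 2 ^ 2 =
        √(S.α 0) * √(S.α 1) * √(S.α 2) * ρ ^ 2 * lam S.α *
          ((freq S.α 0 * cyclicDiff (freq S.α) 0) ^ 2 + (freq S.α 1 * cyclicDiff (freq S.α) 1) ^ 2
            + (freq S.α 2 * cyclicDiff (freq S.α) 2) ^ 2) := by
      have t : ∀ j, S.c j ^ 2 - S.d j ^ 2 = -(freq S.α j * S.α j) * ρ ^ 2 * lam S.α *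
          (freq S.α j * cyclicDiff (freq S.α) j) ^ 2 := fun j => by
        rw [show S.c j ^ 2 - S.d j ^ 2 = (S.c j + S.d j) * (S.c j - S.d j) by ring, csum, cdiff,
          (hρ j).1, (hρ j).2, ← sq j, Real.sqrt_sq (Real.sqrt_nonneg _)]
        ring
      have t0 := t 0
      have t1 := t 1
      have t2 := t 2
      rw [m0] at t0
      rw [m1] at t1
      rw [m2] at t2
      linear_combination t0 - t1 - t2
    rw [this]
    have : 0 < (freq S.α 1 * cyclicDiff (freq S.α) 1) ^ 2 := by
      have : 0 < freq S.α 1 * cyclicDiff (freq S.α) 1 :=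
        mul_pos n1 (by simp [cyclicDiff]; linarith)
      positivity
    have := hα.sqrt_pos 0
    have := hα.sqrt_pos 1
    have := hα.sqrt_pos 2
    positivity
  · rw [cdiff, ediff, cdiff, ediff, (hρ 0).2, (hρ 1).2, (hτ 0).2, (hτ 1).2]
    have : √(S.α 0) * (ρ * (-lam S.α * freq S.α 0 * cyclicDiff (freq S.α) 0)) *
        (√(S.α 1) * (τ * (3 * lam S.α * freq S.α 1 ^ 2))) -
        √(S.α 1) * (ρ * (-lam S.α * freq S.α 1 * cyclicDiff (freq S.α) 1)) *
        (√(S.α 0) * (τ * (3 * lam S.α * freq S.α 0 ^ 2))) =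
        √(S.α 0) * √(S.α 1) * ρ * τ * lam S.α ^ 2 * freq S.α 0 * freq S.α 1 * (-3) *
          (freq S.α 0 ^ 2 + freq S.α 1 ^ 2 + freq S.α 2 ^ 2) := by
      simp only [cyclicDiff, Matrix.cons_val_zero, Matrix.cons_val_one, a2]
      ring
    rw [this]
    have := n0.ne
    positivity
  · rw [cdiff, ediff, cdiff, ediff, (hρ 0).2, (hρ 2).2, (hτ 0).2, (hτ 2).2]
    have : √(S.α 0) * (ρ * (-lam S.α * freq S.α 0 * cyclicDiff (freq S.α) 0)) *
        (√(S.α 2) * (τ * (3 * lam S.α * freq S.α 2 ^ 2))) -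
        √(S.α 2) * (ρ * (-lam S.α * freq S.α 2 * cyclicDiff (freq S.α) 2)) *
        (√(S.α 0) * (τ * (3 * lam S.α * freq S.α 0 ^ 2))) =
        √(S.α 0) * √(S.α 2) * ρ * τ * lam S.α ^ 2 * freq S.α 0 * freq S.α 2 * 3 *
          (freq S.α 0 ^ 2 + freq S.α 1 ^ 2 + freq S.α 2 ^ 2) := by
      simp only [cyclicDiff, Matrix.cons_val_zero, Matrix.cons_val, a2']
      ring
    rw [this]
    have := n0.ne
    positivity
  · rw [csum, esum, csum, esum, (hρ 0).1, (hρ 1).1, (hτ 0).1, (hτ 1).1]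
    have : √(S.α 0) * (ρ * (freq S.α 0 ^ 2 * cyclicDiff (freq S.α) 0)) *
        (√(S.α 1) * (τ * (-freq S.α 1 * (freq S.α 1 ^ 2 + 2 * lam S.α ^ 2)))) -
        √(S.α 1) * (ρ * (freq S.α 1 ^ 2 * cyclicDiff (freq S.α) 1)) *
        (√(S.α 0) * (τ * (-freq S.α 0 * (freq S.α 0 ^ 2 + 2 * lam S.α ^ 2)))) =
        √(S.α 0) * √(S.α 1) * ρ * τ * lam S.α ^ 2 * freq S.α 0 * freq S.α 1 * (-2) *
          (freq S.α 0 ^ 2 + 5 * freq S.α 0 * freq S.α 1 + freq S.α 1 ^ 2) := by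
      simp only [cyclicDiff, Matrix.cons_val_zero, Matrix.cons_val_one, hl, a2]
      ring
    rw [this]
    have := n0.ne
    positivity
  · rw [csum, esum, csum, esum, (hρ 0).1, (hρ 2).1, (hτ 0).1, (hτ 2).1]
    have : √(S.α 0) * (ρ * (freq S.α 0 ^ 2 * cyclicDiff (freq S.α) 0)) *
        (√(S.α 2) * (τ * (-freq S.α 2 * (freq S.α 2 ^ 2 + 2 * lam S.α ^ 2)))) -
        √(S.α 2) * (ρ * (freq S.α 2 ^ 2 * cyclicDiff (freq S.α) 2)) *
        (√(S.α 0) * (τ * (-freq S.α 0 * (freq S.α 0 ^ 2 + 2 * lam S.α ^ 2)))) =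
        √(S.α 0) * √(S.α 2) * ρ * τ * lam S.α ^ 2 * freq S.α 0 * freq S.α 2 * 2 *
          (freq S.α 0 ^ 2 + 5 * freq S.α 0 * freq S.α 2 + freq S.α 2 ^ 2) := by
      simp only [cyclicDiff, Matrix.cons_val_zero, Matrix.cons_val, hl, a2']
      ring
    rw [this]
    have := n0.ne
    positivity

/-- The orthogonality relations between `(c, d)`, `(e, f)`, their reflections, and the kernel of
the evolution matrix. -/
theorem IsValid.pairings (hS : S.IsValid) :
    √(S.α 0) * (S.c 0 - S.d 0) - √(S.α 1) * (S.c 1 - S.d 1) - √(S.α 2) * (S.c 2 - S.d 2) = 0 ∧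
    √(S.α 0) * (S.e 0 - S.f 0) - √(S.α 1) * (S.e 1 - S.f 1) - √(S.α 2) * (S.e 2 - S.f 2) = 0 ∧
    (S.c 0 * S.e 0 - S.d 0 * S.f 0) - (S.c 1 * S.e 1 - S.d 1 * S.f 1)
      - (S.c 2 * S.e 2 - S.d 2 * S.f 2) = 0 ∧
    (S.d 0 * S.e 0 - S.c 0 * S.f 0) - (S.d 1 * S.e 1 - S.c 1 * S.f 1)
      - (S.d 2 * S.e 2 - S.c 2 * S.f 2) = 0 := by
  obtain ⟨hα, hc, he⟩ := hS
  obtain ⟨⟨c0, c1, c2⟩, c3, c4, c5⟩ := evolMatrix_mulVec_eq_iff.1 hc.2.2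
  obtain ⟨⟨e0, e1, e2⟩, e3, e4, e5⟩ := evolMatrix_mulVec_eq_iff.1 he.2.2
  obtain ⟨m0, m1, m2⟩ := hα.mul_sqrt
  have hl := hα.lam_pos.ne'
  -- `M` is symmetric for the form `diag(1, -1, -1, -1, 1, 1)`, so eigenvectors with different
  -- eigenvalues are orthogonal for it. The vector `(√α, √α)` lies in the kernel, and `(d, c)` has
  -- eigenvalue `-λ`; the eigenvalue gaps used are `λ`, `3λ`, `2λ` and `4λ`.
  refine ⟨?_, ?_, ?_, ?_⟩
  · refine (mul_eq_zero.1 ?_).resolve_left hl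
    linear_combination -√(S.α 0) * (c0 - c3) + √(S.α 1) * (c1 - c4) + √(S.α 2) * (c2 - c5)
      - 2 * (S.c 0 + S.d 0) * m0 - 2 * (S.c 1 + S.d 1) * m1 - 2 * (S.c 2 + S.d 2) * m2
  · refine (mul_eq_zero.1 ?_).resolve_left (mul_ne_zero three_ne_zero hl)
    linear_combination -√(S.α 0) * (e0 - e3) + √(S.α 1) * (e1 - e4) + √(S.α 2) * (e2 - e5)
      - 2 * (S.e 0 + S.f 0) * m0 - 2 * (S.e 1 + S.f 1) * m1 - 2 * (S.e 2 + S.f 2) * m2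
  · refine (mul_eq_zero.1 ?_).resolve_left (mul_ne_zero two_ne_zero hl)
    linear_combination (S.e 0 * c0 - S.e 1 * c1 - S.e 2 * c2 - S.f 0 * c3 + S.f 1 * c4 + S.f 2 * c5)
      - (S.c 0 * e0 - S.c 1 * e1 - S.c 2 * e2 - S.d 0 * e3 + S.d 1 * e4 + S.d 2 * e5)
  · refine (mul_eq_zero.1 ?_).resolve_left (mul_ne_zero four_ne_zero hl)
    linear_combination -(-S.f 0 * c0 + S.f 1 * c1 + S.f 2 * c2 + S.e 0 * c3 - S.e 1 * c4
      - S.e 2 * c5) - (S.d 0 * e0 - S.d 1 * e1 - S.d 2 * e2 - S.c 0 * e3 + S.c 1 * e4 + S.c 2 * e5)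

theorem exists_isValid {a : Fin 3 → ℤ} {l : ℤ} (hf : IsFreq a l) :
    ∃ S : Data, S.IsValid ∧ ∀ j, freq S.α j = a j := by
  have n0 : (a 0 : ℝ) < 0 := by exact_mod_cast hf.neg
  have n1 : (0 : ℝ) < a 1 := by exact_mod_cast hf.pos1
  have n2 : (0 : ℝ) < a 2 := by exact_mod_cast hf.pos2
  have hs : (a 0 : ℝ) + a 1 + a 2 = 0 := by exact_mod_cast hf.sum
  obtain ⟨hα, hfr⟩ := isAlpha_of_freq (a := fun j => (a j : ℝ)) n0 n1 n2 hs
  set α : Fin 3 → ℝ := ![(a 1 : ℝ) * a 2, -a 0 * a 2, -a 0 * a 1]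
  have hlp := hα.lam_pos
  have p1 := hα.sqrt_pos 1
  have p2 := hα.sqrt_pos 2
  have b0 := hα.freq_neg
  have b1 := hα.freq_pos1
  have b2 := hα.freq_pos2
  have hcyc : 0 < cyclicDiff (freq α) 1 := by simp [cyclicDiff]; linarith
  -- Nonvanishing is tested in component 1, where the four vectors are, up to nonzero factors, `a₁ ∓
  -- λ` and `(a₁ ∓ λ)(a₁ ∓ 2λ)`; hence `a₁ < λ` suffices.
  have hle : freq α 1 < lam α := by
    refine lt_of_pow_lt_pow_left₀ 2 hlp.le ?_
    rw [hα.lam_sq, show freq α 0 = -freq α 1 - freq α 2 by linarith [hα.freq_sum]]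
    nlinarith [mul_pos b1 b2]
  have e1 := isNormalEigen_lam hα.freq_sum hα.lam_sq
  have e2 := isNormalEigen_three_lam hα.freq_sum hα.lam_sq
  refine ⟨⟨α, fun j => √(α j) * (freq α j ^ 2 * cyclicDiff (freq α) j
        + -lam α * freq α j * cyclicDiff (freq α) j) / 2,
      fun j => √(α j) * (freq α j ^ 2 * cyclicDiff (freq α) j
        - -lam α * freq α j * cyclicDiff (freq α) j) / 2,
      fun j => √(α j) * (-freq α j * (freq α j ^ 2 + 2 * lam α ^ 2) + 3 * lam α * freq α j ^ 2) / 2,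
      fun j => √(α j) * (-freq α j * (freq α j ^ 2 + 2 * lam α ^ 2) -
        3 * lam α * freq α j ^ 2) / 2⟩,
    ⟨hα, ⟨?_, ?_, (hα.isNormalEigen_iff (fun j => rfl) (fun j => rfl)).2 e1⟩,
    ⟨?_, ?_, (hα.isNormalEigen_iff (fun j => rfl) (fun j => rfl)).2 e2⟩⟩, hfr⟩
  · intro h
    have := congrFun h 1
    simp only [Pi.zero_apply] at this
    have h2 : 0 < √(α 1) * freq α 1 * cyclicDiff (freq α) 1 * (lam α - freq α 1) :=
      mul_pos (by positivity) (by linarith)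
    linarith
  · intro h
    have := congrFun h 1
    simp only [Pi.zero_apply] at this
    have : 0 < √(α 1) * (freq α 1 ^ 2 * cyclicDiff (freq α) 1
        - -lam α * freq α 1 * cyclicDiff (freq α) 1) / 2 := by
      rw [neg_mul, neg_mul, sub_neg_eq_add]; positivity
    linarith
  · intro h
    have := congrFun h 1
    simp only [Pi.zero_apply] at this
    have h2 : 0 < √(α 1) * freq α 1 * ((freq α 1 - lam α) ^ 2 + lam α * (lam α - freq α 1)) := by
      have : 0 < lam α - freq α 1 := by linarith
      positivity
    nlinarith
  · intro h
    have := congrFun h 1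
    simp only [Pi.zero_apply] at this
    have h2 : 0 < √(α 1) * freq α 1 * ((freq α 1 ^ 2 + 2 * lam α ^ 2) + 3 * lam α * freq α 1) := by
      positivity
    nlinarith

end Data

/-! ### Special Lagrangian planes from conjugate cross products -/

/-- The complex conjugate of the cross product of two vectors of `ℂ³`. -/
noncomputable def conjCross (u v : C3) : C3 :=
  !₂[conj (u 1 * v 2 - u 2 * v 1), conj (u 2 * v 0 - u 0 * v 2), conj (u 0 * v 1 - u 1 * v 0)]

theorem C3.ext {u v : C3} (h0 : u 0 = v 0) (h1 : u 1 = v 1) (h2 : u 2 = v 2) : u = v := by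
  ext j
  fin_cases j <;> assumption

@[simp] theorem conjCross_zero (u v : C3) : conjCross u v 0 = conj (u 1 * v 2 - u 2 * v 1) := rfl
@[simp] theorem conjCross_one (u v : C3) : conjCross u v 1 = conj (u 2 * v 0 - u 0 * v 2) := rfl
@[simp] theorem conjCross_two (u v : C3) : conjCross u v 2 = conj (u 0 * v 1 - u 1 * v 0) := rfl

theorem C3.inner_eq (u v : C3) :
    (inner ℂ u v : ℂ) = v 0 * conj (u 0) + v 1 * conj (u 1) + v 2 * conj (u 2) := by
  simp [PiLp.inner_apply, Fin.sum_univ_three]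

theorem conjCross_smul_left (a : ℝ) (u v : C3) : conjCross (a • u) v = a • conjCross u v := by
  apply C3.ext <;> simp <;> ring

theorem conjCross_smul_right (a : ℝ) (u v : C3) : conjCross u (a • v) = a • conjCross u v := by
  apply C3.ext <;> simp <;> ring

theorem conjCross_add_right (u v w : C3) :
    conjCross u (v + w) = conjCross u v + conjCross u w := by
  apply C3.ext <;> simp <;> ring

theorem conjCross_add_left (u v w : C3) :
    conjCross (u + v) w = conjCross u w + conjCross v w := by
  apply C3.ext <;> simp <;> ring

theorem conjCross_self (u : C3) : conjCross u u = 0 := by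
  apply C3.ext <;> simp <;> ring

theorem inner_conjCross_left (u v : C3) : (inner ℂ u (conjCross u v) : ℂ) = 0 := by
  rw [C3.inner_eq]
  simp
  ring

theorem inner_conjCross_right (u v : C3) : (inner ℂ v (conjCross u v) : ℂ) = 0 := by
  rw [C3.inner_eq]
  simp
  ring

theorem inner_conjCross_self (u v : C3) : (inner ℂ (conjCross u v) (conjCross u v) : ℂ) =
    inner ℂ u u * inner ℂ v v - inner ℂ u v * inner ℂ v u := by
  simp only [C3.inner_eq]
  simp
  ring

/-- The conjugation in `conjCross` turns the determinant into a squared norm; its being real and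
nonnegative fixes the phase of the plane. -/
theorem holVol_conjCross (u v : C3) :
    holVol ![u, v, conjCross u v] = inner ℂ (conjCross u v) (conjCross u v) := by
  rw [holVol, Matrix.det_fin_three, C3.inner_eq]
  simp
  ring

theorem isSLPlane_of_orthonormal {u v : C3} (hu : (inner ℂ u u : ℂ) = 1)
    (hv : (inner ℂ v v : ℂ) = 1)
    (huv : (inner ℂ u v : ℂ) = 0) :
    IsSLPlane (Submodule.span ℝ (Set.range ![u, v, conjCross u v])) := by
  have hvu : (inner ℂ v u : ℂ) = 0 := by rw [← inner_conj_symm, huv, map_zero]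
  have hw : (inner ℂ (conjCross u v) (conjCross u v) : ℂ) = 1 := by
    rw [inner_conjCross_self, hu, hv, huv]; ring
  have h1 : (inner ℂ (conjCross u v) u : ℂ) = 0 := by
    rw [← inner_conj_symm, inner_conjCross_left, map_zero]
  have h2 : (inner ℂ (conjCross u v) v : ℂ) = 0 := by
    rw [← inner_conj_symm, inner_conjCross_right, map_zero]
  refine ⟨![u, v, conjCross u v], ?_, rfl, by rw [holVol_conjCross, hw, Complex.one_re]⟩
  intro i j
  fin_cases i <;> fin_cases j <;>
    simp [-inner_self_eq_norm_sq_to_K, hu, hv, huv, hvu, hw, h1, h2, inner_conjCross_left,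
      inner_conjCross_right]

/-- Gram–Schmidt with a real coefficient: since the Hermitian product is real, subtracting a real
multiple of `u` makes `v'` Hermitian-orthogonal to `u`, without changing the real span or the cross
product. -/
theorem isSLPlane_span {u v : C3} (him : (inner ℂ u v : ℂ).im = 0) (hne : conjCross u v ≠ 0) :
    IsSLPlane (Submodule.span ℝ (Set.range ![u, v, conjCross u v])) := by
  have hu : u ≠ 0 := by
    rintro rfl
    apply hne
    apply C3.ext <;> simp
  set t : ℝ := (inner ℂ u v : ℂ).re / ‖u‖ ^ 2 with ht
  set v' : C3 := v + (-t) • u with hv'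
  have hnu : ‖u‖ ≠ 0 := norm_ne_zero_iff.2 hu
  have hcross : conjCross u v' = conjCross u v := by
    rw [hv', conjCross_add_right, conjCross_smul_right, conjCross_self, smul_zero, add_zero]
  have hv0 : v' ≠ 0 := by
    intro h
    rw [h] at hcross
    apply hne
    rw [← hcross]
    apply C3.ext <;> simp
  have hnv : ‖v'‖ ≠ 0 := norm_ne_zero_iff.2 hv0
  have hreal : ∀ (r : ℝ) (x y : C3), (inner ℂ x (r • y) : ℂ) = r * inner ℂ x y := fun r x y => by
    rw [← Complex.coe_smul, inner_smul_right]
  have hreal' : ∀ (r : ℝ) (x y : C3), (inner ℂ (r • x) y : ℂ) = r * inner ℂ x y := fun r x y => by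
    rw [← Complex.coe_smul, inner_smul_left, Complex.conj_ofReal]
  have horth : (inner ℂ u v' : ℂ) = 0 := by
    rw [hv', inner_add_right, hreal, inner_self_eq_norm_sq_to_K, ht]
    apply Complex.ext
    · simp only [Complex.coe_algebraMap, Complex.add_re, Complex.zero_re]
      norm_cast
      field_simp
      ring
    · simp only [Complex.coe_algebraMap, Complex.add_im, Complex.zero_im, him]
      norm_cast
  have hunit : ∀ x : C3, ‖x‖ ≠ 0 → (inner ℂ (‖x‖⁻¹ • x) (‖x‖⁻¹ • x) : ℂ) = 1 := fun x hx => by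
    have hx' : (‖x‖ : ℂ) ≠ 0 := by exact_mod_cast hx
    rw [hreal, hreal', inner_self_eq_norm_sq_to_K]
    push_cast
    simp only [Complex.coe_algebraMap]
    field_simp
  have hmain := isSLPlane_of_orthonormal (hunit u hnu) (hunit v' hnv)
    (by rw [hreal, hreal', horth]; simp)
  rw [conjCross_smul_left, conjCross_smul_right, hcross] at hmain
  convert hmain using 1
  apply le_antisymm
  · rw [Submodule.span_le]
    rintro _ ⟨j, rfl⟩
    set V := Submodule.span ℝ (Set.range ![‖u‖⁻¹ • u, ‖v'‖⁻¹ • v', ‖u‖⁻¹ • ‖v'‖⁻¹ • conjCross u v])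
    have m0 : ‖u‖⁻¹ • u ∈ V := Submodule.subset_span ⟨0, rfl⟩
    have m1 : ‖v'‖⁻¹ • v' ∈ V := Submodule.subset_span ⟨1, rfl⟩
    have m2 : ‖u‖⁻¹ • ‖v'‖⁻¹ • conjCross u v ∈ V := Submodule.subset_span ⟨2, rfl⟩
    have m0' := V.smul_mem ‖u‖ m0
    have m1' := V.smul_mem ‖v'‖ m1
    have m2' := V.smul_mem ‖v'‖ (V.smul_mem ‖u‖ m2)
    rw [smul_inv_smul₀ hnu] at m0'
    rw [smul_inv_smul₀ hnv] at m1'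
    rw [smul_inv_smul₀ hnu, smul_inv_smul₀ hnv] at m2'
    fin_cases j
    · exact m0'
    · have := V.add_mem m1' (V.smul_mem t m0')
      rw [hv', add_assoc, ← add_smul, neg_add_cancel, zero_smul, add_zero] at this
      exact this
    · exact m2'
  · rw [Submodule.span_le]
    rintro _ ⟨j, rfl⟩
    set V := Submodule.span ℝ (Set.range ![u, v, conjCross u v])
    have m0 : u ∈ V := Submodule.subset_span ⟨0, rfl⟩
    have m1 : v ∈ V := Submodule.subset_span ⟨1, rfl⟩
    have m2 : conjCross u v ∈ V := Submodule.subset_span ⟨2, rfl⟩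
    fin_cases j
    · exact V.smul_mem _ m0
    · exact V.smul_mem _ (V.add_mem m1 (V.smul_mem _ m0))
    · exact V.smul_mem _ (V.smul_mem _ m2)

/-! ### Differentials whose third column is a multiple of the conjugate cross product -/

section Linear

variable {L : ℝ × ℝ × ℝ →L[ℝ] C3} {u v : C3} {c : ℝ}

theorem linear_apply (hu : L (1, 0, 0) = u) (hv : L (0, 1, 0) = v)
    (hw : L (0, 0, 1) = c • conjCross u v) (x : ℝ × ℝ × ℝ) :
    L x = x.1 • u + x.2.1 • v + (x.2.2 * c) • conjCross u v := by
  have : x = x.1 • ((1 : ℝ), (0 : ℝ), (0 : ℝ)) + x.2.1 • ((0 : ℝ), (1 : ℝ), (0 : ℝ))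
      + x.2.2 • ((0 : ℝ), (0 : ℝ), (1 : ℝ)) := by
    obtain ⟨a, b, d⟩ := x
    simp
  conv_lhs => rw [this]
  rw [map_add, map_add, map_smul, map_smul, map_smul, hu, hv, hw, smul_smul]

/-- Pairing with `conjCross u v` kills `u` and `v` and isolates the third coordinate; crossing with
`u` and with `v` then isolates the other two. -/
theorem injective_iff_conjCross_ne_zero (hc : 0 < c) (hu : L (1, 0, 0) = u) (hv : L (0, 1, 0) = v)
    (hw : L (0, 0, 1) = c • conjCross u v) : Function.Injective L ↔ conjCross u v ≠ 0 := by
  constructor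
  · intro hi h0
    rw [h0, smul_zero, ← map_zero L] at hw
    have := hi hw
    simp [Prod.ext_iff] at this
  · intro hne
    rw [injective_iff_map_eq_zero]
    rintro ⟨a, b, d⟩ h
    rw [linear_apply hu hv hw] at h
    simp only at h
    have hd : d = 0 := by
      have := congrArg (fun z => (inner ℂ z (conjCross u v) : ℂ)) h
      simp only [inner_add_left, inner_zero_left, ← Complex.coe_smul, inner_smul_left,
        inner_conjCross_left, inner_conjCross_right, mul_zero, zero_add, Complex.conj_ofReal]
        at this
      have := (mul_eq_zero.1 this).resolve_right (inner_self_ne_zero.2 hne)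
      have : d * c = 0 := by exact_mod_cast this
      exact (mul_eq_zero.1 this).resolve_right hc.ne'
    rw [hd, zero_mul, zero_smul, add_zero] at h
    have hb : b = 0 := by
      have := congrArg (conjCross u) h
      rw [conjCross_add_right, conjCross_smul_right, conjCross_smul_right, conjCross_self,
        smul_zero, zero_add] at this
      have h0 : conjCross u 0 = 0 := by apply C3.ext <;> simp
      rw [h0] at this
      exact (smul_eq_zero.1 this).resolve_right hne
    have ha : a = 0 := by
      have := congrArg (fun z => conjCross z v) h
      simp only [conjCross_add_left, conjCross_smul_left, conjCross_self, smul_zero,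
        add_zero] at this
      have h0 : conjCross 0 v = 0 := by apply C3.ext <;> simp
      rw [h0] at this
      exact (smul_eq_zero.1 this).resolve_right hne
    simp [ha, hb, hd]

theorem isSLPlane_range (hc : 0 < c) (hu : L (1, 0, 0) = u) (hv : L (0, 1, 0) = v)
    (hw : L (0, 0, 1) = c • conjCross u v) (him : (inner ℂ u v : ℂ).im = 0)
    (hne : conjCross u v ≠ 0) : IsSLPlane (LinearMap.range L.toLinearMap) := by
  convert isSLPlane_span him hne using 1
  apply le_antisymm
  · rintro _ ⟨x, rfl⟩
    rw [ContinuousLinearMap.coe_coe, linear_apply hu hv hw]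
    exact add_mem (add_mem (Submodule.smul_mem _ _ (Submodule.subset_span ⟨0, rfl⟩))
      (Submodule.smul_mem _ _ (Submodule.subset_span ⟨1, rfl⟩)))
      (Submodule.smul_mem _ _ (Submodule.subset_span ⟨2, rfl⟩))
  · rw [Submodule.span_le]
    rintro _ ⟨j, rfl⟩
    fin_cases j
    · exact ⟨_, hu⟩
    · exact ⟨_, hv⟩
    · refine ⟨c⁻¹ • (0, 0, 1), ?_⟩
      rw [ContinuousLinearMap.coe_coe, map_smul, hw, inv_smul_smul₀ hc.ne']
      rfl

end Linear

/-! ### Maps from quotients of `ℝ³` -/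

section Quotient

variable {E H M : Type*} [NormedAddCommGroup E] [NormedSpace ℝ E] [TopologicalSpace H]
  [TopologicalSpace M] [ChartedSpace H M] {I : ModelWithCorners ℝ E H}

/-- `π : ℝ³ → M` is a smooth surjection, with smooth local sections through every point. -/
structure HasSmoothSections (I : ModelWithCorners ℝ E H) (π : ℝ × ℝ × ℝ → M) : Prop where
  smooth : ContMDiff 𝓘(ℝ, ℝ × ℝ × ℝ) I ∞ π
  surj : Function.Surjective π
  section_exists : ∀ x, ∃ s : M → ℝ × ℝ × ℝ, ContMDiffAt I 𝓘(ℝ, ℝ × ℝ × ℝ) ∞ s (π x) ∧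
    s (π x) = x ∧ ∀ᶠ y in 𝓝 (π x), π (s y) = y

variable {π : ℝ × ℝ × ℝ → M} {F : M → C3} {Φ : ℝ × ℝ × ℝ → C3}

theorem HasSmoothSections.contMDiff (h : HasSmoothSections I π) (hΦ : ContDiff ℝ ∞ Φ)
    (hF : ∀ x, F (π x) = Φ x) : ContMDiff I 𝓘(ℝ, C3) ∞ F := by
  intro m
  obtain ⟨x, rfl⟩ := h.surj m
  obtain ⟨s, hs, hsx, hev⟩ := h.section_exists x
  have := (hΦ.contMDiff.contMDiffAt (x := s (π x))).comp (π x) hs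
  refine this.congr_of_eventuallyEq ?_
  filter_upwards [hev] with y hy
  rw [Function.comp_apply, ← hF, hy]

/-- A local section makes the differential surjective, and both sides have dimension 3. This
transfers immersion and tangent plane statements from `Φ` on `ℝ³` to the map on the quotient. -/
theorem HasSmoothSections.mfderiv_bijective [FiniteDimensional ℝ E] (h : HasSmoothSections I π)
    (hE : Module.finrank ℝ E = 3) (x : ℝ × ℝ × ℝ) :
    Function.Bijective (mfderiv 𝓘(ℝ, ℝ × ℝ × ℝ) I π x) := by
  obtain ⟨s, hs, hsx, hev⟩ := h.section_exists x
  have hπ : MDifferentiableAt 𝓘(ℝ, ℝ × ℝ × ℝ) I π (s (π x)) :=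
    (h.smooth.contMDiffAt).mdifferentiableAt (by simp)
  have hs' : MDifferentiableAt I 𝓘(ℝ, ℝ × ℝ × ℝ) s (π x) := hs.mdifferentiableAt (by simp)
  have hcomp := mfderiv_comp (π x) hπ hs'
  have hid : mfderiv I I (π ∘ s) (π x) = ContinuousLinearMap.id ℝ (TangentSpace I (π x)) := by
    rw [Filter.EventuallyEq.mfderiv_eq (f := id) (by
      filter_upwards [hev] with y hy
      exact hy), mfderiv_id]
  have hsurj : Function.Surjective (mfderiv 𝓘(ℝ, ℝ × ℝ × ℝ) I π x) := by
    intro w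
    refine ⟨mfderiv I 𝓘(ℝ, ℝ × ℝ × ℝ) s (π x) w, ?_⟩
    have := congrArg (fun T => T w) (hcomp.symm.trans hid)
    simp only [ContinuousLinearMap.comp_apply] at this
    rw [hsx] at this
    exact this
  let T : (ℝ × ℝ × ℝ) →ₗ[ℝ] E := (mfderiv 𝓘(ℝ, ℝ × ℝ × ℝ) I π x).toLinearMap
  have hd : Module.finrank ℝ (ℝ × ℝ × ℝ) = Module.finrank ℝ E := by
    rw [hE]; simp
  exact ⟨(LinearMap.injective_iff_surjective_of_finrank_eq_finrank (f := T) hd).2 hsurj, hsurj⟩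

theorem HasSmoothSections.mfderiv_comp_eq (h : HasSmoothSections I π) (hΦ : ContDiff ℝ ∞ Φ)
    (hF : ∀ x, F (π x) = Φ x) (x : ℝ × ℝ × ℝ) (v : ℝ × ℝ × ℝ) :
    fderiv ℝ Φ x v = mfderiv I 𝓘(ℝ, C3) F (π x) (mfderiv 𝓘(ℝ, ℝ × ℝ × ℝ) I π x v) := by
  have hF' : MDifferentiableAt I 𝓘(ℝ, C3) F (π x) :=
    ((h.contMDiff hΦ hF).contMDiffAt).mdifferentiableAt (by simp)
  have hπ : MDifferentiableAt 𝓘(ℝ, ℝ × ℝ × ℝ) I π x :=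
    (h.smooth.contMDiffAt).mdifferentiableAt (by simp)
  have := mfderiv_comp x hF' hπ
  rw [show F ∘ π = Φ from funext hF, mfderiv_eq_fderiv] at this
  exact congrArg (fun T => T v) this

theorem HasSmoothSections.immersedAt_iff [FiniteDimensional ℝ E] (h : HasSmoothSections I π)
    (hE : Module.finrank ℝ E = 3) (hΦ : ContDiff ℝ ∞ Φ) (hF : ∀ x, F (π x) = Φ x)
    (x : ℝ × ℝ × ℝ) : ImmersedAt I F (π x) ↔ Function.Injective (fderiv ℝ Φ x) := by
  have hb := h.mfderiv_bijective hE x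
  have : (fderiv ℝ Φ x : ℝ × ℝ × ℝ → C3) =
      mfderiv I 𝓘(ℝ, C3) F (π x) ∘ mfderiv 𝓘(ℝ, ℝ × ℝ × ℝ) I π x :=
    funext fun v => h.mfderiv_comp_eq hΦ hF x v
  rw [this, ImmersedAt]
  exact (Function.Injective.of_comp_iff' _ hb).symm

theorem HasSmoothSections.tangentImage_eq [FiniteDimensional ℝ E] (h : HasSmoothSections I π)
    (hE : Module.finrank ℝ E = 3) (hΦ : ContDiff ℝ ∞ Φ) (hF : ∀ x, F (π x) = Φ x)
    (x : ℝ × ℝ × ℝ) : tangentImage I F (π x) = LinearMap.range (fderiv ℝ Φ x).toLinearMap := by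
  have hb := h.mfderiv_bijective hE x
  ext z
  constructor
  · rintro ⟨w, rfl⟩
    obtain ⟨v, rfl⟩ := hb.2 w
    exact ⟨v, h.mfderiv_comp_eq hΦ hF x v⟩
  · rintro ⟨v, rfl⟩
    exact ⟨_, (h.mfderiv_comp_eq hΦ hF x v).symm⟩

end Quotient

/-! ### Exponentials -/

theorem expi_add (x y t : ℝ) : expi (x + y) t = expi x t * expi y t := by
  rw [expi, expi, expi, ← Complex.exp_add]; congr 1; push_cast; ring

theorem expi_add_right (x s t : ℝ) : expi x (s + t) = expi x s * expi x t := by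
  rw [expi, expi, expi, ← Complex.exp_add]; congr 1; push_cast; ring

@[simp] theorem expi_zero_left (t : ℝ) : expi 0 t = 1 := by simp [expi]

theorem expi_eq_circleExp (x t : ℝ) : expi x t = Circle.exp (x * t) := by
  rw [expi, Circle.coe_exp]; congr 1; push_cast; ring

theorem norm_expi (x t : ℝ) : ‖expi x t‖ = 1 := by
  rw [expi_eq_circleExp]; exact Circle.norm_coe _

theorem expi_ne_zero (x t : ℝ) : expi x t ≠ 0 := Complex.exp_ne_zero _

theorem conj_expi (x t : ℝ) : conj (expi x t) = expi (-x) t := by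
  rw [expi, expi, ← Complex.exp_conj]; congr 1; simp

theorem hasDerivAt_expi (x t : ℝ) : HasDerivAt (expi x) (Complex.I * x * expi x t) t := by
  have h : HasDerivAt (fun t : ℝ => Complex.I * x * (t : ℂ)) (Complex.I * x * 1) t :=
    (Complex.ofRealCLM.hasDerivAt (x := t)).const_mul (Complex.I * x)
  have h2 : HasDerivAt (expi x) (expi x t * (Complex.I * x * 1)) t := h.cexp
  convert h2 using 1
  ring

theorem contDiff_expi (x : ℝ) {n : ℕ∞ω} : ContDiff ℝ n (expi x) :=
  (contDiff_const.mul Complex.ofRealCLM.contDiff).cexp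

@[fun_prop] theorem ContDiff.expi {E : Type*} [NormedAddCommGroup E] [NormedSpace ℝ E] {n : ℕ∞ω}
    {x : ℝ} {f : E → ℝ} (hf : ContDiff ℝ n f) : ContDiff ℝ n fun y => expi x (f y) :=
  (contDiff_expi x).comp hf

@[fun_prop] theorem Continuous.expi {X : Type*} [TopologicalSpace X] {x : ℝ} {f : X → ℝ}
    (hf : Continuous f) : Continuous fun y => expi x (f y) :=
  (contDiff_expi (n := 0) x).continuous.comp hf

theorem expi_int (n : ℤ) (t : ℝ) : expi n t = (Circle.exp t : ℂ) ^ n := by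
  rw [expi, Circle.coe_exp, ← Complex.exp_int_mul]; congr 1; push_cast; ring

/-! ### Smooth local sections of quotient maps -/

theorem contMDiff_circle_coe : ContMDiff (𝓡 1) 𝓘(ℝ, ℂ) ∞ (fun v : Circle => (v : ℂ)) := by
  have : Fact (Module.finrank ℝ ℂ = 1 + 1) := ⟨Complex.finrank_real_complex⟩
  exact contMDiff_coe_sphere

/-- The branch of the argument on the circle that takes the value `t₀` at `e^{i t₀}`. -/
noncomputable def circleArg (t₀ : ℝ) (v : Circle) : ℝ := t₀ + Complex.arg (v * expi (-1) t₀)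

theorem circleArg_exp_self (t₀ : ℝ) : circleArg t₀ (Circle.exp t₀) = t₀ := by
  have : (Circle.exp t₀ : ℂ) = expi 1 t₀ := by rw [expi_eq_circleExp, one_mul]
  rw [circleArg, this, ← expi_add]; simp

theorem exp_circleArg (t₀ : ℝ) (v : Circle) : Circle.exp (circleArg t₀ v) = v := by
  have h : (v : ℂ) * expi (-1) t₀ = ((v * Circle.exp (-t₀) : Circle) : ℂ) := by
    rw [expi_eq_circleExp]; simp
  rw [circleArg, h, Circle.exp_add, Circle.exp_arg, mul_comm v, ← mul_assoc, ← Circle.exp_add]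
  simp

theorem contDiffAt_arg_one : ContDiffAt ℝ ∞ Complex.arg 1 := by
  have h : ContDiffAt ℝ ∞ Complex.log 1 :=
    (Complex.contDiffAt_log (n := ∞) (x := 1) (by simp)).restrict_scalars ℝ
  have h2 := (Complex.imCLM.contDiff (n := ∞)).contDiffAt.comp (1 : ℂ) h
  exact h2.congr_of_eventuallyEq (Filter.Eventually.of_forall fun z => by
    simp [Complex.log_im])

theorem contMDiffAt_circleArg (t₀ : ℝ) :
    ContMDiffAt (𝓡 1) 𝓘(ℝ, ℝ) ∞ (circleArg t₀) (Circle.exp t₀) := by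
  have h1 : ContDiffAt ℝ ∞ (fun z : ℂ => t₀ + Complex.arg (z * expi (-1) t₀)) (Circle.exp t₀) := by
    refine contDiffAt_const.add ?_
    refine ContDiffAt.comp (g := Complex.arg) (f := fun z : ℂ => z * expi (-1) t₀) _ ?_
      (contDiffAt_id.mul contDiffAt_const)
    have : (Circle.exp t₀ : ℂ) * expi (-1) t₀ = 1 := by
      have : (Circle.exp t₀ : ℂ) = expi 1 t₀ := by rw [expi_eq_circleExp, one_mul]
      rw [this, ← expi_add]; simp
    rw [this]
    exact contDiffAt_arg_one
  exact h1.contMDiffAt.comp (Circle.exp t₀) contMDiff_circle_coe.contMDiffAt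

/-- The covering `ℝ³ → ℝ × T²`. -/
noncomputable def toTorus (x : ℝ × ℝ × ℝ) : ℝ × T2 := (x.1, Circle.exp x.2.1, Circle.exp x.2.2)

theorem hasSmoothSections_toTorus : HasSmoothSections coneModel toTorus := by
  refine ⟨?_, ?_, ?_⟩
  · refine ContMDiff.prodMk contDiff_fst.contMDiff (ContMDiff.prodMk ?_ ?_)
    · exact contMDiff_circleExp.comp (contDiff_snd.fst).contMDiff
    · exact contMDiff_circleExp.comp (contDiff_snd.snd).contMDiff
  · rintro ⟨r, u, v⟩
    exact ⟨(r, circleArg 0 u, circleArg 0 v), by simp [toTorus, exp_circleArg]⟩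
  · rintro ⟨r, θ, t⟩
    refine ⟨fun b => (b.1, circleArg θ b.2.1, circleArg t b.2.2), ?_, ?_, ?_⟩
    · refine ContMDiffAt.prodMk_space contMDiffAt_fst (ContMDiffAt.prodMk_space ?_ ?_)
      · exact ContMDiffAt.comp (g := circleArg θ) (f := fun b : ℝ × T2 => b.2.1)
          (toTorus (r, θ, t)) (contMDiffAt_circleArg θ)
          (contMDiff_fst.comp contMDiff_snd).contMDiffAt
      · exact ContMDiffAt.comp (g := circleArg t) (f := fun b : ℝ × T2 => b.2.2)
          (toTorus (r, θ, t)) (contMDiffAt_circleArg t)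
          (contMDiff_snd.comp contMDiff_snd).contMDiffAt
    · simp [toTorus, circleArg_exp_self]
    · exact Filter.Eventually.of_forall fun y => by simp [toTorus, exp_circleArg]

theorem HasSmoothSections.comp_equiv {E H M : Type*} [NormedAddCommGroup E] [NormedSpace ℝ E]
    [TopologicalSpace H] [TopologicalSpace M] [ChartedSpace H M] {I : ModelWithCorners ℝ E H}
    {π : ℝ × ℝ × ℝ → M} (h : HasSmoothSections I π) (e : (ℝ × ℝ × ℝ) ≃L[ℝ] ℝ × ℝ × ℝ) :
    HasSmoothSections I (π ∘ e) := by
  refine ⟨h.smooth.comp e.contDiff.contMDiff, h.surj.comp e.surjective, fun x => ?_⟩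
  obtain ⟨s, hs, hsx, hev⟩ := h.section_exists (e x)
  refine ⟨e.symm ∘ s, ?_, by simp [hsx], ?_⟩
  · exact (e.symm.contDiff.contMDiff.contMDiffAt).comp _ hs
  · filter_upwards [hev] with y hy
    simpa using hy

/-- A branch of the argument supplies `t`, and then `y = x.2 * e^{-it/2}`. The section identity
`key` holds everywhere; only the smoothness of the branch is local. -/
theorem hasSmoothSections_toCyl :
    HasSmoothSections cylModel fun x : ℝ × ℝ × ℝ => toCyl x.1 x.2.1 x.2.2 := by
  have key : ∀ (t₀ : ℝ) (x : Cyl), toCyl (x.2 * expi (-1 / 2) (circleArg t₀ x.1)).re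
      (x.2 * expi (-1 / 2) (circleArg t₀ x.1)).im (circleArg t₀ x.1) = x := fun t₀ x => by
    rw [toCyl, exp_circleArg]
    refine Prod.ext rfl ?_
    simp only
    rw [Complex.re_add_im, mul_assoc, ← expi_add]
    norm_num
  refine ⟨?_, ?_, ?_⟩
  · refine ContMDiff.prodMk (contMDiff_circleExp.comp (contDiff_snd.snd).contMDiff) ?_
    refine ContDiff.contMDiff ?_
    refine ContDiff.mul ?_ (ContDiff.expi contDiff_snd.snd)
    exact (Complex.ofRealCLM.contDiff.comp contDiff_fst).add
      ((Complex.ofRealCLM.contDiff.comp contDiff_snd.fst).mul contDiff_const)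
  · exact fun x => ⟨(_, _, _), key 0 x⟩
  · rintro ⟨y₁, y₂, t₀⟩
    have harg : ContMDiffAt cylModel 𝓘(ℝ, ℝ) ∞ (fun x : Cyl => circleArg t₀ x.1)
        (toCyl y₁ y₂ t₀) :=
      ContMDiffAt.comp (g := circleArg t₀) (f := fun b : Cyl => b.1)
          (toCyl y₁ y₂ t₀) (contMDiffAt_circleArg t₀) contMDiff_fst.contMDiffAt
    have hG : ContDiff ℝ ∞ (fun p : ℂ × ℝ => ((p.1 * expi (-1 / 2) p.2).re,
        (p.1 * expi (-1 / 2) p.2).im, p.2)) := by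
      have : ContDiff ℝ ∞ (fun p : ℂ × ℝ => p.1 * expi (-1 / 2) p.2) :=
        contDiff_fst.mul (ContDiff.expi contDiff_snd)
      exact (Complex.reCLM.contDiff.comp this).prodMk
        ((Complex.imCLM.contDiff.comp this).prodMk contDiff_snd)
    refine ⟨fun x => ((x.2 * expi (-1 / 2) (circleArg t₀ x.1)).re,
      (x.2 * expi (-1 / 2) (circleArg t₀ x.1)).im, circleArg t₀ x.1), ?_, ?_,
      Filter.Eventually.of_forall fun x => key t₀ x⟩
    · exact ContMDiffAt.comp (g := fun p : ℂ × ℝ => ((p.1 * expi (-1 / 2) p.2).re,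
        (p.1 * expi (-1 / 2) p.2).im, p.2)) (f := fun x : Cyl => (x.2, circleArg t₀ x.1))
        (toCyl y₁ y₂ t₀) hG.contMDiff.contMDiffAt
        (ContMDiffAt.prodMk_space contMDiff_snd.contMDiffAt harg)
    · simp only [toCyl, circleArg_exp_self]
      rw [mul_assoc, ← expi_add]
      norm_num

theorem finrank_coneModel :
    Module.finrank ℝ (ℝ × EuclideanSpace ℝ (Fin 1) × EuclideanSpace ℝ (Fin 1)) = 3 := by
  simp

theorem finrank_cylModel : Module.finrank ℝ (EuclideanSpace ℝ (Fin 1) × ℂ) = 3 := by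
  simp [Complex.finrank_real_complex]

/-! ### The quotient map onto the cylinder -/

theorem toCyl_surjective (x : Cyl) : ∃ y₁ y₂ t : ℝ, toCyl y₁ y₂ t = x := by
  obtain ⟨⟨y₁, y₂, t⟩, h⟩ := hasSmoothSections_toCyl.surj x
  exact ⟨y₁, y₂, t, h⟩

theorem expi_half_two_pi_mul (n : ℤ) : expi (1 / 2) (2 * Real.pi * n) = (-1) ^ n := by
  rw [expi_eq_circleExp, show (1 / 2 : ℝ) * (2 * Real.pi * n) = n * Real.pi by ring,
    ← expi_eq_circleExp, expi_int]
  simp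

theorem toCyl_eq_iff (y₁ y₂ t y₁' y₂' t' : ℝ) : toCyl y₁ y₂ t = toCyl y₁' y₂' t' ↔
    ∃ n : ℤ, y₁' = (-1) ^ n * y₁ ∧ y₂' = (-1) ^ n * y₂ ∧ t' = t + 2 * Real.pi * n := by
  have hs : ∀ n : ℤ, ((-1 : ℂ) ^ n) * (-1) ^ n = 1 := fun n => by
    rw [← mul_zpow]; norm_num
  have key : ∀ (n : ℤ) (z z' : ℂ), z * expi (1 / 2) t = z' * expi (1 / 2) (t + 2 * Real.pi * n) ↔
      z' = (-1) ^ n * z := fun n z z' => by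
    rw [expi_add_right, expi_half_two_pi_mul, mul_comm (expi _ t), ← mul_assoc,
      mul_left_inj' (expi_ne_zero _ _)]
    constructor
    · intro h; rw [h]; linear_combination -z' * hs n
    · intro h; rw [h]; linear_combination -z * hs n
  have hre : ∀ n : ℤ, ((-1 : ℂ) ^ n) = (((-1 : ℝ) ^ n : ℝ) : ℂ) := fun n => by push_cast; rfl
  have hcoord : ∀ n : ℤ, ((y₁' : ℂ) + y₂' * Complex.I = (-1) ^ n * (y₁ + y₂ * Complex.I)) ↔
      (y₁' = (-1) ^ n * y₁ ∧ y₂' = (-1) ^ n * y₂) := fun n => by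
    rw [hre]
    generalize (-1 : ℝ) ^ n = r
    simp [Complex.ext_iff]
  constructor
  · intro h
    rw [toCyl, toCyl, Prod.mk.injEq] at h
    obtain ⟨n, hn⟩ := Circle.exp_eq_exp.1 h.1.symm
    have hn' : t' = t + 2 * Real.pi * n := by rw [hn]; ring
    have h2 := h.2
    rw [hn', key, hcoord] at h2
    exact ⟨n, h2.1, h2.2, hn'⟩
  · rintro ⟨n, h1, h2, rfl⟩
    rw [toCyl, toCyl, Prod.mk.injEq]
    refine ⟨(Circle.exp_eq_exp.2 ⟨n, by ring⟩).symm, ?_⟩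
    rw [key, hcoord]
    exact ⟨h1, h2⟩

/-! ### Derivatives of maps `ℝ³ → ℂ³` -/

theorem C3.hasDerivAt {f : ℝ → C3} {f' : C3} {t : ℝ}
    (h : ∀ j, HasDerivAt (fun s => f s j) (f' j) t) : HasDerivAt f f' t := by
  have h1 : HasDerivAt (fun s => (WithLp.ofLp (f s) : Fin 3 → ℂ)) (WithLp.ofLp f') t :=
    hasDerivAt_pi.2 h
  exact ((PiLp.continuousLinearEquiv 2 ℝ
    (fun _ : Fin 3 => ℂ)).symm.toContinuousLinearMap.hasFDerivAt.comp_hasDerivAt t h1)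

theorem C3.hasDerivAt_mk {f g h : ℝ → ℂ} {f' g' h' : ℂ} {t : ℝ} (hf : HasDerivAt f f' t)
    (hg : HasDerivAt g g' t) (hh : HasDerivAt h h' t) :
    HasDerivAt (fun s => (!₂[f s, g s, h s] : C3)) !₂[f', g', h'] t :=
  C3.hasDerivAt (forall_fin3 hf hg hh)

theorem C3.mk_eq {z₀ z₁ z₂ : ℂ} {w : C3} (h0 : z₀ = w 0) (h1 : z₁ = w 1) (h2 : z₂ = w 2) :
    !₂[z₀, z₁, z₂] = w :=
  C3.ext h0 h1 h2

theorem hasDerivAt_ofReal (t : ℝ) : HasDerivAt (fun s : ℝ => (s : ℂ)) 1 t :=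
  Complex.ofRealCLM.hasDerivAt

theorem C3.contDiff {E : Type*} [NormedAddCommGroup E] [NormedSpace ℝ E] {n : ℕ∞ω} {f : E → C3}
    (h : ∀ j, ContDiff ℝ n fun x => f x j) : ContDiff ℝ n f := by
  have h1 : ContDiff ℝ n (fun s => (WithLp.ofLp (f s) : Fin 3 → ℂ)) := contDiff_pi.2 h
  exact (PiLp.continuousLinearEquiv 2 ℝ
    (fun _ : Fin 3 => ℂ)).symm.contDiff.comp h1

section Partial

variable {Φ : ℝ × ℝ × ℝ → C3} {a b t : ℝ} {u u' : C3}
  {f : ℝ → C3}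

theorem fderiv_fst_eq (hΦ : ContDiff ℝ ∞ Φ) (h : HasDerivAt f u' a) (hf : ∀ s, f s = Φ (s, b, t))
    (hu : u' = u) :
    fderiv ℝ Φ (a, b, t) (1, 0, 0) = u := by
  have h1 : HasDerivAt (fun s : ℝ => (s, b, t)) ((1 : ℝ), (0 : ℝ), (0 : ℝ)) a :=
    (hasDerivAt_id a).prodMk (hasDerivAt_const a (b, t))
  exact (((hΦ.differentiable (by simp)) (a, b, t)).hasFDerivAt.comp_hasDerivAt a h1).unique
    ((funext hf ▸ h : HasDerivAt (fun s => _) u' _).congr_deriv hu)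

theorem fderiv_snd_eq (hΦ : ContDiff ℝ ∞ Φ) (h : HasDerivAt f u' b) (hf : ∀ s, f s = Φ (a, s, t))
    (hu : u' = u) :
    fderiv ℝ Φ (a, b, t) (0, 1, 0) = u := by
  have h1 : HasDerivAt (fun s : ℝ => (a, s, t)) ((0 : ℝ), (1 : ℝ), (0 : ℝ)) b :=
    (hasDerivAt_const b a).prodMk ((hasDerivAt_id b).prodMk (hasDerivAt_const b t))
  exact (((hΦ.differentiable (by simp)) (a, b, t)).hasFDerivAt.comp_hasDerivAt b h1).unique
    ((funext hf ▸ h : HasDerivAt (fun s => _) u' _).congr_deriv hu)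

theorem fderiv_thd_eq (hΦ : ContDiff ℝ ∞ Φ) (h : HasDerivAt f u' t) (hf : ∀ s, f s = Φ (a, b, s))
    (hu : u' = u) :
    fderiv ℝ Φ (a, b, t) (0, 0, 1) = u := by
  have h1 : HasDerivAt (fun s : ℝ => (a, b, s)) ((0 : ℝ), (0 : ℝ), (1 : ℝ)) t :=
    (hasDerivAt_const t a).prodMk ((hasDerivAt_const t b).prodMk (hasDerivAt_id t))
  exact (((hΦ.differentiable (by simp)) (a, b, t)).hasFDerivAt.comp_hasDerivAt t h1).unique
    ((funext hf ▸ h : HasDerivAt (fun s => _) u' _).congr_deriv hu)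

end Partial

/-- `Φ : ℝ³ → ℂ³` solves the evolution equation `∂Φ/∂t = c • conjCross (∂Φ/∂y₁) (∂Φ/∂y₂)` with
isotropic slices; `u` and `v` are the derivatives in `y₁` and `y₂`. -/
structure IsSLEvolution (Φ u v : ℝ × ℝ × ℝ → C3) (c : ℝ) : Prop where
  pos : 0 < c
  smooth : ContDiff ℝ ∞ Φ
  fst : ∀ x, fderiv ℝ Φ x (1, 0, 0) = u x
  snd : ∀ x, fderiv ℝ Φ x (0, 1, 0) = v x
  thd : ∀ x, fderiv ℝ Φ x (0, 0, 1) = c • conjCross (u x) (v x)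
  isotropic : ∀ x, (inner ℂ (u x) (v x) : ℂ).im = 0

section Quotient

variable {E H M : Type*} [NormedAddCommGroup E] [NormedSpace ℝ E] [TopologicalSpace H]
  [TopologicalSpace M] [ChartedSpace H M] {I : ModelWithCorners ℝ E H}
  {π : ℝ × ℝ × ℝ → M} {F : M → C3} {Φ u v : ℝ × ℝ × ℝ → C3} {c : ℝ}

theorem IsSLEvolution.immersedAt_iff [FiniteDimensional ℝ E] (hE : Module.finrank ℝ E = 3)
    (hΦ : IsSLEvolution Φ u v c) (h : HasSmoothSections I π) (hF : ∀ x, F (π x) = Φ x)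
    (x : ℝ × ℝ × ℝ) : ImmersedAt I F (π x) ↔ conjCross (u x) (v x) ≠ 0 := by
  rw [h.immersedAt_iff hE hΦ.smooth hF]
  exact injective_iff_conjCross_ne_zero hΦ.pos (hΦ.fst x) (hΦ.snd x) (hΦ.thd x)

theorem IsSLEvolution.isSLPlane [FiniteDimensional ℝ E] (hE : Module.finrank ℝ E = 3)
    (hΦ : IsSLEvolution Φ u v c) (h : HasSmoothSections I π) (hF : ∀ x, F (π x) = Φ x)
    {m : M} (hm : ImmersedAt I F m) : IsSLPlane (tangentImage I F m) := by
  obtain ⟨x, rfl⟩ := h.surj m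
  rw [hΦ.immersedAt_iff hE h hF] at hm
  rw [h.tangentImage_eq hE hΦ.smooth hF]
  exact isSLPlane_range hΦ.pos (hΦ.fst x) (hΦ.snd x) (hΦ.thd x) (hΦ.isotropic x) hm

end Quotient

/-! ### The cone -/

section Cone

variable {α : Fin 3 → ℝ} {a : Fin 3 → ℤ}

/-- The map `Ψ` in the coordinates `(r, θ, t)`. -/
noncomputable def coneParam (α : Fin 3 → ℝ) (a : Fin 3 → ℤ) (x : ℝ × ℝ × ℝ) : C3 :=
  !₂[x.1 * (Complex.I * √(α 0) * expi (a 0) x.2.2),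
    x.1 * ((√(α 1) * Real.cos x.2.1 : ℝ) * expi (a 1) x.2.2),
    x.1 * ((√(α 2) * Real.sin x.2.1 : ℝ) * expi (a 2) x.2.2)]

theorem coneParam_zero (r θ t : ℝ) : r * (Complex.I * √(α 0) * expi (a 0) t) =
    coneParam α a (r, θ, t) 0 := rfl

theorem coneParam_one (r θ t : ℝ) : r * ((√(α 1) * Real.cos θ : ℝ) * expi (a 1) t) =
    coneParam α a (r, θ, t) 1 := rfl

theorem coneParam_two (r θ t : ℝ) : r * ((√(α 2) * Real.sin θ : ℝ) * expi (a 2) t) =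
    coneParam α a (r, θ, t) 2 := rfl

theorem coneMap_torus_toTorus (x : ℝ × ℝ × ℝ) :
    coneMap (torus α a) (toTorus x) = coneParam α a x := by
  apply C3.ext <;> simp [coneMap, torus, toTorus, coneParam, expi_int]

/-- The equation matches component by component: the amplitudes by `√(α 1) √(α 2) = -a 0 √(α 0)` and
its analogues, the exponentials by `∑ a j = 0`. The slices are isotropic because in each component
both derivatives carry the same phase. -/
theorem isSLEvolution_coneParam (h : IsAlpha α) (ha : ∀ j, freq α j = a j) :
    IsSLEvolution (coneParam α a) (fun x => coneParam α a (1, x.2))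
      (fun x => !₂[0, x.1 * ((-(√(α 1) * Real.sin x.2.1) : ℝ) * expi (a 1) x.2.2),
        x.1 * ((√(α 2) * Real.cos x.2.1 : ℝ) * expi (a 2) x.2.2)]) 1 := by
  have hsm : ContDiff ℝ ∞ (coneParam α a) := by
    refine C3.contDiff (forall_fin3 ?_ ?_ ?_)
    · exact (Complex.ofRealCLM.contDiff.comp contDiff_fst).mul
        (contDiff_const.mul (ContDiff.expi contDiff_snd.snd))
    · refine (Complex.ofRealCLM.contDiff.comp contDiff_fst).mul
        (ContDiff.mul ?_ (ContDiff.expi contDiff_snd.snd))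
      exact Complex.ofRealCLM.contDiff.comp
        (contDiff_const.mul (Real.contDiff_cos.comp contDiff_snd.fst))
    · refine (Complex.ofRealCLM.contDiff.comp contDiff_fst).mul
        (ContDiff.mul ?_ (ContDiff.expi contDiff_snd.snd))
      exact Complex.ofRealCLM.contDiff.comp
        (contDiff_const.mul (Real.contDiff_sin.comp contDiff_snd.fst))
  obtain ⟨m0, m1, m2⟩ := h.mul_sqrt
  have hs := h.freq_sum
  simp only [ha] at m0 m1 m2 hs
  have c0 : (√(α 1) : ℂ) * √(α 2) = -a 0 * √(α 0) := by exact_mod_cast m0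
  have c1 : (√(α 2) : ℂ) * √(α 0) = a 1 * √(α 1) := by exact_mod_cast m1
  have c2 : (√(α 0) : ℂ) * √(α 1) = a 2 * √(α 2) := by exact_mod_cast m2
  have e0 : ∀ t, expi (a 0) t = expi (-a 1) t * expi (-a 2) t := fun t => by
    rw [← expi_add]; congr 1; linarith
  have e1 : ∀ t, expi (a 1) t = expi (-a 2) t * expi (-a 0) t := fun t => by
    rw [← expi_add]; congr 1; linarith
  have e2 : ∀ t, expi (a 2) t = expi (-a 0) t * expi (-a 1) t := fun t => by
    rw [← expi_add]; congr 1; linarith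
  refine ⟨one_pos, hsm, ?_, ?_, ?_, ?_⟩
  · rintro ⟨r, θ, t⟩
    refine fderiv_fst_eq hsm (C3.hasDerivAt_mk ((hasDerivAt_ofReal r).mul_const _)
      ((hasDerivAt_ofReal r).mul_const _) ((hasDerivAt_ofReal r).mul_const _))
      (fun _ => C3.mk_eq (coneParam_zero _ _ _) (coneParam_one _ _ _)
      (coneParam_two _ _ _)) ?_
    apply C3.ext <;> simp [coneParam]
  · rintro ⟨r, θ, t⟩
    refine fderiv_snd_eq hsm (C3.hasDerivAt_mk (hasDerivAt_const _ _)
      ((((Real.hasDerivAt_cos θ).const_mul √(α 1)).ofReal_comp.mul_const _).const_mul _)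
      ((((Real.hasDerivAt_sin θ).const_mul √(α 2)).ofReal_comp.mul_const _).const_mul _))
      (fun _ => C3.mk_eq (coneParam_zero _ _ _) (coneParam_one _ _ _)
      (coneParam_two _ _ _)) ?_
    apply C3.ext <;> simp
  · rintro ⟨r, θ, t⟩
    have hcs : (Real.cos θ : ℂ) ^ 2 + (Real.sin θ : ℂ) ^ 2 = 1 := by
      exact_mod_cast Real.cos_sq_add_sin_sq θ
    refine fderiv_thd_eq hsm (C3.hasDerivAt_mk
      (((hasDerivAt_expi (a 0) t).const_mul _).const_mul _)
      (((hasDerivAt_expi (a 1) t).const_mul _).const_mul _)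
      (((hasDerivAt_expi (a 2) t).const_mul _).const_mul _))
      (fun _ => C3.mk_eq (coneParam_zero _ _ _) (coneParam_one _ _ _)
      (coneParam_two _ _ _)) ?_
    apply C3.ext
    · simp [coneParam, conj_expi, Complex.conj_ofReal, -Complex.ofReal_cos, -Complex.ofReal_sin]
      rw [e0 t]
      linear_combination (r * √(α 0) * a 0 * expi (-a 1) t * expi (-a 2) t) * Complex.I_sq
        - r * expi (-a 1) t * expi (-a 2) t * √(α 1) * √(α 2) * hcs
        - r * expi (-a 1) t * expi (-a 2) t * c0
    · simp [coneParam, conj_expi, Complex.conj_ofReal, -Complex.ofReal_cos, -Complex.ofReal_sin]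
      rw [e1 t]
      linear_combination -r * Complex.I * Real.cos θ * expi (-a 2) t * expi (-a 0) t * c1
    · simp [coneParam, conj_expi, Complex.conj_ofReal, -Complex.ofReal_cos, -Complex.ofReal_sin]
      rw [e2 t]
      linear_combination -r * Complex.I * Real.sin θ * expi (-a 0) t * expi (-a 1) t * c2
  · rintro ⟨r, θ, t⟩
    have n1 : expi (a 1) t * expi (-a 1) t = 1 := by rw [← expi_add]; simp
    have n2 : expi (a 2) t * expi (-a 2) t = 1 := by rw [← expi_add]; simp
    have : (inner ℂ (coneParam α a (1, θ, t)) (!₂[0,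
        (r : ℂ) * ((-(√(α 1) * Real.sin θ) : ℝ) * expi (a 1) t),
        r * ((√(α 2) * Real.cos θ : ℝ) * expi (a 2) t)] : C3) : ℂ) =
        ((r * (√(α 2) ^ 2 - √(α 1) ^ 2) * Real.cos θ * Real.sin θ : ℝ) : ℂ) := by
      rw [C3.inner_eq]
      simp [coneParam, conj_expi, -Complex.ofReal_cos, -Complex.ofReal_sin, Complex.conj_ofReal]
      linear_combination -(r * √(α 1) ^ 2 * Real.cos θ * Real.sin θ : ℂ) * n1 +
        (r * √(α 2) ^ 2 * Real.cos θ * Real.sin θ : ℂ) * n2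
    rw [this, Complex.ofReal_im]

theorem conjCross_coneParam_ne_zero (h : IsAlpha α) {x : ℝ × ℝ × ℝ} (hx : 0 < x.1) :
    conjCross (coneParam α a (1, x.2))
      !₂[0, x.1 * ((-(√(α 1) * Real.sin x.2.1) : ℝ) * expi (a 1) x.2.2),
        x.1 * ((√(α 2) * Real.cos x.2.1 : ℝ) * expi (a 2) x.2.2)] ≠ 0 := by
  obtain ⟨r, θ, t⟩ := x
  intro h0
  have hcs : (Real.cos θ : ℂ) ^ 2 + (Real.sin θ : ℂ) ^ 2 = 1 := by
    exact_mod_cast Real.cos_sq_add_sin_sq θ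
  have h1 := congrArg (fun z : C3 => z 0) h0
  simp only [conjCross_zero, coneParam] at h1
  have h2 : (r : ℂ) * √(α 1) * √(α 2) * (expi (a 1) t * expi (a 2) t) = 0 := by
    rw [show ((0 : C3).ofLp 0) = conj (0 : ℂ) by simp, (starRingEnd ℂ).injective.eq_iff] at h1
    simp [-Complex.ofReal_cos, -Complex.ofReal_sin] at h1
    linear_combination h1 - (r : ℂ) * √(α 1) * √(α 2) * (expi (a 1) t * expi (a 2) t) * hcs
  have s1 := (h.sqrt_pos 1).ne'
  have s2 := (h.sqrt_pos 2).ne'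
  have hr : r ≠ 0 := hx.ne'
  simp [expi_ne_zero, s1, s2, hr] at h2

theorem isSLImmersionOn_coneMap (h : IsAlpha α) (ha : ∀ j, freq α j = a j) {ℓ : T2 → C3}
    {e : (ℝ × ℝ × ℝ) ≃L[ℝ] ℝ × ℝ × ℝ} (he : ∀ x, (e x).1 = x.1)
    (hℓ : ∀ x, coneMap ℓ (toTorus (e x)) = coneParam α a x) :
    IsSLImmersionOn coneModel (coneMap ℓ) {b | 0 < b.1} := by
  have hs := hasSmoothSections_toTorus.comp_equiv e
  have hev := isSLEvolution_coneParam h ha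
  refine ⟨hs.contMDiff hev.smooth hℓ, fun b hb => ?_⟩
  have hi : ImmersedAt coneModel (coneMap ℓ) b := by
    obtain ⟨x, rfl⟩ := hs.surj b
    rw [hev.immersedAt_iff finrank_coneModel hs hℓ]
    refine conjCross_coneParam_ne_zero h ?_
    rw [← he]
    exact hb
  exact ⟨hi, hev.isSLPlane finrank_coneModel hs hℓ hi⟩

theorem isSLImmersionOn_torus (h : IsAlpha α) (ha : ∀ j, freq α j = a j) :
    IsSLImmersionOn coneModel (coneMap (torus α a)) {b | 0 < b.1} :=
  isSLImmersionOn_coneMap h ha (e := ContinuousLinearEquiv.refl ℝ _) (fun _ => rfl)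
    fun x => coneMap_torus_toTorus x

end Cone

/-! ### Injectivity properties of the cone -/

section ConeInjective

variable {α : Fin 3 → ℝ} {a : Fin 3 → ℤ} {l : ℤ}

theorem IsFreq.eq_one_of_zpow {G : Type*} [Group G] (hf : IsFreq a l) {g : G}
    (h : ∀ j, g ^ a j = 1) : g = 1 := by
  have hd : ∀ j, (orderOf g : ℤ) ∣ a j := fun j => orderOf_dvd_iff_zpow_eq_one.2 (h j)
  have h2 : (orderOf g : ℤ) ∣ (Int.gcd (a 0) (Int.gcd (a 1) (a 2)) : ℤ) :=
    Int.dvd_coe_gcd (hd 0) (Int.dvd_coe_gcd (hd 1) (hd 2))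
  rw [hf.gcd] at h2
  have : orderOf g ∣ 1 := by exact_mod_cast h2
  exact orderOf_eq_one_iff.1 (Nat.dvd_one.1 this)

theorem circle_sq_add_sq (u : Circle) : (u : ℂ).re ^ 2 + (u : ℂ).im ^ 2 = 1 := by
  have := Circle.normSq_coe u
  rw [Complex.normSq_apply] at this
  linarith

theorem IsFreq.odd_of_even (hf : IsFreq a l) (h : Even (a 0)) : Odd (a 1) ∧ Odd (a 2) := by
  have hs := hf.sum
  have key : ¬ (Even (a 1) ∧ Even (a 2)) := by
    rintro ⟨h1, h2⟩
    have : (2 : ℤ) ∣ (Int.gcd (a 0) (Int.gcd (a 1) (a 2)) : ℤ) :=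
      Int.dvd_coe_gcd h.two_dvd (Int.dvd_coe_gcd h1.two_dvd h2.two_dvd)
    rw [hf.gcd] at this
    norm_num at this
  have h12 : Even (a 1) ↔ Even (a 2) := by
    have : Even (a 1 + a 2) := by
      rw [show a 1 + a 2 = -a 0 by linarith]; exact h.neg
    exact Int.even_add.1 this
  rw [← Int.not_even_iff_odd, ← Int.not_even_iff_odd]
  tauto

/-- The moduli of the first components give `r = r'`. With `v' = v * ζ` one gets `ζ ^ a 0 = 1`, and
`ζ ^ a 1`, `ζ ^ a 2`, whose product is 1, must be one and the same sign. The sign `+` gives `ζ = 1`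
because the `a j` are coprime; the sign `-` gives `ζ² = 1`, hence `ζ = -1` and `a 0` even. -/
theorem coneMap_torus_eq_iff (hα : IsAlpha α) (hf : IsFreq a l) (b b' : ℝ × T2) (hb : 0 < b.1)
    (hb' : 0 < b'.1) : coneMap (torus α a) b = coneMap (torus α a) b' ↔
      b = b' ∨ (Even (a 0) ∧ b' = (b.1, (-b.2.1, -b.2.2))) := by
  obtain ⟨r, u, v⟩ := b
  obtain ⟨r', u', v'⟩ := b'
  have s0 : (√(α 0) : ℂ) ≠ 0 := by exact_mod_cast (hα.sqrt_pos 0).ne'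
  have s1 : (√(α 1) : ℂ) ≠ 0 := by exact_mod_cast (hα.sqrt_pos 1).ne'
  have s2 : (√(α 2) : ℂ) ≠ 0 := by exact_mod_cast (hα.sqrt_pos 2).ne'
  constructor
  · intro h
    simp only at hb hb'
    have h0 := congrArg (fun z : C3 => z 0) h
    have h1 := congrArg (fun z : C3 => z 1) h
    have h2 := congrArg (fun z : C3 => z 2) h
    simp [coneMap, torus] at h0 h1 h2
    have hr : r = r' := by
      have := congrArg (fun z : ℂ => ‖z‖) h0
      have hn : ∀ w : Circle, ‖(w : ℂ)‖ = 1 := Circle.norm_coe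
      have p := (hα.sqrt_pos 0).ne'
      simp [norm_zpow, abs_of_pos hb, abs_of_pos hb', hn] at this
      simpa [p] using this
    subst hr
    have hr : (r : ℂ) ≠ 0 := by exact_mod_cast hb.ne'
    have e0 : (v : ℂ) ^ a 0 = (v' : ℂ) ^ a 0 := by
      simpa [hr, s0] using h0
    have e1 : ((u : ℂ).re : ℂ) * (v : ℂ) ^ a 1 = (u' : ℂ).re * (v' : ℂ) ^ a 1 := by
      refine mul_left_cancel₀ (mul_ne_zero hr s1) ?_
      linear_combination h1
    have e2 : ((u : ℂ).im : ℂ) * (v : ℂ) ^ a 2 = (u' : ℂ).im * (v' : ℂ) ^ a 2 := by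
      refine mul_left_cancel₀ (mul_ne_zero hr s2) ?_
      linear_combination h2
    obtain ⟨ζ, rfl⟩ : ∃ ζ : Circle, v' = v * ζ := ⟨v⁻¹ * v', by simp⟩
    have hv : ∀ n : ℤ, (v : ℂ) ^ n ≠ 0 := fun n => zpow_ne_zero _ (Circle.coe_ne_zero v)
    simp only [Circle.coe_mul, mul_zpow] at e0 e1 e2
    have z0 : (ζ : ℂ) ^ a 0 = 1 := by
      refine mul_left_cancel₀ (hv (a 0)) ?_
      rw [← e0, mul_one]
    have z1 : ((u : ℂ).re : ℂ) = (u' : ℂ).re * (ζ : ℂ) ^ a 1 := by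
      refine mul_left_cancel₀ (hv (a 1)) ?_
      linear_combination e1
    have z2 : ((u : ℂ).im : ℂ) = (u' : ℂ).im * (ζ : ℂ) ^ a 2 := by
      refine mul_left_cancel₀ (hv (a 2)) ?_
      linear_combination e2
    have z12 : (ζ : ℂ) ^ a 1 * (ζ : ℂ) ^ a 2 = 1 := by
      rw [← zpow_add₀ (Circle.coe_ne_zero ζ), show a 1 + a 2 = -a 0 by linarith [hf.sum],
        zpow_neg, z0, inv_one]
    have real_sq : ∀ (x y : ℝ) (w : Circle), (x : ℂ) = y * w → y ≠ 0 → (w : ℂ) ^ 2 = 1 := by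
      intro x y w hx hy
      have hy' : (y : ℂ) ≠ 0 := by exact_mod_cast hy
      have hw : (w : ℂ) = ((x / y : ℝ) : ℂ) := by
        push_cast; rw [eq_div_iff hy', hx]; ring
      have hn := congrArg (fun z : ℂ => ‖z‖ ^ 2) hw
      simp only [Circle.norm_coe, Complex.norm_real, Real.norm_eq_abs, sq_abs] at hn
      rw [hw]
      exact_mod_cast (by linarith : (x / y) ^ 2 = 1)
    have hsq : ((ζ : ℂ) ^ a 1) ^ 2 = 1 := by
      -- One of the two real factors of `u'` is nonzero, and either suffices because `ζ ^ a 1` and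
      -- `ζ ^ a 2` are mutually inverse.
      by_cases hc : (u' : ℂ).re = 0
      · have hs : (u' : ℂ).im ≠ 0 := by
          intro hs
          have := circle_sq_add_sq u'
          rw [hc, hs] at this
          norm_num at this
        have := real_sq _ _ (ζ ^ a 2) (by rw [Circle.coe_zpow]; exact z2) hs
        rw [Circle.coe_zpow] at this
        have h3 : ((ζ : ℂ) ^ a 1) ^ 2 * ((ζ : ℂ) ^ a 2) ^ 2 = 1 := by
          rw [← mul_pow, z12, one_pow]
        rwa [this, mul_one] at h3
      · have := real_sq _ _ (ζ ^ a 1) (by rw [Circle.coe_zpow]; exact z1) hc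
        rwa [Circle.coe_zpow] at this
    have toC : ∀ (n : ℤ) (g : Circle), (ζ : ℂ) ^ n = g → ζ ^ n = g := fun n g h => by
      apply Circle.ext
      rw [Circle.coe_zpow, h]
    rcases sq_eq_sq_iff_eq_or_eq_neg.1 (hsq.trans (one_pow 2).symm) with h3 | h3
    · left
      rw [h3, one_mul] at z12
      rw [h3, mul_one] at z1
      rw [z12, mul_one] at z2
      have hζ : ζ = 1 := hf.eq_one_of_zpow
        (forall_fin3 (toC _ 1 (by simpa using z0)) (toC _ 1 (by simpa using h3))
          (toC _ 1 (by simpa using z12)))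
      have hu : u = u' := Circle.ext (Complex.ext (by exact_mod_cast z1) (by exact_mod_cast z2))
      rw [hζ, hu, mul_one]
    · right
      have h4 : (ζ : ℂ) ^ a 2 = -1 := by
        rw [h3] at z12; linear_combination -z12
      have hζ2 : ζ ^ 2 = 1 := by
        refine hf.eq_one_of_zpow (forall_fin3 ?_ ?_ ?_) <;>
          rw [← zpow_natCast, ← zpow_mul, mul_comm, zpow_mul]
        · rw [toC _ 1 (by simpa using z0), one_zpow]
        · apply Circle.ext
          rw [Circle.coe_zpow, Circle.coe_zpow, h3]; simp
        · apply Circle.ext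
          rw [Circle.coe_zpow, Circle.coe_zpow, h4]; simp
      have hζ : (ζ : ℂ) = -1 := by
        have : (ζ : ℂ) ^ 2 = 1 := by rw [← Circle.coe_pow, hζ2, Circle.coe_one]
        rcases sq_eq_sq_iff_eq_or_eq_neg.1 (this.trans (one_pow 2).symm) with h5 | h5
        · rw [h5, one_zpow] at h3
          norm_num at h3
        · exact h5
      have hev : Even (a 0) := by
        by_contra ho
        rw [Int.not_even_iff_odd] at ho
        rw [hζ, ho.neg_one_zpow] at z0
        norm_num at z0
      refine ⟨hev, ?_⟩
      rw [h3] at z1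
      rw [h4] at z2
      have hu : u' = -u := by
        apply Circle.ext
        rw [Circle.coe_neg]
        apply Complex.ext
        · have : (u : ℂ).re = -(u' : ℂ).re := by
            have : ((u : ℂ).re : ℂ) = ((-(u' : ℂ).re : ℝ) : ℂ) := by rw [z1]; simp
            exact_mod_cast this
          simp [this]
        · have : (u : ℂ).im = -(u' : ℂ).im := by
            have : ((u : ℂ).im : ℂ) = ((-(u' : ℂ).im : ℝ) : ℂ) := by rw [z2]; simp
            exact_mod_cast this
          simp [this]
      have hv' : v * ζ = -v := by
        apply Circle.ext
        rw [Circle.coe_mul, hζ, Circle.coe_neg]; ring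
      rw [hu, hv']
  · rintro (h | ⟨hev, h⟩)
    · rw [h]
    · rw [h]
      obtain ⟨o1, o2⟩ := hf.odd_of_even hev
      apply C3.ext <;> simp [coneMap, torus, hev.neg_zpow, o1.neg_zpow, o2.neg_zpow]

/-- As the products `a j * α j` are `-κ`, `κ`, `κ`, the quadratic equation becomes `c² + s² = 1`
once the coordinates are divided by `r * √(α j)` with `r = x 0 / √(α 0)`. -/
theorem cone_eq_image (hα : IsAlpha α) (ha : ∀ j, freq α j = a j) :
    cone (fun j => a j) = coneMap (torus α a) '' {b | 0 ≤ b.1} := by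
  obtain ⟨m0, m1, m2⟩ := hα.freq_mul
  have n1 := hα.freq_pos1
  have n2 := hα.freq_pos2
  simp only [ha] at m0 m1 m2 n1 n2
  have p0 := hα.sqrt_pos 0
  have p1 := hα.sqrt_pos 1
  have p2 := hα.sqrt_pos 2
  have q := fun j => Real.sq_sqrt (hα.1 j).le
  set κ := √(α 0) * √(α 1) * √(α 2)
  have hκ : 0 < κ := by positivity
  ext z
  constructor
  · rintro ⟨x, t, hx, he, rfl⟩
    rcases hx.eq_or_lt with h0 | h0
    · rw [← h0] at he
      have h1 : x 1 = 0 := by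
        have : 0 ≤ (a 2 : ℝ) * x 2 ^ 2 := by positivity
        have h3 : (a 1 : ℝ) * x 1 ^ 2 ≤ 0 := by nlinarith
        by_contra hne
        have : 0 < (a 1 : ℝ) * x 1 ^ 2 := by positivity
        linarith
      have h2 : x 2 = 0 := by
        rw [h1] at he
        have : (a 2 : ℝ) * x 2 ^ 2 = 0 := by linarith
        simpa [n2.ne'] using this
      refine ⟨(0, 1, 1), by simp, ?_⟩
      apply C3.ext <;> simp [coneMap, ← h0, h1, h2]
    · set r := x 0 / √(α 0) with hr
      have hrp : 0 < r := by positivity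
      have hx0 : x 0 = r * √(α 0) := by rw [hr]; field_simp
      set c := x 1 / (r * √(α 1)) with hc
      set s := x 2 / (r * √(α 2)) with hs
      have hx1 : x 1 = r * √(α 1) * c := by rw [hc]; field_simp
      have hx2 : x 2 = r * √(α 2) * s := by rw [hs]; field_simp
      have hcs : c ^ 2 + s ^ 2 = 1 := by
        rw [hx0, hx1, hx2] at he
        have : r ^ 2 * κ * (c ^ 2 + s ^ 2 - 1) = 0 := by
          linear_combination he - r ^ 2 * (a 0 * q 0 + a 1 * q 1 * c ^ 2 + a 2 * q 2 * s ^ 2)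
            - r ^ 2 * (m0 + c ^ 2 * m1 + s ^ 2 * m2)
        have := (mul_eq_zero.1 this).resolve_left (by positivity)
        linarith
      obtain ⟨u, hu⟩ : ∃ u : Circle, (u : ℂ) = ⟨c, s⟩ := by
        have h1 : ‖(⟨c, s⟩ : ℂ)‖ = 1 := by
          rw [Complex.norm_def, Complex.normSq_mk, Real.sqrt_eq_one]
          linarith
        refine ⟨Circle.exp (Complex.arg ⟨c, s⟩), ?_⟩
        have := Complex.norm_mul_exp_arg_mul_I ⟨c, s⟩
        rwa [h1, Complex.ofReal_one, one_mul] at this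
      refine ⟨(r, u, Circle.exp t), hrp.le, ?_⟩
      apply C3.ext
      · simp [coneMap, torus, hx0, expi_int, -Circle.coe_exp]; ring
      · simp [coneMap, torus, hx1, hu, expi_int, -Circle.coe_exp]; ring
      · simp [coneMap, torus, hx2, hu, expi_int, -Circle.coe_exp]; ring
  · rintro ⟨⟨r, u, v⟩, hr, rfl⟩
    obtain ⟨t, rfl⟩ := Circle.exp_surjective v
    refine ⟨![r * √(α 0), r * √(α 1) * (u : ℂ).re, r * √(α 2) * (u : ℂ).im], t, ?_, ?_, ?_⟩
    · simp only [Matrix.cons_val_zero]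
      exact mul_nonneg hr (Real.sqrt_nonneg _)
    · simp only [Matrix.cons_val_zero, Matrix.cons_val_one, Matrix.cons_val]
      linear_combination r ^ 2 * (a 0 * q 0 + a 1 * q 1 * (u : ℂ).re ^ 2
        + a 2 * q 2 * (u : ℂ).im ^ 2) + r ^ 2 * (m0 + (u : ℂ).re ^ 2 * m1 + (u : ℂ).im ^ 2 * m2)
        + r ^ 2 * κ * circle_sq_add_sq u
    · apply C3.ext
      · simp [coneMap, torus, expi_int, -Circle.coe_exp]; ring
      · simp [coneMap, torus, expi_int, -Circle.coe_exp]; ring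
      · simp [coneMap, torus, expi_int, -Circle.coe_exp]; ring

/-- The shear `(r, θ, t) ↦ (r, θ + t, 2t)`. -/
noncomputable def shear : (ℝ × ℝ × ℝ) ≃L[ℝ] ℝ × ℝ × ℝ :=
  LinearEquiv.toContinuousLinearEquiv
    { toFun := fun x => (x.1, x.2.1 + x.2.2, 2 * x.2.2)
      invFun := fun x => (x.1, x.2.1 - x.2.2 / 2, x.2.2 / 2)
      map_add' := fun x y => by
        simp only [Prod.fst_add, Prod.snd_add, Prod.mk_add_mk]; congr 2 <;> ring
      map_smul' := fun c x => by
        simp only [Prod.smul_fst, Prod.smul_snd, smul_eq_mul, RingHom.id_apply, Prod.smul_mk]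
        congr 2 <;> ring
      left_inv := fun x => by simp
      right_inv := fun x => by
        refine Prod.ext rfl (Prod.ext ?_ ?_) <;> simp only <;> ring }

theorem shear_apply (x : ℝ × ℝ × ℝ) : shear x = (x.1, x.2.1 + x.2.2, 2 * x.2.2) := rfl

/-- A square root on the circle. -/
noncomputable def circleSqrt (v : Circle) : Circle := Circle.exp (Complex.arg v / 2)

theorem circleSqrt_sq (v : Circle) : circleSqrt v ^ 2 = v := by
  rw [circleSqrt, sq, ← Circle.exp_add, add_halves, Circle.exp_arg]

theorem circle_eq_or_eq_neg_of_sq_eq {u v : Circle} (h : u ^ 2 = v ^ 2) : u = v ∨ u = -v := by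
  have : (u : ℂ) ^ 2 = (v : ℂ) ^ 2 := by rw [← Circle.coe_pow, h, Circle.coe_pow]
  rcases sq_eq_sq_iff_eq_or_eq_neg.1 this with h | h
  · exact Or.inl (Circle.ext h)
  · exact Or.inr (Circle.ext (by rw [h, Circle.coe_neg]))

/-- For `a 0` odd, `torus` already gives an injective cone. For `a 0` even it identifies `(u, v)`
with `(-u, -v)`; the quotient is again a torus, through `(u, v) ↦ (uv, v²)`, and `ℓ` is `torus` in
these coordinates. The choice of `circleSqrt` is immaterial by `hinv`, and smoothness comes from the
lift `shear` to `ℝ³`, not from the discontinuous square root. -/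
theorem isSLTorusCone_cone (hα : IsAlpha α) (hf : IsFreq a l) (ha : ∀ j, freq α j = a j) :
    IsSLTorusCone (cone fun j => a j) := by
  have hiff := fun b b' => coneMap_torus_eq_iff hα hf b b'
  by_cases hev : Even (a 0)
  · set ℓ : T2 → C3 := fun x => torus α a (x.1 * (circleSqrt x.2)⁻¹, circleSqrt x.2) with hℓ
    have hinv : ∀ u v : Circle, torus α a (-u, -v) = torus α a (u, v) := fun u v => by
      have := (hiff (1, u, v) (1, -u, -v) one_pos one_pos).2 (Or.inr ⟨hev, rfl⟩)
      simpa [coneMap] using this.symm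
    have hpull : ∀ u v : Circle, ℓ (u * v, v ^ 2) = torus α a (u, v) := fun u v => by
      simp only [hℓ]
      rcases circle_eq_or_eq_neg_of_sq_eq (circleSqrt_sq (v ^ 2)) with h | h
      · rw [h]; simp
      · rw [h, ← hinv u v]
        congr 2
        rw [inv_neg, mul_neg, mul_assoc, mul_inv_cancel, mul_one]
    have hsurj : ∀ x : T2, ∃ u v : Circle, x = (u * v, v ^ 2) := fun x =>
      ⟨x.1 * (circleSqrt x.2)⁻¹, circleSqrt x.2, by simp [circleSqrt_sq]⟩
    refine ⟨ℓ, ?_, ?_, ?_⟩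
    · rw [cone_eq_image hα ha]
      ext z
      constructor
      · rintro ⟨⟨r, u, v⟩, hr, rfl⟩
        exact ⟨(r, u * v, v ^ 2), hr, by simp [coneMap, hpull]⟩
      · rintro ⟨⟨r, x⟩, hr, rfl⟩
        obtain ⟨u, v, rfl⟩ := hsurj x
        exact ⟨(r, u, v), hr, by simp [coneMap, hpull]⟩
    · rintro ⟨r, x⟩ hr ⟨r', x'⟩ hr' h
      obtain ⟨u, v, rfl⟩ := hsurj x
      obtain ⟨u', v', rfl⟩ := hsurj x'
      have h2 : coneMap (torus α a) (r, u, v) = coneMap (torus α a) (r', u', v') := by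
        simpa [coneMap, hpull] using h
      rcases (hiff (r, u, v) (r', u', v') hr hr').1 h2 with h3 | ⟨-, h3⟩
      · simp only [Prod.mk.injEq] at h3
        obtain ⟨rfl, rfl, rfl⟩ := h3
        rfl
      · simp only [Prod.mk.injEq] at h3
        obtain ⟨rfl, rfl, rfl⟩ := h3
        simp
    · refine isSLImmersionOn_coneMap hα ha (e := shear) (fun _ => rfl) fun x => ?_
      rw [← coneMap_torus_toTorus]
      simp only [coneMap, toTorus, shear_apply]
      rw [Circle.exp_add, two_mul, Circle.exp_add, ← sq, hpull]
  · refine ⟨torus α a, cone_eq_image hα ha, fun b hb b' hb' h => ?_, isSLImmersionOn_torus hα ha⟩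
    exact ((hiff b b' hb hb').1 h).resolve_right fun h => hev h.1

end ConeInjective

/-! ### The double cover of the ends -/

/-- The complex number `|y|² e^{2iφ} e^{it}`, as a function on `ℝ × T²`. -/
noncomputable def endSquare (b : ℝ × T2) : ℂ := (2 * b.1 : ℝ) * ((b.2.1 * b.2.2 : Circle) : ℂ)

theorem continuous_endSquare : Continuous endSquare := by
  unfold endSquare
  fun_prop

theorem endSquare_ne_zero {b : ℝ × T2} (hb : 0 < b.1) : endSquare b ≠ 0 := by
  refine mul_ne_zero ?_ (Circle.coe_ne_zero _)
  exact_mod_cast (by positivity : (2 * b.1 : ℝ) ≠ 0)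

theorem norm_sq_mul_exp_two_arg (z : ℂ) :
    ((‖z‖ ^ 2 : ℝ) : ℂ) * (Circle.exp (2 * Complex.arg z) : ℂ) = z ^ 2 := by
  conv_rhs => rw [← Complex.norm_mul_exp_arg_mul_I z]
  rw [Circle.coe_exp, mul_pow, ← Complex.exp_nat_mul]
  push_cast
  congr 2
  ring

theorem endSquare_endCover (x : Cyl) : endSquare (endCover x) = x.2 ^ 2 := by
  rw [← norm_sq_mul_exp_two_arg, endSquare, endCover]
  simp only [inv_mul_cancel_right]
  congr 2
  ring

theorem endCover_eq_iff {b : ℝ × T2} (hb : 0 < b.1) (x : Cyl) :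
    endCover x = b ↔ x.1 = b.2.2 ∧ x.2 ^ 2 = endSquare b := by
  constructor
  · rintro rfl
    exact ⟨rfl, (endSquare_endCover x).symm⟩
  · rintro ⟨h1, h2⟩
    have hn : ‖x.2‖ ^ 2 = 2 * b.1 := by
      rw [← norm_pow, h2, endSquare, norm_mul, Circle.norm_coe, mul_one, Complex.norm_real,
        Real.norm_of_nonneg (by positivity)]
    have h3 := norm_sq_mul_exp_two_arg x.2
    rw [h2, hn, endSquare] at h3
    have h4 := Circle.ext (mul_left_cancel₀ (by exact_mod_cast (by positivity : (2 * b.1 : ℝ) ≠ 0))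
      h3)
    refine Prod.ext ?_ (Prod.ext ?_ h1)
    · simp only [endCover, hn]; ring
    · simp only [endCover, h4, h1, mul_inv_cancel_right]

theorem ncard_endCover_preimage {b : ℝ × T2} (hb : 0 < b.1) : (endCover ⁻¹' {b}).ncard = 2 := by
  obtain ⟨z, hz⟩ := IsAlgClosed.exists_pow_nat_eq (endSquare b) two_pos
  have hz0 : z ≠ 0 := by
    rintro rfl
    exact endSquare_ne_zero hb (by rw [← hz]; simp)
  have : endCover ⁻¹' {b} = {(b.2.2, z), (b.2.2, -z)} := by
    ext x
    rw [Set.mem_preimage, Set.mem_singleton_iff, endCover_eq_iff hb, ← hz,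
      sq_eq_sq_iff_eq_or_eq_neg,
      Set.mem_insert_iff, Set.mem_singleton_iff, Prod.ext_iff, Prod.ext_iff]
    tauto
  rw [this, Set.ncard_pair]
  intro h
  have := congrArg Prod.snd h
  simp only at this
  exact hz0 (self_eq_neg.1 this)

theorem continuousOn_endCover : ContinuousOn endCover {x | x.2 ≠ 0} := by
  have h1 : ContinuousOn (fun x : Cyl => Circle.exp (2 * Complex.arg x.2)) {x | x.2 ≠ 0} := by
    have hind : Topology.IsInducing (fun z : Circle => (z : ℂ)) := ⟨rfl⟩
    rw [hind.continuousOn_iff]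
    have : ContinuousOn (fun x : Cyl => x.2 ^ 2 / ((‖x.2‖ ^ 2 : ℝ) : ℂ)) {x | x.2 ≠ 0} := by
      refine ContinuousOn.div (by fun_prop) (by fun_prop) fun x hx => ?_
      have : ‖x.2‖ ≠ 0 := norm_ne_zero_iff.2 hx
      exact_mod_cast (by positivity : ‖x.2‖ ^ 2 ≠ 0)
    refine this.congr fun x hx => ?_
    have : ‖x.2‖ ≠ 0 := norm_ne_zero_iff.2 hx
    have h2 : ((‖x.2‖ ^ 2 : ℝ) : ℂ) ≠ 0 := by exact_mod_cast (by positivity : ‖x.2‖ ^ 2 ≠ 0)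
    rw [eq_div_iff h2, ← norm_sq_mul_exp_two_arg, mul_comm]
    rfl
  unfold endCover
  refine ContinuousOn.prodMk (by fun_prop) (ContinuousOn.prodMk ?_ (by fun_prop))
  exact h1.mul (by fun_prop)

/-- Up to carrying `e^{it}` along, `endCover` is the pullback along `endSquare` of the squaring map
on `ℂ ∖ {0}`, so local trivializations of `z ↦ z²` pull back; the fibre is that of the squaring map.
-/
theorem isCoveringMapOn_endCover : IsCoveringMapOn endCover {b | 0 < b.1} := by
  intro b₀ hb₀
  obtain ⟨hdisc, U, hmem, hU, hUpre, H, hH⟩ :=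
    isCoveringMapOn_npow (𝕜 := ℂ) 2 (by norm_num) (endSquare b₀) (endSquare_ne_zero hb₀)
  set V : Set (ℝ × T2) := {b | 0 < b.1 ∧ endSquare b ∈ U} with hV
  have hVopen : IsOpen V :=
    (isOpen_lt continuous_const continuous_fst).inter (hU.preimage continuous_endSquare)
  have hpre : endCover ⁻¹' V = {x | x.2 ≠ 0} ∩ {x | x.2 ^ 2 ∈ U} := by
    ext x
    simp only [hV, Set.mem_preimage, Set.mem_ofPred_eq, endSquare_endCover, Set.mem_inter_iff]
    refine and_congr_left fun _ => ?_
    simp only [endCover]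
    constructor
    · rintro h h0
      simp [h0] at h
    · intro h
      have := norm_pos_iff.2 h
      positivity
  have hsq : ∀ (b : V) (i : (fun x : ℂ => x ^ 2) ⁻¹' {endSquare b₀}),
      (H.symm (⟨endSquare b, b.2.2⟩, i) : ℂ) ^ 2 = endSquare b := fun b i => by
    have := hH (H.symm (⟨endSquare b, b.2.2⟩, i))
    rw [H.apply_symm_apply] at this
    exact this.symm
  have hcov : ∀ (b : V) (i : (fun x : ℂ => x ^ 2) ⁻¹' {endSquare b₀}),
      endCover ((b : ℝ × T2).2.2, (H.symm (⟨endSquare b, b.2.2⟩, i) : ℂ)) = b := fun b i =>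
    (endCover_eq_iff b.2.1 _).2 ⟨rfl, hsq b i⟩
  have hUmem : ∀ x : endCover ⁻¹' V, (x : Cyl).2 ∈ (fun x : ℂ => x ^ 2) ⁻¹' U := fun x =>
    ((Set.ext_iff.1 hpre _).1 x.2).2
  refine IsEvenlyCovered.to_isEvenlyCovered_preimage
    (I := (fun x : ℂ => x ^ 2) ⁻¹' {endSquare b₀}) ⟨hdisc, V, ⟨hb₀, hmem⟩, hVopen, ?_, ?_, ?_⟩
  · rw [hpre]
    exact (isOpen_ne_fun continuous_snd continuous_const).inter
      (hU.preimage (continuous_snd.pow 2))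
  · refine
      { toFun := fun x => (⟨endCover x, x.2⟩, (H ⟨(x : Cyl).2, hUmem x⟩).2)
        invFun := fun bi => ⟨((bi.1 : ℝ × T2).2.2, (H.symm (⟨endSquare bi.1, bi.1.2.2⟩, bi.2) : ℂ)),
          by rw [Set.mem_preimage, hcov]; exact bi.1.2⟩
        left_inv := ?_
        right_inv := ?_
        continuous_toFun := ?_
        continuous_invFun := ?_ }
    · intro x
      apply Subtype.ext
      refine Prod.ext rfl ?_
      simp only
      have : ((⟨endSquare (endCover (x : Cyl)), x.2.2⟩ : U), (H ⟨(x : Cyl).2, hUmem x⟩).2) =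
          H ⟨(x : Cyl).2, hUmem x⟩ := by
        refine Prod.ext (Subtype.ext ?_) rfl
        simp only
        rw [hH, endSquare_endCover]
      rw [this, H.symm_apply_apply]
    · rintro ⟨b, i⟩
      refine Prod.ext (Subtype.ext (hcov b i)) ?_
      simp
    · refine Continuous.prodMk (Continuous.subtype_mk ?_ _) ?_
      · refine continuousOn_iff_continuous_domRestrict.1 (continuousOn_endCover.mono ?_)
        rw [hpre]
        exact Set.inter_subset_left
      · exact continuous_snd.comp (H.continuous.comp
          (Continuous.subtype_mk (continuous_snd.comp continuous_subtype_val) _))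
    · refine Continuous.subtype_mk (Continuous.prodMk (by fun_prop) ?_) _
      refine continuous_subtype_val.comp (H.symm.continuous.comp (Continuous.prodMk
        (Continuous.subtype_mk ?_ _) continuous_snd))
      exact continuous_endSquare.comp (continuous_subtype_val.comp continuous_fst)
  · intro x
    rfl

/-! ### The evolution equations for the family -/

/-- Places each frequency strictly between consecutive multiples of `λ`, so that none of them is an
integer multiple of `λ`. -/
theorem IsAlpha.freq_lt_lam (h : IsAlpha α) : freq α 1 < lam α ∧ freq α 2 < lam α ∧
    lam α < -freq α 0 ∧ -freq α 0 < 2 * lam α := by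
  have hl := h.lam_sq
  have h0 := h.lam_pos
  have h1 := h.freq_pos1
  have h2 := h.freq_pos2
  have hs : freq α 0 = -(freq α 1 + freq α 2) := by linarith [h.freq_sum]
  rw [hs] at hl ⊢
  have h12 := mul_pos h1 h2
  refine ⟨?_, ?_, ?_, ?_⟩ <;> nlinarith

namespace Data

variable {S : Data}

theorem exists_int_mode (m n : Fin 4) : ∃ k : ℤ, mode m + mode n = 2 * k := by
  have h : ∀ m, ∃ k : ℤ, mode m = 2 * k + 1 := by
    intro m
    fin_cases m
    exacts [⟨-2, by norm_num [mode]⟩, ⟨-1, by norm_num [mode]⟩, ⟨0, by norm_num [mode]⟩,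
      ⟨1, by norm_num [mode]⟩]
  obtain ⟨k, hk⟩ := h m
  obtain ⟨k', hk'⟩ := h n
  exact ⟨k + k' + 1, by rw [hk, hk']; push_cast; ring⟩

/-- Sums of two modes are even, so the frequencies in `r` are `a_j + kλ` with `k` an integer. A zero
frequency would force a term linear in `t` into `r`, which would destroy periodicity. -/
theorem rFreq_ne_zero (hα : IsAlpha S.α) (j : Fin 3) (m n : Fin 4) : S.rFreq j m n ≠ 0 := by
  obtain ⟨k, hk⟩ := exists_int_mode m n
  obtain ⟨h1, h2, h3, h4⟩ := hα.freq_lt_lam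
  have h0 := hα.lam_pos
  have p1 := hα.freq_pos1
  have p2 := hα.freq_pos2
  rw [rFreq, hk]
  intro h
  have key : freq S.α j = (-k : ℤ) * lam S.α := by push_cast; linarith
  have hlt : ∀ (a b : ℤ), (a : ℝ) * lam S.α < b * lam S.α → a < b := fun a b hab => by
    exact_mod_cast lt_of_mul_lt_mul_right hab h0.le
  fin_cases j
  · have h5 : freq S.α 0 = (-k : ℤ) * lam S.α := key
    have := hlt 1 k (by push_cast at h5 ⊢; linarith)
    have := hlt k 2 (by push_cast at h5 ⊢; linarith)
    omega
  · have h5 : freq S.α 1 = (-k : ℤ) * lam S.α := key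
    have := hlt 0 (-k) (by push_cast at h5 ⊢; linarith)
    have := hlt (-k) 1 (by push_cast at h5 ⊢; linarith)
    omega
  · have h5 : freq S.α 2 = (-k : ℤ) * lam S.α := key
    have := hlt 0 (-k) (by push_cast at h5 ⊢; linarith)
    have := hlt (-k) 1 (by push_cast at h5 ⊢; linarith)
    omega

/-! ### Amplitudes and the differential equations for `w`, `p` and `r` -/

/-- The amplitude `c Z + d Z̄ + e W + f W̄` of the functions `p_j`. -/
noncomputable def amp (S : Data) (Z W : ℂ) (j : Fin 3) : ℂ :=
  Z * S.c j + conj Z * S.d j + W * S.e j + conj W * S.f j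

theorem amp_re (Z W : ℂ) (j : Fin 3) :
    (S.amp Z W j).re = (S.c j + S.d j) * Z.re + (S.e j + S.f j) * W.re := by
  simp [amp]; ring

theorem amp_im (Z W : ℂ) (j : Fin 3) :
    (S.amp Z W j).im = (S.c j - S.d j) * Z.im + (S.e j - S.f j) * W.im := by
  simp [amp]; ring

/-- The rotated parameter `C e^{iλt/2}`. -/
noncomputable def rotC (S : Data) (C : ℂ) (t : ℝ) : ℂ := C * expi (lam S.α / 2) t

/-- The rotated parameter `D e^{3iλt/2}`. -/
noncomputable def rotD (S : Data) (D : ℂ) (t : ℝ) : ℂ := D * expi (3 * lam S.α / 2) t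

theorem conj_rotC (C : ℂ) (t : ℝ) : conj (S.rotC C t) = conj C * expi (-(lam S.α / 2)) t := by
  rw [rotC, map_mul, conj_expi]

theorem conj_rotD (D : ℂ) (t : ℝ) : conj (S.rotD D t) = conj D * expi (-(3 * lam S.α / 2)) t := by
  rw [rotD, map_mul, conj_expi]

/-- Beyond the phase `e^{i a_j t}`, time acts only by rotating the constants; expressions such as
`conj Z * Z'` are therefore constant in time. -/
theorem p_eq (C D : ℂ) (j : Fin 3) (t : ℝ) : S.p C D j t =
    phase j * expi (freq S.α j) t * S.amp (S.rotC C t) (S.rotD D t) j := by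
  rw [p, amp, conj_rotC, conj_rotD, rotC, rotD, sub_eq_add_neg, sub_eq_add_neg, expi_add, expi_add,
    expi_add, expi_add]
  ring

theorem conj_amp (C D : ℂ) (j : Fin 3) (t : ℝ) : conj (S.amp (S.rotC C t) (S.rotD D t) j) =
    ∑ m, S.coeff C D j m * expi (mode m * lam S.α / 2) t := by
  simp only [amp, map_add, map_mul, Complex.conj_conj, Complex.conj_ofReal]
  rw [conj_rotC, conj_rotD, rotC, rotD]
  simp only [Fin.sum_univ_four, coeff, mode, Matrix.cons_val_zero, Matrix.cons_val_one,
    Matrix.cons_val, one_mul, neg_mul, neg_div]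
  ring

theorem conj_p (C D : ℂ) (j : Fin 3) (t : ℝ) : conj (S.p C D j t) =
    conj (phase j) * expi (-freq S.α j) t * conj (S.amp (S.rotC C t) (S.rotD D t) j) := by
  rw [p_eq, map_mul, map_mul, conj_expi]

theorem conj_w (j : Fin 3) (t : ℝ) : conj (S.w j t) =
    conj (phase j) * √(S.α j) * expi (-freq S.α j) t := by
  rw [w, map_mul, map_mul, conj_expi, Complex.conj_ofReal]

theorem expi_freq (hα : IsAlpha S.α) (t : ℝ) :
    expi (-freq S.α 1) t * expi (-freq S.α 2) t = expi (freq S.α 0) t ∧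
    expi (-freq S.α 0) t * expi (-freq S.α 2) t = expi (freq S.α 1) t ∧
    expi (-freq S.α 0) t * expi (-freq S.α 1) t = expi (freq S.α 2) t := by
  have := hα.freq_sum
  refine ⟨?_, ?_, ?_⟩ <;> rw [← expi_add] <;> congr 1 <;> linarith

theorem phase_zero : phase 0 = Complex.I := rfl
theorem phase_one : phase 1 = 1 := rfl
theorem phase_two : phase 2 = 1 := rfl

theorem hasDerivAt_w (hα : IsAlpha S.α) (t : ℝ) :
    HasDerivAt (S.w 0) (conj (S.w 1 t * S.w 2 t)) t ∧
    HasDerivAt (S.w 1) (-conj (S.w 0 t * S.w 2 t)) t ∧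
    HasDerivAt (S.w 2) (-conj (S.w 0 t * S.w 1 t)) t := by
  obtain ⟨x0, x1, x2⟩ := expi_freq hα t
  obtain ⟨m0, m1, m2⟩ := hα.mul_sqrt
  have c0 : (√(S.α 1) : ℂ) * √(S.α 2) = -freq S.α 0 * √(S.α 0) := by exact_mod_cast m0
  have c1 : (√(S.α 2) : ℂ) * √(S.α 0) = freq S.α 1 * √(S.α 1) := by exact_mod_cast m1
  have c2 : (√(S.α 0) : ℂ) * √(S.α 1) = freq S.α 2 * √(S.α 2) := by exact_mod_cast m2
  have h : ∀ j, HasDerivAt (S.w j)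
      (phase j * √(S.α j) * (Complex.I * freq S.α j * expi (freq S.α j) t)) t := fun j =>
    (hasDerivAt_expi _ t).const_mul _
  refine ⟨(h 0).congr_deriv ?_, (h 1).congr_deriv ?_, (h 2).congr_deriv ?_⟩ <;>
    simp only [map_mul, conj_w, phase_zero, phase_one, phase_two, Complex.conj_I, map_one]
  · rw [← x0]
    linear_combination √(S.α 0) * freq S.α 0 * expi (-freq S.α 1) t * expi (-freq S.α 2) t *
      Complex.I_sq - expi (-freq S.α 1) t * expi (-freq S.α 2) t * c0
  · rw [← x1]
    linear_combination -Complex.I * expi (-freq S.α 0) t * expi (-freq S.α 2) t * c1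
  · rw [← x2]
    linear_combination -Complex.I * expi (-freq S.α 0) t * expi (-freq S.α 1) t * c2

theorem hasDerivAt_p' (C D : ℂ) (j : Fin 3) (t : ℝ) : HasDerivAt (S.p C D j)
    (phase j * expi (freq S.α j) t * Complex.I *
      ((freq S.α j + lam S.α / 2) * S.rotC C t * S.c j +
        (freq S.α j - lam S.α / 2) * conj (S.rotC C t) * S.d j +
        (freq S.α j + 3 * lam S.α / 2) * S.rotD D t * S.e j +
        (freq S.α j - 3 * lam S.α / 2) * conj (S.rotD D t) * S.f j)) t := by
  have h := (((((hasDerivAt_expi (freq S.α j + lam S.α / 2) t).const_mul (C * S.c j)).add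
    ((hasDerivAt_expi (freq S.α j - lam S.α / 2) t).const_mul (conj C * S.d j))).add
    ((hasDerivAt_expi (freq S.α j + 3 * lam S.α / 2) t).const_mul (D * S.e j))).add
    ((hasDerivAt_expi (freq S.α j - 3 * lam S.α / 2) t).const_mul (conj D * S.f j))).const_mul
    (phase j)
  refine h.congr_deriv ?_
  rw [conj_rotC, conj_rotD, rotC, rotD, sub_eq_add_neg, sub_eq_add_neg, expi_add, expi_add,
    expi_add, expi_add]
  push_cast
  ring

/-- Comparing the coefficients of `Z`, `conj Z`, `W`, `conj W` leaves exactly the rows of the two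
eigenvalue equations, halved. -/
theorem hasDerivAt_p (hS : S.IsValid) (C D : ℂ) (t : ℝ) :
    HasDerivAt (S.p C D 0)
      (1 / 2 * conj (S.w 1 t * S.p C D 2 t + S.w 2 t * S.p C D 1 t)) t ∧
    HasDerivAt (S.p C D 1)
      (-(1 / 2) * conj (S.w 0 t * S.p C D 2 t + S.w 2 t * S.p C D 0 t)) t ∧
    HasDerivAt (S.p C D 2)
      (-(1 / 2) * conj (S.w 0 t * S.p C D 1 t + S.w 1 t * S.p C D 0 t)) t := by
  obtain ⟨hα, hc, he⟩ := hS
  obtain ⟨x0, x1, x2⟩ := expi_freq hα t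
  have hc' := evolMatrix_mulVec_eq_iff.1 hc.2.2
  have he' := evolMatrix_mulVec_eq_iff.1 he.2.2
  have cast : ∀ {a b : ℝ}, a = b → (a : ℂ) = b := fun h => congrArg _ h
  obtain ⟨⟨c0, c1, c2⟩, c3, c4, c5⟩ := hc'
  obtain ⟨⟨e0, e1, e2⟩, e3, e4, e5⟩ := he'
  replace c0 := cast c0; replace c1 := cast c1; replace c2 := cast c2
  replace c3 := cast c3; replace c4 := cast c4; replace c5 := cast c5
  replace e0 := cast e0; replace e1 := cast e1; replace e2 := cast e2
  replace e3 := cast e3; replace e4 := cast e4; replace e5 := cast e5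
  push_cast at c0 c1 c2 c3 c4 c5 e0 e1 e2 e3 e4 e5
  refine ⟨(hasDerivAt_p' C D 0 t).congr_deriv ?_, (hasDerivAt_p' C D 1 t).congr_deriv ?_,
    (hasDerivAt_p' C D 2 t).congr_deriv ?_⟩ <;>
    simp only [map_add, map_mul, conj_w, conj_p, phase_zero, phase_one, phase_two, Complex.conj_I,
      map_one, amp, Complex.conj_conj, Complex.conj_ofReal]
  · rw [← x0]
    generalize S.rotC C t = Z
    generalize S.rotD D t = W
    generalize expi (-freq S.α 1) t = X
    generalize expi (-freq S.α 2) t = Y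
    linear_combination X * Y * ((freq S.α 0 + lam S.α / 2) * Z * S.c 0 +
        (freq S.α 0 - lam S.α / 2) * conj Z * S.d 0 +
        (freq S.α 0 + 3 * lam S.α / 2) * W * S.e 0 +
        (freq S.α 0 - 3 * lam S.α / 2) * conj W * S.f 0) * Complex.I_sq
      + X * Y / 2 * (Z * c0 - conj Z * c3 + W * e0 - conj W * e3)
  · rw [← x1]
    generalize S.rotC C t = Z
    generalize S.rotD D t = W
    generalize expi (-freq S.α 0) t = X
    generalize expi (-freq S.α 2) t = Y
    linear_combination X * Y * Complex.I / 2 * (-Z * c1 + conj Z * c4 - W * e1 + conj W * e4)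
  · rw [← x2]
    generalize S.rotC C t = Z
    generalize S.rotD D t = W
    generalize expi (-freq S.α 0) t = X
    generalize expi (-freq S.α 1) t = Y
    linear_combination X * Y * Complex.I / 2 * (-Z * c2 + conj Z * c5 - W * e2 + conj W * e5)

theorem sum_coeff_mul (y z : Fin 4 → ℂ) (j : Fin 3) (t : ℝ) :
    ∑ m, ∑ n, y m * z n * expi (S.rFreq j m n) t = expi (freq S.α j) t *
      ((∑ m, y m * expi (mode m * lam S.α / 2) t) * ∑ n, z n * expi (mode n * lam S.α / 2) t) := by
  rw [Finset.sum_mul_sum, Finset.mul_sum]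
  refine Finset.sum_congr rfl fun m _ => ?_
  rw [Finset.mul_sum]
  refine Finset.sum_congr rfl fun n _ => ?_
  rw [rFreq, add_mul, add_div, expi_add, expi_add]
  ring

theorem hasDerivAt_sum (hα : IsAlpha S.α) (E : ℂ) (G : Fin 4 → Fin 4 → ℂ) (j : Fin 3) (t : ℝ) :
    HasDerivAt (fun t => E + ∑ m, ∑ n, G m n / (2 * S.rFreq j m n : ℝ) * expi (S.rFreq j m n) t)
      (Complex.I / 2 * ∑ m, ∑ n, G m n * expi (S.rFreq j m n) t) t := by
  have h : HasDerivAt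
      (fun t => E + ∑ m, ∑ n, G m n / (2 * S.rFreq j m n : ℝ) * expi (S.rFreq j m n) t)
      (∑ m, ∑ n, G m n / (2 * S.rFreq j m n : ℝ) *
        (Complex.I * S.rFreq j m n * expi (S.rFreq j m n) t)) t :=
    (HasDerivAt.fun_sum fun m _ => HasDerivAt.fun_sum fun n _ =>
      (hasDerivAt_expi _ t).const_mul _).const_add E
  refine h.congr_deriv ?_
  rw [Finset.mul_sum]
  refine Finset.sum_congr rfl fun m _ => ?_
  rw [Finset.mul_sum]
  refine Finset.sum_congr rfl fun n _ => ?_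
  have : (S.rFreq j m n : ℂ) ≠ 0 := by exact_mod_cast rFreq_ne_zero hα j m n
  push_cast
  field_simp

theorem hasDerivAt_r (hS : S.IsValid) (k : Params) (t : ℝ) :
    HasDerivAt (S.r k 0) (1 / 2 * conj (S.p (k.2 0) (k.2 1) 1 t * S.p (k.2 0) (k.2 1) 2 t +
      S.p (k.2 2) (k.2 3) 1 t * S.p (k.2 2) (k.2 3) 2 t)) t ∧
    HasDerivAt (S.r k 1) (1 / 2 * conj (S.p (k.2 2) (k.2 3) 2 t * S.p (k.2 2) (k.2 3) 0 t -
      S.p (k.2 0) (k.2 1) 0 t * S.p (k.2 0) (k.2 1) 2 t)) t ∧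
    HasDerivAt (S.r k 2) (-(1 / 2) * conj (S.p (k.2 0) (k.2 1) 0 t * S.p (k.2 2) (k.2 3) 1 t +
      S.p (k.2 0) (k.2 1) 1 t * S.p (k.2 2) (k.2 3) 0 t)) t := by
  obtain ⟨x0, x1, x2⟩ := expi_freq hS.1 t
  set y := S.coeff (k.2 0) (k.2 1) with hy
  set y' := S.coeff (k.2 2) (k.2 3) with hy'
  have h0 := hasDerivAt_sum hS.1 (k.1 0)
    (fun m n => -Complex.I * (y 1 m * y 2 n + y' 1 m * y' 2 n)) 0 t
  have h1 := hasDerivAt_sum hS.1 (k.1 1) (fun m n => y 0 m * y 2 n - y' 0 m * y' 2 n) 1 t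
  have h2 := hasDerivAt_sum hS.1 (k.1 2) (fun m n => y 0 m * y' 1 n + y 1 m * y' 0 n) 2 t
  have e0 : ∑ m, ∑ n, -Complex.I * (y 1 m * y 2 n + y' 1 m * y' 2 n) * expi (S.rFreq 0 m n) t =
      -Complex.I * (∑ m, ∑ n, y 1 m * y 2 n * expi (S.rFreq 0 m n) t +
        ∑ m, ∑ n, y' 1 m * y' 2 n * expi (S.rFreq 0 m n) t) := by
    simp only [Finset.mul_sum, mul_add, add_mul, mul_assoc, Finset.sum_add_distrib]
  have e1 : ∑ m, ∑ n, (y 0 m * y 2 n - y' 0 m * y' 2 n) * expi (S.rFreq 1 m n) t =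
      ∑ m, ∑ n, y 0 m * y 2 n * expi (S.rFreq 1 m n) t -
        ∑ m, ∑ n, y' 0 m * y' 2 n * expi (S.rFreq 1 m n) t := by
    simp only [sub_mul, Finset.sum_sub_distrib]
  have e2 : ∑ m, ∑ n, (y 0 m * y' 1 n + y 1 m * y' 0 n) * expi (S.rFreq 2 m n) t =
      ∑ m, ∑ n, y 0 m * y' 1 n * expi (S.rFreq 2 m n) t +
        ∑ m, ∑ n, y 1 m * y' 0 n * expi (S.rFreq 2 m n) t := by
    simp only [add_mul, Finset.sum_add_distrib]
  refine ⟨h0.congr_deriv ?_, h1.congr_deriv ?_, h2.congr_deriv ?_⟩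
  · rw [e0, sum_coeff_mul, sum_coeff_mul, ← x0]
    simp only [map_add, map_mul, conj_p, phase_one, phase_two, map_one, conj_amp, ← hy, ← hy']
    linear_combination -(1 / 2) * expi (-freq S.α 1) t * expi (-freq S.α 2) t *
      ((∑ m, y 1 m * expi (mode m * lam S.α / 2) t) * (∑ m, y 2 m * expi (mode m * lam S.α / 2) t) +
       (∑ m, y' 1 m * expi (mode m * lam S.α / 2) t) *
        (∑ m, y' 2 m * expi (mode m * lam S.α / 2) t)) * Complex.I_sq
  · rw [e1, sum_coeff_mul, sum_coeff_mul, ← x1]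
    simp only [map_sub, map_mul, conj_p, phase_zero, phase_two, Complex.conj_I, map_one, conj_amp,
      ← hy, ← hy']
    ring
  · rw [e2, sum_coeff_mul, sum_coeff_mul, ← x2]
    simp only [map_add, map_mul, conj_p, phase_zero, phase_one, Complex.conj_I, map_one, conj_amp,
      ← hy, ← hy']
    ring

/-! ### Smoothness, first derivatives and isotropy of `Φ` -/

theorem contDiff_w (j : Fin 3) : ContDiff ℝ ∞ (S.w j) := contDiff_const.mul (contDiff_expi _)

theorem contDiff_p (C D : ℂ) (j : Fin 3) : ContDiff ℝ ∞ (S.p C D j) :=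
  contDiff_const.mul ((((contDiff_const.mul (contDiff_expi _)).add
    (contDiff_const.mul (contDiff_expi _))).add (contDiff_const.mul (contDiff_expi _))).add
    (contDiff_const.mul (contDiff_expi _)))

theorem contDiff_r (k : Params) (j : Fin 3) : ContDiff ℝ ∞ (S.r k j) :=
  contDiff_const.add (ContDiff.sum fun _ _ => ContDiff.sum fun _ _ =>
    contDiff_const.mul (contDiff_expi _))

theorem contDiff_Phi (k : Params) :
    ContDiff ℝ ∞ fun x : ℝ × ℝ × ℝ => S.Phi k x.1 x.2.1 x.2.2 := by
  have h1 : ContDiff ℝ ∞ fun x : ℝ × ℝ × ℝ => (x.1 : ℂ) :=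
    Complex.ofRealCLM.contDiff.comp contDiff_fst
  have h2 : ContDiff ℝ ∞ fun x : ℝ × ℝ × ℝ => (x.2.1 : ℂ) :=
    Complex.ofRealCLM.contDiff.comp contDiff_snd.fst
  have ht : ContDiff ℝ ∞ fun x : ℝ × ℝ × ℝ => x.2.2 := contDiff_snd.snd
  have hw := fun j => (contDiff_w (S := S) j).comp ht
  have hp := fun C D j => (contDiff_p (S := S) C D j).comp ht
  have hr := fun j => (contDiff_r (S := S) k j).comp ht
  refine C3.contDiff (forall_fin3 ?_ ?_ ?_)
  · exact ((((contDiff_const.mul ((h1.pow 2).add (h2.pow 2))).mul (hw 0)).add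
      (h1.mul (hp _ _ 0))).add (h2.mul (hp _ _ 0))).add (hr 0)
  · exact ((((contDiff_const.mul ((h1.pow 2).sub (h2.pow 2))).mul (hw 1)).add
      (h1.mul (hp _ _ 1))).sub (h2.mul (hp _ _ 1))).add (hr 1)
  · exact ((((h1.mul h2).mul (hw 2)).add
      (h1.mul (hp _ _ 2))).add (h2.mul (hp _ _ 2))).add (hr 2)

/-- The derivative of `Φ` in `y₁`. -/
noncomputable def dPhi₁ (S : Data) (k : Params) (x : ℝ × ℝ × ℝ) : C3 :=
  !₂[x.1 * S.w 0 x.2.2 + S.p (k.2 0) (k.2 1) 0 x.2.2,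
    x.1 * S.w 1 x.2.2 + S.p (k.2 0) (k.2 1) 1 x.2.2,
    x.2.1 * S.w 2 x.2.2 + S.p (k.2 2) (k.2 3) 2 x.2.2]

/-- The derivative of `Φ` in `y₂`. -/
noncomputable def dPhi₂ (S : Data) (k : Params) (x : ℝ × ℝ × ℝ) : C3 :=
  !₂[x.2.1 * S.w 0 x.2.2 + S.p (k.2 2) (k.2 3) 0 x.2.2,
    -x.2.1 * S.w 1 x.2.2 - S.p (k.2 2) (k.2 3) 1 x.2.2,
    x.1 * S.w 2 x.2.2 + S.p (k.2 0) (k.2 1) 2 x.2.2]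

section

variable (k : Params) (y₁ y₂ t : ℝ)

theorem Phi_zero : S.Phi k y₁ y₂ t 0 = (1 / 2 : ℂ) * (y₁ ^ 2 + y₂ ^ 2) * S.w 0 t +
    y₁ * S.p (k.2 0) (k.2 1) 0 t + y₂ * S.p (k.2 2) (k.2 3) 0 t + S.r k 0 t := rfl

theorem Phi_one : S.Phi k y₁ y₂ t 1 = (1 / 2 : ℂ) * (y₁ ^ 2 - y₂ ^ 2) * S.w 1 t +
    y₁ * S.p (k.2 0) (k.2 1) 1 t - y₂ * S.p (k.2 2) (k.2 3) 1 t + S.r k 1 t := rfl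

theorem Phi_two : S.Phi k y₁ y₂ t 2 = (y₁ * y₂ : ℂ) * S.w 2 t +
    y₁ * S.p (k.2 2) (k.2 3) 2 t + y₂ * S.p (k.2 0) (k.2 1) 2 t + S.r k 2 t := rfl

end

/-- The terms pairing `Z` with `Z'` and `W` with `W'` form the admissibility expression; the mixed
terms vanish by the last two relations of `pairings`. This is the part of isotropy that does not
involve `y`. -/
theorem im_sum_conj_amp (hS : S.IsValid) {Z W Z' W' : ℂ}
    (h : (conj Z * Z').im * (S.c 0 ^ 2 - S.c 1 ^ 2 - S.c 2 ^ 2 - S.d 0 ^ 2 + S.d 1 ^ 2 + S.d 2 ^ 2)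
      + (conj W * W').im *
        (S.e 0 ^ 2 - S.e 1 ^ 2 - S.e 2 ^ 2 - S.f 0 ^ 2 + S.f 1 ^ 2 + S.f 2 ^ 2) = 0) :
    (conj (S.amp Z W 0) * S.amp Z' W' 0).im - (conj (S.amp Z W 1) * S.amp Z' W' 1).im -
      (conj (S.amp Z W 2) * S.amp Z' W' 2).im = 0 := by
  obtain ⟨-, -, h3, h4⟩ := hS.pairings
  simp only [Complex.mul_im, Complex.conj_re, Complex.conj_im, amp_re, amp_im] at h ⊢
  linear_combination h + (Z.re * W'.im - Z.im * W'.re + W.re * Z'.im - W.im * Z'.re) * h3 +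
    (Z.re * W'.im + Z.im * W'.re - W.re * Z'.im - W.im * Z'.re) * h4

/-- The part of isotropy linear in `y`: it pairs `w` with `p`, or with `q`, and vanishes because the
kernel vector `(√α, √α)` is orthogonal to both eigenvectors. -/
theorem im_sum_amp (hS : S.IsValid) (Z W : ℂ) :
    √(S.α 0) * (S.amp Z W 0).im - √(S.α 1) * (S.amp Z W 1).im - √(S.α 2) * (S.amp Z W 2).im
      = 0 := by
  obtain ⟨h1, h2, -, -⟩ := hS.pairings
  simp only [amp_im]
  linear_combination Z.im * h1 + W.im * h2

theorem conj_rot_mul (C C' : ℂ) (t : ℝ) : conj (S.rotC C t) * S.rotC C' t = conj C * C' := by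
  have : expi (-(lam S.α / 2)) t * expi (lam S.α / 2) t = 1 := by rw [← expi_add]; simp
  rw [conj_rotC, rotC]
  linear_combination conj C * C' * this

theorem conj_rotD_mul (C C' : ℂ) (t : ℝ) : conj (S.rotD C t) * S.rotD C' t = conj C * C' := by
  have : expi (-(3 * lam S.α / 2)) t * expi (3 * lam S.α / 2) t = 1 := by rw [← expi_add]; simp
  rw [conj_rotD, rotD]
  linear_combination conj C * C' * this

theorem conj_phase_mul (j : Fin 3) : conj (phase j) * phase j = 1 := by
  fin_cases j <;> simp [phase]

theorem isSLEvolution_Phi (hS : S.IsValid) {k : Params} (hk : k ∈ S.admissible) :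
    IsSLEvolution (fun x => S.Phi k x.1 x.2.1 x.2.2) (S.dPhi₁ k) (S.dPhi₂ k) (1 / 2) := by
  have hsm := contDiff_Phi (S := S) k
  refine ⟨by norm_num, hsm, ?_, ?_, ?_, ?_⟩
  · rintro ⟨y₁, y₂, t⟩
    have h := hasDerivAt_ofReal y₁
    refine fderiv_fst_eq hsm (C3.hasDerivAt_mk
      ((((((h.pow 2).add_const _).const_mul _).mul_const _).add (h.mul_const _)).add_const _
        |>.add_const _)
      ((((((h.pow 2).sub_const _).const_mul _).mul_const _).add (h.mul_const _)).sub_const _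
        |>.add_const _)
      ((((h.mul_const _).mul_const _).add (h.mul_const _)).add_const _
        |>.add_const _))
      (fun _ => C3.mk_eq (Phi_zero k _ y₂ t).symm (Phi_one k _ y₂ t).symm
        (Phi_two k _ y₂ t).symm) ?_
    apply C3.ext <;> simp [dPhi₁]
  · rintro ⟨y₁, y₂, t⟩
    have h := hasDerivAt_ofReal y₂
    refine fderiv_snd_eq hsm (C3.hasDerivAt_mk
      ((((((h.pow 2).const_add _).const_mul _).mul_const _).add_const _).add (h.mul_const _)
        |>.add_const _)
      ((((((h.pow 2).const_sub _).const_mul _).mul_const _).add_const _).sub (h.mul_const _)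
        |>.add_const _)
      ((((h.const_mul _).mul_const _).add_const _).add (h.mul_const _)
        |>.add_const _))
      (fun _ => C3.mk_eq (Phi_zero k y₁ _ t).symm (Phi_one k y₁ _ t).symm
        (Phi_two k y₁ _ t).symm) ?_
    apply C3.ext <;> simp [dPhi₂]
  · rintro ⟨y₁, y₂, t⟩
    obtain ⟨w0, w1, w2⟩ := hasDerivAt_w hS.1 t
    obtain ⟨p0, p1, p2⟩ := hasDerivAt_p hS (k.2 0) (k.2 1) t
    obtain ⟨q0, q1, q2⟩ := hasDerivAt_p hS (k.2 2) (k.2 3) t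
    obtain ⟨r0, r1, r2⟩ := hasDerivAt_r hS k t
    refine fderiv_thd_eq hsm (C3.hasDerivAt_mk
      ((((w0.const_mul _).add (p0.const_mul _)).add (q0.const_mul _)).add r0)
      ((((w1.const_mul _).add (p1.const_mul _)).sub (q1.const_mul _)).add r1)
      ((((w2.const_mul _).add (q2.const_mul _)).add (p2.const_mul _)).add r2))
      (fun _ => C3.mk_eq (Phi_zero k y₁ y₂ _).symm (Phi_one k y₁ y₂ _).symm
        (Phi_two k y₁ y₂ _).symm) ?_
    -- The derivatives of `w`, `p` and `q`, and `r` match the terms of degree two, one and zero in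
    -- `y` of half the conjugate cross product.
    apply C3.ext <;> simp [dPhi₁, dPhi₂] <;> ring
  · rintro ⟨y₁, y₂, t⟩
    have hw : ∀ i (C D : ℂ), (conj (S.w i t) * S.p C D i t) =
        √(S.α i) * S.amp (S.rotC C t) (S.rotD D t) i := fun i C D => by
      have : expi (-freq S.α i) t * expi (freq S.α i) t = 1 := by rw [← expi_add]; simp
      rw [conj_w, p_eq]
      linear_combination √(S.α i) * S.amp (S.rotC C t) (S.rotD D t) i *
        (expi (-freq S.α i) t * expi (freq S.α i) t * conj_phase_mul i + this)
    have hww : ∀ i, conj (S.w i t) * S.w i t = (√(S.α i) ^ 2 : ℝ) := fun i => by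
      have : expi (-freq S.α i) t * expi (freq S.α i) t = 1 := by rw [← expi_add]; simp
      rw [conj_w, w]
      push_cast
      linear_combination √(S.α i) ^ 2 *
        (expi (-freq S.α i) t * expi (freq S.α i) t * conj_phase_mul i + this)
    have hpp : ∀ i (C D C' D' : ℂ), conj (S.p C D i t) * S.p C' D' i t =
        conj (S.amp (S.rotC C t) (S.rotD D t) i) * S.amp (S.rotC C' t) (S.rotD D' t) i :=
      fun i C D C' D' => by
        have : expi (-freq S.α i) t * expi (freq S.α i) t = 1 := by rw [← expi_add]; simp
        rw [conj_p, p_eq]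
        linear_combination conj (S.amp (S.rotC C t) (S.rotD D t) i) *
          S.amp (S.rotC C' t) (S.rotD D' t) i *
          (expi (-freq S.α i) t * expi (freq S.α i) t * conj_phase_mul i + this)
    have h1 := im_sum_amp hS (S.rotC (k.2 0) t) (S.rotD (k.2 1) t)
    have h2 := im_sum_amp hS (S.rotC (k.2 2) t) (S.rotD (k.2 3) t)
    have h3 := im_sum_conj_amp hS (Z := S.rotC (k.2 0) t) (W := S.rotD (k.2 1) t)
      (Z' := S.rotC (k.2 2) t) (W' := S.rotD (k.2 3) t) (by
        rw [conj_rot_mul, conj_rotD_mul]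
        have : _ = (0 : ℝ) := hk
        simp only [Complex.mul_im, Complex.conj_re, Complex.conj_im] at this ⊢
        linear_combination -this)
    have hre : ∀ (i : Fin 3) (Z W : ℂ), ((√(S.α i) : ℂ) * S.amp Z W i).im =
        √(S.α i) * (S.amp Z W i).im := fun i Z W => Complex.im_ofReal_mul _ _
    rw [← hre, ← hre, ← hre, ← hw, ← hw, ← hw] at h1 h2
    rw [← hpp, ← hpp, ← hpp] at h3
    have w0 := congrArg Complex.im (hww 0)
    have w1 := congrArg Complex.im (hww 1)
    have w2 := congrArg Complex.im (hww 2)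
    rw [Complex.ofReal_im] at w0 w1 w2
    rw [C3.inner_eq]
    simp only [dPhi₁, dPhi₂]
    simp [Complex.mul_im, Complex.conj_re, Complex.conj_im] at *
    -- The terms quadratic in `y` are real multiples of `|w_j|²`, so the imaginary part is affine in
    -- `y`.
    linear_combination h3 + y₁ * h2 - y₂ * h1

end Data

/-! ### Periodicity of the family -/

theorem expi_int_two_pi_mul (m n : ℤ) (t : ℝ) :
    expi m (t + 2 * Real.pi * n) = expi m t := by
  rw [expi_eq_circleExp, expi_eq_circleExp]
  exact congrArg _ (Circle.exp_eq_exp.2 ⟨m * n, by push_cast; ring⟩)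

theorem expi_odd_half {l : ℤ} (hl : Odd l) (n : ℤ) (t : ℝ) :
    expi ((l : ℝ) / 2) (t + 2 * Real.pi * n) = (-1) ^ n * expi ((l : ℝ) / 2) t := by
  have : expi ((l : ℝ) / 2) (2 * Real.pi * n) = expi (1 / 2) (2 * Real.pi * (l * n : ℤ)) := by
    rw [expi_eq_circleExp, expi_eq_circleExp]
    congr 2
    push_cast
    ring
  rw [expi_add_right, this, expi_half_two_pi_mul, zpow_mul, hl.neg_one_zpow, mul_comm]

namespace Data

variable {S : Data} {a : Fin 3 → ℤ} {l : ℤ}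

theorem w_add (ha : ∀ j, freq S.α j = a j) (j : Fin 3) (t : ℝ) (n : ℤ) :
    S.w j (t + 2 * Real.pi * n) = S.w j t := by
  rw [w, w, ha, expi_int_two_pi_mul]

theorem amp_mul_neg_one_zpow (n : ℤ) (Z W : ℂ) (j : Fin 3) :
    S.amp ((-1) ^ n * Z) ((-1) ^ n * W) j = (-1) ^ n * S.amp Z W j := by
  simp only [amp, map_mul, map_zpow₀, map_neg, map_one]
  ring

/-- The frequencies are `a j ± l/2` and `a j ± 3l/2`, all in `ℤ + 1/2` because `l` is odd. -/
theorem p_add (hf : IsFreq a l) (ha : ∀ j, freq S.α j = a j) (hl : lam S.α = l) (C D : ℂ)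
    (j : Fin 3) (t : ℝ) (n : ℤ) :
    S.p C D j (t + 2 * Real.pi * n) = (-1) ^ n * S.p C D j t := by
  have h1 : S.rotC C (t + 2 * Real.pi * n) = (-1) ^ n * S.rotC C t := by
    rw [rotC, rotC, hl, expi_odd_half hf.odd]; ring
  have h3 : S.rotD D (t + 2 * Real.pi * n) = (-1) ^ n * S.rotD D t := by
    have := expi_odd_half ((by decide : Odd (3 : ℤ)).mul hf.odd) n t
    push_cast at this
    rw [rotD, rotD, hl, this]; ring
  rw [p_eq, p_eq, h1, h3, amp_mul_neg_one_zpow, ha, expi_int_two_pi_mul]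
  ring

theorem r_add (ha : ∀ j, freq S.α j = a j) (hl : lam S.α = l) (k : Params)
    (j : Fin 3) (t : ℝ) (n : ℤ) : S.r k j (t + 2 * Real.pi * n) = S.r k j t := by
  have h : ∀ m m', expi (S.rFreq j m m') (t + 2 * Real.pi * n) = expi (S.rFreq j m m') t := by
    intro m m'
    obtain ⟨i, hi⟩ := exists_int_mode m m'
    have : S.rFreq j m m' = (a j + i * l : ℤ) := by
      rw [rFreq, hi, ha, hl]; push_cast; ring
    rw [this, expi_int_two_pi_mul]
  simp only [r, h]

theorem Phi_add (hf : IsFreq a l) (ha : ∀ j, freq S.α j = a j) (hl : lam S.α = l) (k : Params)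
    (y₁ y₂ t : ℝ) (n : ℤ) :
    S.Phi k ((-1) ^ n * y₁) ((-1) ^ n * y₂) (t + 2 * Real.pi * n) = S.Phi k y₁ y₂ t := by
  have hs : ((-1 : ℂ) ^ n) * (-1) ^ n = 1 := by
    rw [← mul_zpow]; norm_num
  have hw := fun j => w_add (S := S) ha j t n
  have hp := fun C D j => p_add hf ha hl C D j t n
  have hr := fun j => r_add ha hl k j t n
  apply C3.ext
  · rw [Phi_zero, Phi_zero, hw, hr, hp, hp]
    push_cast
    linear_combination ((1 / 2 : ℂ) * (y₁ ^ 2 + y₂ ^ 2) * S.w 0 t + y₁ * S.p (k.2 0) (k.2 1) 0 t +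
      y₂ * S.p (k.2 2) (k.2 3) 0 t) * hs
  · rw [Phi_one, Phi_one, hw, hr, hp, hp]
    push_cast
    linear_combination ((1 / 2 : ℂ) * (y₁ ^ 2 - y₂ ^ 2) * S.w 1 t + y₁ * S.p (k.2 0) (k.2 1) 1 t -
      y₂ * S.p (k.2 2) (k.2 3) 1 t) * hs
  · rw [Phi_two, Phi_two, hw, hr, hp, hp]
    push_cast
    linear_combination ((y₁ * y₂ : ℂ) * S.w 2 t + y₁ * S.p (k.2 2) (k.2 3) 2 t +
      y₂ * S.p (k.2 0) (k.2 1) 2 t) * hs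

theorem Phi_add_two_pi (hf : IsFreq a l) (ha : ∀ j, freq S.α j = a j) (hl : lam S.α = l)
    (k : Params) (y₁ y₂ t : ℝ) : S.Phi k y₁ y₂ (t + 2 * Real.pi) = S.Phi k (-y₁) (-y₂) t := by
  have := Phi_add hf ha hl k (-y₁) (-y₂) t 1
  simpa using this

theorem Phi_add_four_pi (hf : IsFreq a l) (ha : ∀ j, freq S.α j = a j) (hl : lam S.α = l)
    (k : Params) (y₁ y₂ t : ℝ) : S.Phi k y₁ y₂ (t + 4 * Real.pi) = S.Phi k y₁ y₂ t := by
  rw [show t + 4 * Real.pi = t + 2 * Real.pi + 2 * Real.pi by ring, Phi_add_two_pi hf ha hl,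
    Phi_add_two_pi hf ha hl, neg_neg, neg_neg]

/-- The preimage chosen by `descend` differs from `(y₁, y₂, t)` by the `ℤ`-action, under which `Φ`
is invariant by `Phi_add`. -/
theorem F_toCyl (hf : IsFreq a l) (ha : ∀ j, freq S.α j = a j) (hl : lam S.α = l)
    (k : Params) (y₁ y₂ t : ℝ) : S.F k (toCyl y₁ y₂ t) = S.Phi k y₁ y₂ t := by
  set x := toCyl y₁ y₂ t with hx
  set t' : ℝ := Complex.arg x.1 with ht'
  set y : ℂ := x.2 * expi (-1 / 2) t' with hy
  have h : toCyl y.re y.im t' = toCyl y₁ y₂ t := by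
    rw [← hx]
    refine Prod.ext (Circle.exp_arg _) ?_
    simp only [toCyl, Complex.re_add_im]
    rw [hy, mul_assoc, ← expi_add]
    norm_num
  obtain ⟨n, h1, h2, h3⟩ := (toCyl_eq_iff _ _ _ _ _ _).1 h
  rw [h1, h2, h3, Phi_add hf ha hl]
  rfl

theorem range_F (hf : IsFreq a l) (ha : ∀ j, freq S.α j = a j) (hl : lam S.α = l)
    (k : Params) : Set.range (S.F k) = S.N k := by
  ext z
  constructor
  · rintro ⟨x, rfl⟩
    obtain ⟨y₁, y₂, t, rfl⟩ := toCyl_surjective x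
    exact ⟨y₁, y₂, t, F_toCyl hf ha hl k y₁ y₂ t⟩
  · rintro ⟨y₁, y₂, t, rfl⟩
    exact ⟨toCyl y₁ y₂ t, F_toCyl hf ha hl k y₁ y₂ t⟩

/-- Real and imaginary parts decouple into two real `2 × 2` systems, with coefficients the sums and
the differences of the eigenvector halves; `hadd` and `hsub` are their determinants. -/
theorem eq_zero_of_amp {i : Fin 3}
    (hsub : (S.c 0 - S.d 0) * (S.e i - S.f i) - (S.c i - S.d i) * (S.e 0 - S.f 0) ≠ 0)
    (hadd : (S.c 0 + S.d 0) * (S.e i + S.f i) - (S.c i + S.d i) * (S.e 0 + S.f 0) ≠ 0) {Z W : ℂ}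
    (h0 : S.amp Z W 0 = 0) (h1 : S.amp Z W i = 0) : Z = 0 ∧ W = 0 := by
  have a0 := amp_re (S := S) Z W 0
  have a1 := amp_re (S := S) Z W i
  have b0 := amp_im (S := S) Z W 0
  have b1 := amp_im (S := S) Z W i
  rw [h0] at a0 b0
  rw [h1] at a1 b1
  simp only [Complex.zero_re, Complex.zero_im] at a0 a1 b0 b1
  have e1 : Z.re = 0 := (mul_eq_zero.1 (by
    linear_combination (S.e 0 + S.f 0) * a1 - (S.e i + S.f i) * a0)).resolve_left hadd
  have e2 : Z.im = 0 := (mul_eq_zero.1 (by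
    linear_combination (S.e 0 - S.f 0) * b1 - (S.e i - S.f i) * b0)).resolve_left hsub
  have e3 : W.re = 0 := (mul_eq_zero.1 (by
    linear_combination (S.c i + S.d i) * a0 - (S.c 0 + S.d 0) * a1)).resolve_left hadd
  have e4 : W.im = 0 := (mul_eq_zero.1 (by
    linear_combination (S.c i - S.d i) * b0 - (S.c 0 - S.d 0) * b1)).resolve_left hsub
  exact ⟨Complex.ext e1 e2, Complex.ext e3 e4⟩

theorem IsNondegenerate.eq_zero_of_p (hn : S.IsNondegenerate) {C D : ℂ} {t : ℝ}
    (h0 : S.p C D 0 t = 0) (h1 : S.p C D 1 t = 0) : C = 0 ∧ D = 0 := by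
  rw [p_eq] at h0 h1
  obtain ⟨h, h'⟩ := eq_zero_of_amp hn.sub1 hn.add1
    ((mul_eq_zero.1 h0).resolve_left (mul_ne_zero Complex.I_ne_zero (expi_ne_zero _ _)))
    ((mul_eq_zero.1 h1).resolve_left (mul_ne_zero one_ne_zero (expi_ne_zero _ _)))
  exact ⟨(mul_eq_zero.1 h).resolve_right (expi_ne_zero _ _),
    (mul_eq_zero.1 h').resolve_right (expi_ne_zero _ _)⟩

theorem w_ne_zero (hα : IsAlpha S.α) (j : Fin 3) (t : ℝ) : S.w j t ≠ 0 := by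
  have := (hα.sqrt_pos j).ne'
  refine mul_ne_zero (mul_ne_zero ?_ (by exact_mod_cast this)) (expi_ne_zero _ _)
  fin_cases j <;> simp [phase]

theorem period_of_Phi (hf : IsFreq a l) (hS : S.IsValid) (ha : ∀ j, freq S.α j = a j)
    {k : Params} (hk : k.2 ≠ 0) {T : ℝ}
    (hT : ∀ y₁ y₂ t : ℝ, S.Phi k y₁ y₂ (t + T) = S.Phi k y₁ y₂ t) :
    ∃ n : ℤ, T = 4 * Real.pi * n := by
  have hl := lam_eq hf hS ha
  have hn := hS.isNondegenerate hf ha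
  have hc : ∀ j y₁ y₂, S.Phi k y₁ y₂ (0 + T) j = S.Phi k y₁ y₂ 0 j := fun j y₁ y₂ =>
    congrArg (fun z : C3 => z j) (hT y₁ y₂ 0)
  -- Second differences in `y`, mixed for the third component, extract the quadratic coefficients
  -- `w_j`.
  have hw : ∀ j, S.w j (0 + T) = S.w j 0 := by
    refine forall_fin3 ?_ ?_ ?_
    · have h1 := hc 0 1 0
      have h2 := hc 0 (-1) 0
      have h3 := hc 0 0 0
      simp only [Phi_zero] at h1 h2 h3
      push_cast at h1 h2 h3
      linear_combination h1 + h2 - 2 * h3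
    · have h1 := hc 1 1 0
      have h2 := hc 1 (-1) 0
      have h3 := hc 1 0 0
      simp only [Phi_one] at h1 h2 h3
      push_cast at h1 h2 h3
      linear_combination h1 + h2 - 2 * h3
    · have h1 := hc 2 1 1
      have h2 := hc 2 1 0
      have h3 := hc 2 0 1
      have h4 := hc 2 0 0
      simp only [Phi_two] at h1 h2 h3 h4
      push_cast at h1 h2 h3 h4
      linear_combination h1 - h2 - h3 + h4
  have hexp : Circle.exp T = 1 := by
    refine hf.eq_one_of_zpow fun j => Circle.ext ?_
    have h1 := hw j
    have h0 := w_ne_zero hS.1 j 0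
    have h2 : S.w j (0 + T) = S.w j 0 * expi (a j) T := by
      rw [w, w, expi_add_right, ha]; ring
    rw [h2] at h1
    rw [Circle.coe_zpow, ← expi_int, Circle.coe_one]
    exact mul_left_cancel₀ h0 (by rw [h1, mul_one])
  obtain ⟨m, hm⟩ := Circle.exp_eq_one.1 hexp
  -- An odd multiple of `2π` fixes `w` and `r` but negates `p` and `q`, so these would vanish at `t
  -- = 0`, which nondegeneracy allows only for zero constants.
  rcases Int.even_or_odd m with ⟨n, rfl⟩ | hodd
  · exact ⟨n, by rw [hm]; push_cast; ring⟩
  · exfalso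
    apply hk
    have hneg : ∀ C D j, S.p C D j (0 + T) = -S.p C D j 0 := fun C D j => by
      rw [hm, mul_comm (m : ℝ), p_add hf ha hl, hodd.neg_one_zpow]; ring
    have hrr : ∀ j, S.r k j (0 + T) = S.r k j 0 := fun j => by
      rw [hm, mul_comm (m : ℝ), r_add ha hl]
    have e1 := hc 0 1 0
    have e2 := hc 1 1 0
    have e3 := hc 0 0 1
    have e4 := hc 1 0 1
    simp only [Phi_zero, Phi_one, hw, hneg, hrr] at e1 e2 e3 e4
    push_cast at e1 e2 e3 e4
    obtain ⟨h0, h1⟩ := hn.eq_zero_of_p (C := k.2 0) (D := k.2 1) (t := 0)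
      (by linear_combination -e1 / 2) (by linear_combination -e2 / 2)
    obtain ⟨h2, h3⟩ := hn.eq_zero_of_p (C := k.2 2) (D := k.2 3) (t := 0)
      (by linear_combination -e3 / 2) (by linear_combination e4 / 2)
    ext j
    fin_cases j
    exacts [h0, h1, h2, h3]

/-! ### Smoothness and density of the immersed points -/

theorem F_toCyl' (hf : IsFreq a l) (ha : ∀ j, freq S.α j = a j) (hl : lam S.α = l) (k : Params)
    (x : ℝ × ℝ × ℝ) : S.F k (toCyl x.1 x.2.1 x.2.2) = S.Phi k x.1 x.2.1 x.2.2 :=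
  F_toCyl hf ha hl k _ _ _

theorem continuous_toCyl : Continuous fun x : ℝ × ℝ × ℝ => toCyl x.1 x.2.1 x.2.2 :=
  hasSmoothSections_toCyl.smooth.continuous

theorem contMDiff_F (hf : IsFreq a l) (ha : ∀ j, freq S.α j = a j) (hl : lam S.α = l)
    (k : Params) : ContMDiff cylModel 𝓘(ℝ, C3) ∞ (S.F k) :=
  hasSmoothSections_toCyl.contMDiff (contDiff_Phi k) (F_toCyl' hf ha hl k)

/-- Along lines in the `y₁` direction the first component of the cross product is, up to
conjugation, a quadratic polynomial with leading coefficient `w₁w₂ ≠ 0` (indices from 0). If it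
vanished on an interval, so would its second difference at `0` and `±ε/2`. -/
theorem dense_conjCross_ne_zero (hα : IsAlpha S.α) (k : Params) :
    Dense {x | conjCross (S.dPhi₁ k x) (S.dPhi₂ k x) ≠ 0} := by
  rw [Metric.dense_iff]
  rintro ⟨y₁, y₂, t⟩ ε hε
  by_contra hcon
  rw [Set.not_nonempty_iff_eq_empty] at hcon
  have h : ∀ s : ℝ, |s| < ε → S.dPhi₁ k (y₁ + s, y₂, t) 1 * S.dPhi₂ k (y₁ + s, y₂, t) 2 -
      S.dPhi₁ k (y₁ + s, y₂, t) 2 * S.dPhi₂ k (y₁ + s, y₂, t) 1 = 0 := by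
    intro s hs
    have hmem : ((y₁ + s, y₂, t) : ℝ × ℝ × ℝ) ∈ Metric.ball (y₁, y₂, t) ε := by
      rw [Metric.mem_ball, dist_eq_norm]
      simpa [Prod.norm_def] using hs
    have h0 : conjCross (S.dPhi₁ k (y₁ + s, y₂, t)) (S.dPhi₂ k (y₁ + s, y₂, t)) = 0 := by
      by_contra hne
      exact Set.eq_empty_iff_forall_notMem.1 hcon _ ⟨hmem, hne⟩
    have h1 := congrArg (fun z : C3 => z 0) h0
    simpa only [conjCross_zero, PiLp.zero_apply, map_eq_zero] using h1
  have h0 := h 0 (by simpa using hε)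
  have h1 := h (ε / 2) (by rw [abs_of_pos (by linarith)]; linarith)
  have h2 := h (-(ε / 2)) (by rw [abs_neg, abs_of_pos (by linarith)]; linarith)
  simp [dPhi₁, dPhi₂] at h0 h1 h2
  have : 2 * ((ε : ℂ) / 2) ^ 2 * (S.w 1 t * S.w 2 t) = 0 := by
    linear_combination h1 + h2 - 2 * h0
  have hε' : (ε : ℂ) ≠ 0 := by exact_mod_cast hε.ne'
  simp [w_ne_zero hα, hε'] at this

theorem isSLParametrized_F (hf : IsFreq a l) (hS : S.IsValid) (ha : ∀ j, freq S.α j = a j)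
    {k : Params} (hk : k ∈ S.admissible) : IsSLParametrized cylModel (S.F k) := by
  have hl := lam_eq hf hS ha
  have hev := isSLEvolution_Phi hS hk
  have hF := F_toCyl' hf ha hl k
  refine ⟨contMDiff_F hf ha hl k, ?_, fun x hx => ?_⟩
  · refine ((hasSmoothSections_toCyl.surj.denseRange).dense_image continuous_toCyl
      (dense_conjCross_ne_zero hS.1 k)).mono ?_
    rintro _ ⟨x, hx, rfl⟩
    exact (hev.immersedAt_iff finrank_cylModel hasSmoothSections_toCyl hF x).2 hx
  · exact hev.isSLPlane finrank_cylModel hasSmoothSections_toCyl hF hx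

theorem isSLImmersionOn_F_iff (hf : IsFreq a l) (hS : S.IsValid) (ha : ∀ j, freq S.α j = a j)
    {k : Params} (hk : k ∈ S.admissible) : IsSLImmersionOn cylModel (S.F k) Set.univ ↔
      ∀ x, conjCross (S.dPhi₁ k x) (S.dPhi₂ k x) ≠ 0 := by
  have hl := lam_eq hf hS ha
  have hev := isSLEvolution_Phi hS hk
  have hF := F_toCyl' hf ha hl k
  have hi := fun x => hev.immersedAt_iff finrank_cylModel hasSmoothSections_toCyl hF x
  constructor
  · exact fun h x => (hi x).1 (h.2 _ trivial).1
  · refine fun h => ⟨contMDiff_F hf ha hl k, fun m _ => ?_⟩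
    have hm : ImmersedAt cylModel (S.F k) m := by
      obtain ⟨x, rfl⟩ := hasSmoothSections_toCyl.surj m
      exact (hi x).2 (h x)
    exact ⟨hm, hev.isSLPlane finrank_cylModel hasSmoothSections_toCyl hF hm⟩

end Data

/-! ### Behaviour at infinity -/

theorem C3.norm_le (z : C3) : ‖z‖ ≤ ‖z 0‖ + ‖z 1‖ + ‖z 2‖ := by
  rw [EuclideanSpace.norm_eq, Fin.sum_univ_three]
  refine Real.sqrt_le_iff.2 ⟨by positivity, ?_⟩
  nlinarith [mul_nonneg (norm_nonneg (z 0)) (norm_nonneg (z 1)),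
    mul_nonneg (norm_nonneg (z 0)) (norm_nonneg (z 2)),
    mul_nonneg (norm_nonneg (z 1)) (norm_nonneg (z 2))]

namespace Data

variable {S : Data} {a : Fin 3 → ℤ} {l : ℤ}

theorem exists_norm_le_of_periodic {f : ℝ → ℂ} (hf : Continuous f) {c : ℝ} (hc : c ≠ 0)
    (h : ∀ t, f (t + c) = f t) : ∃ K, ∀ t, ‖f t‖ ≤ K := by
  obtain ⟨K, hK⟩ := (Function.Periodic.isBounded_of_continuous (f := f) h hc hf).exists_norm_le
  exact ⟨K, fun t => hK _ ⟨t, rfl⟩⟩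

theorem exists_norm_p_le (hf : IsFreq a l) (ha : ∀ j, freq S.α j = a j) (hl : lam S.α = l)
    (C D : ℂ) (j : Fin 3) : ∃ K, ∀ t, ‖S.p C D j t‖ ≤ K := by
  refine exists_norm_le_of_periodic (contDiff_p C D j).continuous (c := 4 * Real.pi)
    (by positivity) fun t => ?_
  have := p_add hf ha hl C D j t 2
  rw [show t + 4 * Real.pi = t + 2 * Real.pi * (2 : ℤ) by push_cast; ring, this]
  norm_num

theorem exists_norm_r_le (ha : ∀ j, freq S.α j = a j) (hl : lam S.α = l)
    (k : Params) (j : Fin 3) : ∃ K, ∀ t, ‖S.r k j t‖ ≤ K := by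
  refine exists_norm_le_of_periodic (contDiff_r k j).continuous (c := 2 * Real.pi)
    (by positivity) fun t => ?_
  have := r_add ha hl k j t 1
  rwa [Int.cast_one, mul_one] at this

theorem exists_bound (hf : IsFreq a l) (ha : ∀ j, freq S.α j = a j) (hl : lam S.α = l)
    (k : Params) : ∃ K, 0 < K ∧ ∀ j t, ‖S.p (k.2 0) (k.2 1) j t‖ ≤ K ∧
      ‖S.p (k.2 2) (k.2 3) j t‖ ≤ K ∧ ‖S.r k j t‖ ≤ K := by
  choose A hA using exists_norm_p_le hf ha hl (k.2 0) (k.2 1)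
  choose B hB using exists_norm_p_le hf ha hl (k.2 2) (k.2 3)
  choose C hC using exists_norm_r_le ha hl k
  have hle : ∀ (u : Fin 3 → ℝ) j, u j ≤ ∑ i, |u i| := fun u j =>
    (le_abs_self _).trans (Finset.single_le_sum (f := fun i => |u i|) (fun i _ => abs_nonneg _)
      (Finset.mem_univ j))
  have hp : ∀ u : Fin 3 → ℝ, 0 ≤ ∑ i, |u i| := fun u => Finset.sum_nonneg fun i _ => abs_nonneg _
  have := hp A
  have := hp B
  have := hp C
  refine ⟨∑ i, |A i| + ∑ i, |B i| + ∑ i, |C i| + 1, by linarith, fun j t => ⟨?_, ?_, ?_⟩⟩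
  · linarith [hA j t, hle A j]
  · linarith [hB j t, hle B j]
  · linarith [hC j t, hle C j]

theorem coneMap_torus_endCover (ha : ∀ j, freq S.α j = a j) (y₁ y₂ t : ℝ) :
    coneMap (torus S.α a) (endCover (toCyl y₁ y₂ t)) =
      !₂[(1 / 2 : ℂ) * (y₁ ^ 2 + y₂ ^ 2) * S.w 0 t, (1 / 2 : ℂ) * (y₁ ^ 2 - y₂ ^ 2) * S.w 1 t,
        (y₁ * y₂ : ℂ) * S.w 2 t] := by
  set z : ℂ := (y₁ + y₂ * Complex.I) * expi (1 / 2) t with hz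
  set u : Circle := Circle.exp (2 * Complex.arg z) * (Circle.exp t)⁻¹ with hu
  have hnorm : ‖z‖ ^ 2 = y₁ ^ 2 + y₂ ^ 2 := by
    rw [hz, norm_mul, norm_expi, mul_one, ← Complex.normSq_eq_norm_sq,
      Complex.normSq_add_mul_I]
  have hz2 : z ^ 2 = (y₁ + y₂ * Complex.I) ^ 2 * (Circle.exp t : ℂ) := by
    rw [hz, mul_pow, sq (expi _ _), ← expi_add, expi_eq_circleExp]
    norm_num
  have hsq : ((‖z‖ ^ 2 : ℝ) : ℂ) * (u : ℂ) = (y₁ + y₂ * Complex.I) ^ 2 := by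
    rw [hu, Circle.coe_mul, ← mul_assoc, norm_sq_mul_exp_two_arg, hz2, mul_assoc, ← Circle.coe_mul,
      mul_inv_cancel, Circle.coe_one, mul_one]
  have hre := congrArg Complex.re hsq
  have him := congrArg Complex.im hsq
  rw [Complex.re_ofReal_mul] at hre
  rw [Complex.im_ofReal_mul] at him
  have hre' : ‖z‖ ^ 2 * (u : ℂ).re = y₁ ^ 2 - y₂ ^ 2 := by
    rw [hre]; simp [sq]
  have him' : ‖z‖ ^ 2 * (u : ℂ).im = 2 * (y₁ * y₂) := by
    rw [him]; simp [sq]; ring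
  have e0 : ((‖z‖ : ℂ)) ^ 2 = y₁ ^ 2 + y₂ ^ 2 := by exact_mod_cast hnorm
  have e1 : ((‖z‖ : ℂ)) ^ 2 * ((u : ℂ).re : ℂ) = y₁ ^ 2 - y₂ ^ 2 := by exact_mod_cast hre'
  have e2 : ((‖z‖ : ℂ)) ^ 2 * ((u : ℂ).im : ℂ) = 2 * (y₁ * y₂) := by exact_mod_cast him'
  have hcov : endCover (toCyl y₁ y₂ t) = (‖z‖ ^ 2 / 2, (u, Circle.exp t)) := rfl
  rw [hcov]
  have hw : ∀ j, S.w j t = phase j * √(S.α j) * (Circle.exp t : ℂ) ^ a j := fun j => by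
    rw [w, ha, expi_int]
  generalize hv : Circle.exp t = v at *
  apply C3.ext
  · simp [coneMap, torus, hw, phase, -mul_eq_mul_left_iff, -mul_eq_mul_right_iff]
    linear_combination √(S.α 0) * Complex.I * (v : ℂ) ^ a 0 / 2 * e0
  · simp [coneMap, torus, hw, phase]
    linear_combination √(S.α 1) * (v : ℂ) ^ a 1 / 2 * e1
  · simp [coneMap, torus, hw, phase]
    linear_combination √(S.α 2) * (v : ℂ) ^ a 2 / 2 * e2

/-- Removing the part quadratic in `y` leaves only terms `y₁p`, `y₂q` and `r`, whose coefficients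
are continuous and periodic, hence bounded. -/
theorem exists_norm_F_sub_le (hf : IsFreq a l) (ha : ∀ j, freq S.α j = a j)
    (hl : lam S.α = l) (k : Params) : ∃ K, 0 < K ∧ ∀ x,
      ‖S.F k x - coneMap (torus S.α a) (endCover x)‖ ≤ K * (1 + ‖x.2‖) := by
  obtain ⟨K, hK, hb⟩ := exists_bound hf ha hl k
  refine ⟨6 * K, by positivity, fun x => ?_⟩
  obtain ⟨y₁, y₂, t, rfl⟩ := toCyl_surjective x
  have hn : ‖(toCyl y₁ y₂ t).2‖ = ‖(y₁ + y₂ * Complex.I : ℂ)‖ := by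
    rw [toCyl, norm_mul, norm_expi, mul_one]
  have h1 : |y₁| ≤ ‖(toCyl y₁ y₂ t).2‖ := by
    rw [hn]; simpa using Complex.abs_re_le_norm (y₁ + y₂ * Complex.I)
  have h2 : |y₂| ≤ ‖(toCyl y₁ y₂ t).2‖ := by
    rw [hn]; simpa using Complex.abs_im_le_norm (y₁ + y₂ * Complex.I)
  set m := ‖(toCyl y₁ y₂ t).2‖ with hm
  have hm0 : 0 ≤ m := norm_nonneg _
  have key : ∀ A B C : ℂ, ‖A‖ ≤ K → ‖B‖ ≤ K → ‖C‖ ≤ K → ‖y₁ * A + y₂ * B + C‖ ≤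
      2 * K * (1 + m) := by
    intro A B C hA hB hC
    refine norm_add₃_le.trans ?_
    rw [norm_mul, norm_mul, Complex.norm_real, Complex.norm_real, Real.norm_eq_abs,
      Real.norm_eq_abs]
    have := mul_le_mul h1 hA (norm_nonneg _) hm0
    have := mul_le_mul h2 hB (norm_nonneg _) hm0
    nlinarith
  refine (C3.norm_le _).trans ?_
  rw [F_toCyl hf ha hl, coneMap_torus_endCover ha]
  have c0 := key _ _ _ (hb 0 t).1 (hb 0 t).2.1 (hb 0 t).2.2
  have c1 := key _ (-_) _ (hb 1 t).1 ((norm_neg _).trans_le (hb 1 t).2.1) (hb 1 t).2.2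
  have c2 := key _ _ _ (hb 2 t).2.1 (hb 2 t).1 (hb 2 t).2.2
  have d0 : (S.Phi k y₁ y₂ t - !₂[(1 / 2 : ℂ) * (y₁ ^ 2 + y₂ ^ 2) * S.w 0 t,
      (1 / 2 : ℂ) * (y₁ ^ 2 - y₂ ^ 2) * S.w 1 t, (y₁ * y₂ : ℂ) * S.w 2 t]) 0 =
      y₁ * S.p (k.2 0) (k.2 1) 0 t + y₂ * S.p (k.2 2) (k.2 3) 0 t + S.r k 0 t := by
    simp [Phi_zero]; ring
  have d1 : (S.Phi k y₁ y₂ t - !₂[(1 / 2 : ℂ) * (y₁ ^ 2 + y₂ ^ 2) * S.w 0 t,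
      (1 / 2 : ℂ) * (y₁ ^ 2 - y₂ ^ 2) * S.w 1 t, (y₁ * y₂ : ℂ) * S.w 2 t]) 1 =
      y₁ * S.p (k.2 0) (k.2 1) 1 t + y₂ * -S.p (k.2 2) (k.2 3) 1 t + S.r k 1 t := by
    simp [Phi_one]; ring
  have d2 : (S.Phi k y₁ y₂ t - !₂[(1 / 2 : ℂ) * (y₁ ^ 2 + y₂ ^ 2) * S.w 0 t,
      (1 / 2 : ℂ) * (y₁ ^ 2 - y₂ ^ 2) * S.w 1 t, (y₁ * y₂ : ℂ) * S.w 2 t]) 2 =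
      y₁ * S.p (k.2 2) (k.2 3) 2 t + y₂ * S.p (k.2 0) (k.2 1) 2 t + S.r k 2 t := by
    simp [Phi_two]; ring
  rw [d0, d1, d2]
  linarith

theorem le_norm_coneMap_endCover (x : Cyl) :
    √(S.α 0) / 2 * ‖x.2‖ ^ 2 ≤ ‖coneMap (torus S.α a) (endCover x)‖ := by
  refine le_trans (le_of_eq ?_) (PiLp.norm_apply_le (coneMap (torus S.α a) (endCover x)) 0)
  simp [coneMap, torus, endCover, abs_of_nonneg (Real.sqrt_nonneg (S.α 0))]
  rw [Circle.norm_coe, one_zpow]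
  ring

theorem exists_le_norm_F (hf : IsFreq a l) (hα : IsAlpha S.α) (ha : ∀ j, freq S.α j = a j)
    (hl : lam S.α = l) (k : Params) : ∃ δ R, 0 < δ ∧ 1 ≤ R ∧ ∀ x : Cyl, R ≤ ‖x.2‖ →
      δ ^ 2 * ‖x.2‖ ^ 2 ≤ ‖S.F k x‖ := by
  obtain ⟨K, hK, hb⟩ := exists_norm_F_sub_le hf ha hl k
  have hσ := hα.sqrt_pos 0
  set σ := √(S.α 0) with hσd
  -- For `m = ‖x.2‖ ≥ 1` the norm is at least `(σ/2)m² - 2Km`, and `m ≥ 8K/σ` makes this at least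
  -- `(σ/4)m²`.
  refine ⟨√(σ / 4), max 1 (8 * K / σ), by positivity, le_max_left _ _, fun x hx => ?_⟩
  have h1 : 1 ≤ ‖x.2‖ := (le_max_left _ _).trans hx
  have h2 : 8 * K / σ ≤ ‖x.2‖ := (le_max_right _ _).trans hx
  rw [div_le_iff₀ hσ] at h2
  rw [Real.sq_sqrt (by positivity)]
  have h3 := hb x
  have h4 := le_norm_coneMap_endCover (S := S) (a := a) x
  rw [← hσd] at h4
  have h5 := norm_le_norm_add_norm_sub' (coneMap (torus S.α a) (endCover x)) (S.F k x)
  rw [norm_sub_rev] at h5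
  nlinarith [mul_le_mul_of_nonneg_right h2 (norm_nonneg x.2)]

theorem tendsto_snd_cocompact : Filter.Tendsto (fun x : Cyl => ‖x.2‖) (Filter.cocompact Cyl)
    Filter.atTop :=
  tendsto_norm_cocompact_atTop.comp
    (isProperMap_iff_tendsto_cocompact.1 (isProperMap_snd_of_compactSpace (X := Circle))).2

theorem isProperMap_F (hf : IsFreq a l) (hα : IsAlpha S.α) (ha : ∀ j, freq S.α j = a j)
    (hl : lam S.α = l) (k : Params) : IsProperMap (S.F k) := by
  obtain ⟨δ, R, hδ, hR, hb⟩ := exists_le_norm_F hf hα ha hl k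
  refine isProperMap_iff_tendsto_cocompact.2 ⟨(contMDiff_F hf ha hl k).continuous, ?_⟩
  rw [← Metric.cobounded_eq_cocompact (α := C3), ← tendsto_norm_atTop_iff_cobounded]
  have h1 : Filter.Tendsto (fun x : Cyl => δ ^ 2 * ‖x.2‖ ^ 2) (Filter.cocompact Cyl)
      Filter.atTop :=
    ((Filter.tendsto_pow_atTop two_ne_zero).comp tendsto_snd_cocompact).const_mul_atTop
      (by positivity)
  refine Filter.tendsto_atTop_mono' _ ?_ h1
  filter_upwards [tendsto_snd_cocompact.eventually_ge_atTop R] with x hx using hb x hx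

theorem isBigO_F (hf : IsFreq a l) (hα : IsAlpha S.α) (ha : ∀ j, freq S.α j = a j)
    (hl : lam S.α = l) (k : Params) :
    (fun x => S.F k x - coneMap (torus S.α a) (endCover x))
      =O[Filter.cocompact Cyl] fun x => ‖S.F k x‖ ^ (1 / 2 : ℝ) := by
  obtain ⟨δ, R, hδ, hR, hb⟩ := exists_le_norm_F hf hα ha hl k
  obtain ⟨K, hK, hd⟩ := exists_norm_F_sub_le hf ha hl k
  refine Asymptotics.IsBigO.of_bound (2 * K / δ) ?_
  filter_upwards [tendsto_snd_cocompact.eventually_ge_atTop R] with x hx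
  have h1 := hb x hx
  have h2 : δ * ‖x.2‖ ≤ √‖S.F k x‖ := by
    refine Real.le_sqrt_of_sq_le ?_
    rw [mul_pow]
    exact h1
  rw [← Real.sqrt_eq_rpow, Real.norm_of_nonneg (Real.sqrt_nonneg _)]
  refine (hd x).trans ?_
  rw [div_mul_eq_mul_div, le_div_iff₀ hδ]
  have h3 : 1 ≤ ‖x.2‖ := hR.trans hx
  nlinarith [mul_pos hK hδ]

end Data

/-! ### Generic members are immersed: the exceptional set is closed -/

/-- A vanishing cross product makes `u` and `v` dependent over `ℂ`; the real Hermitian product makes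
the ratio real. -/
theorem C3.eq_zero_or_eq_smul {u v : C3} (h : conjCross u v = 0)
    (him : (inner ℂ u v : ℂ).im = 0) : u = 0 ∨ v = 0 ∨ ∃ σ : ℝ, σ ≠ 0 ∧ u + σ • v = 0 := by
  by_cases hu : u = 0
  · exact Or.inl hu
  by_cases hv : v = 0
  · exact Or.inr (Or.inl hv)
  refine Or.inr (Or.inr ?_)
  have e0 : u 1 * v 2 - u 2 * v 1 = 0 := by
    simpa only [conjCross_zero, PiLp.zero_apply, map_eq_zero] using congrArg (fun z : C3 => z 0) h
  have e1 : u 2 * v 0 - u 0 * v 2 = 0 := by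
    simpa only [conjCross_one, PiLp.zero_apply, map_eq_zero] using congrArg (fun z : C3 => z 1) h
  have e2 : u 0 * v 1 - u 1 * v 0 = 0 := by
    simpa only [conjCross_two, PiLp.zero_apply, map_eq_zero] using congrArg (fun z : C3 => z 2) h
  have hn : (inner ℂ u u : ℂ) = (‖u‖ ^ 2 : ℝ) := by
    rw [inner_self_eq_norm_sq_to_K]; norm_cast
  have hg : (inner ℂ u v : ℂ) = ((inner ℂ u v : ℂ).re : ℂ) := Complex.ext rfl (by simp [him])
  set g : ℝ := (inner ℂ u v : ℂ).re with hgd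
  have hpos : 0 < ‖u‖ ^ 2 := by positivity
  rw [C3.inner_eq] at hn hg
  have key : (‖u‖ ^ 2) • v = g • u := by
    apply C3.ext <;> simp only [PiLp.smul_apply, Complex.real_smul, ← hn, ← hg]
    · linear_combination conj (u 2) * e1 - conj (u 1) * e2
    · linear_combination conj (u 0) * e2 - conj (u 2) * e0
    · linear_combination conj (u 1) * e0 - conj (u 0) * e1
  have hg0 : g ≠ 0 := by
    intro h0
    rw [h0, zero_smul, smul_eq_zero] at key
    exact key.elim hpos.ne' hv
  refine ⟨-(g⁻¹ * ‖u‖ ^ 2), neg_ne_zero.2 (mul_ne_zero (inv_ne_zero hg0) hpos.ne'), ?_⟩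
  rw [neg_smul, mul_smul, key, smul_smul, inv_mul_cancel₀ hg0, one_smul, add_neg_cancel]

namespace Data

variable {S : Data} {a : Fin 3 → ℤ} {l : ℤ}

theorem conjCross_dPhi_add (hf : IsFreq a l) (ha : ∀ j, freq S.α j = a j) (hl : lam S.α = l)
    (k : Params) (y₁ y₂ t : ℝ) (n : ℤ) :
    conjCross (S.dPhi₁ k ((-1) ^ n * y₁, (-1) ^ n * y₂, t + 2 * Real.pi * n))
      (S.dPhi₂ k ((-1) ^ n * y₁, (-1) ^ n * y₂, t + 2 * Real.pi * n)) =
    conjCross (S.dPhi₁ k (y₁, y₂, t)) (S.dPhi₂ k (y₁, y₂, t)) := by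
  have h1 : S.dPhi₁ k ((-1) ^ n * y₁, (-1) ^ n * y₂, t + 2 * Real.pi * n) =
      ((-1 : ℝ) ^ n) • S.dPhi₁ k (y₁, y₂, t) := by
    apply C3.ext <;> simp [dPhi₁, w_add ha, p_add hf ha hl] <;> ring
  have h2 : S.dPhi₂ k ((-1) ^ n * y₁, (-1) ^ n * y₂, t + 2 * Real.pi * n) =
      ((-1 : ℝ) ^ n) • S.dPhi₂ k (y₁, y₂, t) := by
    apply C3.ext <;> simp [dPhi₂, w_add ha, p_add hf ha hl] <;> ring
  rw [h1, h2, conjCross_smul_left, conjCross_smul_right, smul_smul, ← mul_zpow]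
  norm_num

/-! ### Bounds, uniform in the parameters, on the points where the cross product vanishes -/

theorem exists_norm_amp_le (S : Data) : ∃ M, 0 ≤ M ∧ ∀ Z W j, ‖S.amp Z W j‖ ≤ M * (‖Z‖ + ‖W‖) := by
  refine ⟨∑ j, (|S.c j| + |S.d j| + |S.e j| + |S.f j|),
    Finset.sum_nonneg fun _ _ => by positivity, fun Z W j => ?_⟩
  have h1 : ‖S.amp Z W j‖ ≤ (|S.c j| + |S.d j| + |S.e j| + |S.f j|) * (‖Z‖ + ‖W‖) := by
    rw [amp]
    refine (norm_add_le _ _).trans ((add_le_add_left (norm_add₃_le) _).trans ?_)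
    simp only [norm_mul, RCLike.norm_conj, Complex.norm_real, Real.norm_eq_abs]
    nlinarith [norm_nonneg Z, norm_nonneg W, mul_nonneg (norm_nonneg Z) (abs_nonneg (S.e j)),
      mul_nonneg (norm_nonneg Z) (abs_nonneg (S.f j)),
      mul_nonneg (norm_nonneg W) (abs_nonneg (S.c j)),
      mul_nonneg (norm_nonneg W) (abs_nonneg (S.d j))]
  refine h1.trans (mul_le_mul_of_nonneg_right ?_ (by positivity))
  exact Finset.single_le_sum (f := fun j => |S.c j| + |S.d j| + |S.e j| + |S.f j|)
    (fun _ _ => by positivity) (Finset.mem_univ j)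

theorem norm_phase (j : Fin 3) : ‖phase j‖ = 1 := by
  fin_cases j <;> simp [phase]

theorem norm_w (j : Fin 3) (t : ℝ) : ‖S.w j t‖ = √(S.α j) := by
  rw [w, norm_mul, norm_mul, norm_phase, norm_expi, Complex.norm_real,
    Real.norm_of_nonneg (Real.sqrt_nonneg _)]
  ring

theorem norm_p_le {M : ℝ} (hM : ∀ Z W j, ‖S.amp Z W j‖ ≤ M * (‖Z‖ + ‖W‖)) (C D : ℂ) (j : Fin 3)
    (t : ℝ) : ‖S.p C D j t‖ ≤ M * (‖C‖ + ‖D‖) := by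
  rw [p_eq, norm_mul, norm_mul, norm_phase, norm_expi, one_mul, one_mul]
  refine (hM _ _ j).trans_eq ?_
  rw [rotC, rotD, norm_mul, norm_mul, norm_expi, norm_expi, mul_one, mul_one]

theorem norm_param_le (k : Params) (j : Fin 4) : ‖k.2 j‖ ≤ ‖k‖ :=
  (norm_le_pi_norm k.2 j).trans (norm_snd_le k)

/-- Up to conjugation, the first component of the cross product is `(y₁² + y₂²)w₁w₂` (indices from
0) plus terms of degree at most one in `y`, with coefficients bounded for bounded parameters and
`|w₁w₂|` constant. -/
theorem exists_bound_of_conjCross_eq_zero (hα : IsAlpha S.α) (K : ℝ) : ∃ R, ∀ k : Params,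
    ‖k‖ ≤ K → ∀ y₁ y₂ t : ℝ, conjCross (S.dPhi₁ k (y₁, y₂, t)) (S.dPhi₂ k (y₁, y₂, t)) = 0 →
      |y₁| ≤ R ∧ |y₂| ≤ R := by
  obtain ⟨M, hM0, hM⟩ := exists_norm_amp_le S
  have s1 := hα.sqrt_pos 1
  have s2 := hα.sqrt_pos 2
  set B := M * (K + K) with hB
  set W := √(S.α 1) + √(S.α 2) with hW
  set κ := √(S.α 1) * √(S.α 2) with hκ
  have hκ0 : 0 < κ := mul_pos s1 s2
  refine ⟨(4 * W * B + 4 * B ^ 2) / κ + 1, fun k hk y₁ y₂ t h => ?_⟩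
  have hK0 : 0 ≤ K := (norm_nonneg k).trans hk
  have hB0 : 0 ≤ B := by positivity
  have hp : ∀ j, ‖S.p (k.2 0) (k.2 1) j t‖ ≤ B := fun j =>
    (norm_p_le hM _ _ j t).trans (mul_le_mul_of_nonneg_left
      (add_le_add ((norm_param_le k 0).trans hk) ((norm_param_le k 1).trans hk)) hM0)
  have hq : ∀ j, ‖S.p (k.2 2) (k.2 3) j t‖ ≤ B := fun j =>
    (norm_p_le hM _ _ j t).trans (mul_le_mul_of_nonneg_left
      (add_le_add ((norm_param_le k 2).trans hk) ((norm_param_le k 3).trans hk)) hM0)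
  have h1 : S.dPhi₁ k (y₁, y₂, t) 1 * S.dPhi₂ k (y₁, y₂, t) 2 -
      S.dPhi₁ k (y₁, y₂, t) 2 * S.dPhi₂ k (y₁, y₂, t) 1 = 0 := by
    simpa only [conjCross_zero, PiLp.zero_apply, map_eq_zero] using congrArg (fun z : C3 => z 0) h
  have h2 : ((y₁ ^ 2 + y₂ ^ 2 : ℝ) : ℂ) * (S.w 1 t * S.w 2 t) =
      -(y₁ * (S.w 1 t * S.p (k.2 0) (k.2 1) 2 t + S.w 2 t * S.p (k.2 0) (k.2 1) 1 t) +
        y₂ * (S.w 1 t * S.p (k.2 2) (k.2 3) 2 t + S.w 2 t * S.p (k.2 2) (k.2 3) 1 t) +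
        (S.p (k.2 0) (k.2 1) 1 t * S.p (k.2 0) (k.2 1) 2 t +
          S.p (k.2 2) (k.2 3) 1 t * S.p (k.2 2) (k.2 3) 2 t)) := by
    simp [dPhi₁, dPhi₂] at h1
    push_cast
    linear_combination h1
  have hlin : ∀ x y : ℂ, ‖x‖ ≤ B → ‖y‖ ≤ B → ‖S.w 1 t * x + S.w 2 t * y‖ ≤ W * B := by
    intro x y hx hy
    refine (norm_add_le _ _).trans ?_
    rw [norm_mul, norm_mul, norm_w, norm_w, hW, add_mul]
    gcongr
  have hquad : ∀ x y z w : ℂ, ‖x‖ ≤ B → ‖y‖ ≤ B → ‖z‖ ≤ B → ‖w‖ ≤ B →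
      ‖x * y + z * w‖ ≤ 2 * B ^ 2 := by
    intro x y z w hx hy hz hw
    refine (norm_add_le _ _).trans ?_
    rw [norm_mul, norm_mul]
    nlinarith [mul_le_mul hx hy (norm_nonneg y) hB0, mul_le_mul hz hw (norm_nonneg w) hB0]
  have h3 : (y₁ ^ 2 + y₂ ^ 2) * κ ≤ |y₁| * (W * B) + |y₂| * (W * B) + 2 * B ^ 2 := by
    have := congrArg norm h2
    rw [norm_neg, norm_mul, norm_mul, norm_w, norm_w, Complex.norm_real,
      Real.norm_of_nonneg (by positivity)] at this
    rw [hκ, this]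
    refine norm_add₃_le.trans ?_
    rw [norm_mul, norm_mul, Complex.norm_real, Complex.norm_real, Real.norm_eq_abs,
      Real.norm_eq_abs]
    gcongr
    · exact hlin _ _ (hp 2) (hp 1)
    · exact hlin _ _ (hq 2) (hq 1)
    · exact hquad _ _ _ _ (hp 1) (hp 2) (hq 1) (hq 2)
  set m := |y₁| + |y₂| with hm
  have hm0 : 0 ≤ m := by positivity
  have hsq : m ^ 2 ≤ 2 * (y₁ ^ 2 + y₂ ^ 2) := by
    rw [← sq_abs y₁, ← sq_abs y₂, hm]
    nlinarith [sq_nonneg (|y₁| - |y₂|)]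
  have hWB : 0 ≤ W * B := by positivity
  have hmR : m ≤ (4 * W * B + 4 * B ^ 2) / κ + 1 := by
    by_contra! hlt
    have h4 : 1 ≤ m := by
      have : 0 ≤ (4 * W * B + 4 * B ^ 2) / κ := by positivity
      linarith
    have h5 : (4 * W * B + 4 * B ^ 2) / κ < m := by linarith
    rw [div_lt_iff₀ hκ0] at h5
    have h6 : m ^ 2 * κ ≤ 2 * m * (W * B) + 4 * B ^ 2 := by
      nlinarith [mul_le_mul_of_nonneg_right hsq hκ0.le]
    have h7 : B ^ 2 ≤ B ^ 2 * m := le_mul_of_one_le_right (sq_nonneg B) h4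
    have h8 := mul_lt_mul_of_pos_right h5 (by linarith : 0 < m)
    have h9 := mul_nonneg hWB hm0
    nlinarith
  exact ⟨by linarith [abs_nonneg y₂], by linarith [abs_nonneg y₁]⟩

theorem continuous_conjCross_dPhi : Continuous fun z : Params × ℝ × ℝ × ℝ =>
    conjCross (S.dPhi₁ z.1 z.2) (S.dPhi₂ z.1 z.2) := by
  have hw := fun j => (contDiff_w (S := S) j).continuous
  have hp : ∀ i i' j, Continuous fun z : Params × ℝ × ℝ × ℝ =>
      S.p (z.1.2 i) (z.1.2 i') j z.2.2.2 := by
    intro i i' j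
    unfold p
    have := Complex.continuous_conj
    fun_prop
  have hww : ∀ j, Continuous fun z : Params × ℝ × ℝ × ℝ => S.w j z.2.2.2 := fun j =>
    (hw j).comp (by fun_prop)
  have h1 : ∀ j, Continuous fun z : Params × ℝ × ℝ × ℝ => S.dPhi₁ z.1 z.2 j := by
    refine forall_fin3 ?_ ?_ ?_
    · exact Continuous.add (Continuous.mul (by fun_prop) (hww 0)) (hp 0 1 0)
    · exact Continuous.add (Continuous.mul (by fun_prop) (hww 1)) (hp 0 1 1)
    · exact Continuous.add (Continuous.mul (by fun_prop) (hww 2)) (hp 2 3 2)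
  have h2 : ∀ j, Continuous fun z : Params × ℝ × ℝ × ℝ => S.dPhi₂ z.1 z.2 j := by
    refine forall_fin3 ?_ ?_ ?_
    · exact Continuous.add (Continuous.mul (by fun_prop) (hww 0)) (hp 2 3 0)
    · exact Continuous.sub (Continuous.mul (by fun_prop) (hww 1)) (hp 2 3 1)
    · exact Continuous.add (Continuous.mul (by fun_prop) (hww 2)) (hp 0 1 2)
  refine (PiLp.continuous_toLp 2 _).comp (continuous_pi (forall_fin3 ?_ ?_ ?_))
  · exact Complex.continuous_conj.comp (((h1 1).mul (h2 2)).sub ((h1 2).mul (h2 1)))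
  · exact Complex.continuous_conj.comp (((h1 2).mul (h2 0)).sub ((h1 0).mul (h2 2)))
  · exact Complex.continuous_conj.comp (((h1 0).mul (h2 1)).sub ((h1 1).mul (h2 0)))

/-- For parameters near `k₀`, zeros are confined to a fixed box in `y`, and periodicity brings `t`
into `[0, 2π]`; nonvanishing on this compact set is an open condition. -/
theorem isOpen_conjCross_ne_zero (hf : IsFreq a l) (hα : IsAlpha S.α)
    (ha : ∀ j, freq S.α j = a j) (hl : lam S.α = l) :
    IsOpen {k : Params | ∀ x, conjCross (S.dPhi₁ k x) (S.dPhi₂ k x) ≠ 0} := by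
  rw [isOpen_iff_eventually]
  intro k₀ hk₀
  obtain ⟨R, hR⟩ := exists_bound_of_conjCross_eq_zero hα (‖k₀‖ + 1)
  have hcompact : IsCompact (Set.Icc (-R) R ×ˢ Set.Icc (-R) R ×ˢ Set.Icc 0 (2 * Real.pi)) :=
    isCompact_Icc.prod (isCompact_Icc.prod isCompact_Icc)
  have h1 := hcompact.eventually_forall_of_forall_eventually (x₀ := k₀)
    (P := fun k x => conjCross (S.dPhi₁ k x) (S.dPhi₂ k x) ≠ 0) fun x _ =>
    (continuous_conjCross_dPhi.continuousAt (x := (k₀, x))).eventually_ne (hk₀ x)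
  have h2 : ∀ᶠ k : Params in 𝓝 k₀, ‖k‖ < ‖k₀‖ + 1 :=
    continuous_norm.continuousAt.eventually_lt_const (by linarith)
  filter_upwards [h1, h2] with k hk hk'
  rintro ⟨y₁, y₂, t⟩ h0
  obtain ⟨n, hn, -⟩ := existsUnique_add_zsmul_mem_Ico Real.two_pi_pos t 0
  have ht : t + 2 * Real.pi * n ∈ Set.Icc 0 (2 * Real.pi) := by
    rw [zsmul_eq_mul, mul_comm (n : ℝ), zero_add] at hn
    exact Set.Ico_subset_Icc_self hn
  rw [← conjCross_dPhi_add hf ha hl k y₁ y₂ t n] at h0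
  obtain ⟨b1, b2⟩ := hR k hk'.le _ _ _ h0
  exact hk _ ⟨abs_le.1 b1, abs_le.1 b2, ht⟩ h0

end Data

/-! ### The dimension of the exceptional set -/

@[fun_prop] theorem ContDiff.ofRealComp {E : Type*} [NormedAddCommGroup E] [NormedSpace ℝ E]
    {n : ℕ∞ω} {f : E → ℝ} (hf : ContDiff ℝ n f) : ContDiff ℝ n fun x => (f x : ℂ) :=
  Complex.ofRealCLM.contDiff.comp hf

@[fun_prop] theorem ContDiff.conjComp {E : Type*} [NormedAddCommGroup E] [NormedSpace ℝ E]
    {n : ℕ∞ω} {f : E → ℂ} (hf : ContDiff ℝ n f) : ContDiff ℝ n fun x => conj (f x) :=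
  Complex.conjCLE.contDiff.comp hf

namespace Data

variable {S : Data} {a : Fin 3 → ℤ} {l : ℤ}

theorem amp_add (Z W Z' W' : ℂ) (j : Fin 3) :
    S.amp (Z + Z') (W + W') j = S.amp Z W j + S.amp Z' W' j := by
  simp only [amp, map_add]; ring

theorem amp_smul (r : ℝ) (Z W : ℂ) (j : Fin 3) :
    S.amp (r * Z) (r * W) j = r * S.amp Z W j := by
  simp only [amp, map_mul, Complex.conj_ofReal]; ring

theorem exists_amp_inverse {i : Fin 3}
    (hsub : (S.c 0 - S.d 0) * (S.e i - S.f i) - (S.c i - S.d i) * (S.e 0 - S.f 0) ≠ 0)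
    (hadd : (S.c 0 + S.d 0) * (S.e i + S.f i) - (S.c i + S.d i) * (S.e 0 + S.f 0) ≠ 0) :
    ∃ g : ℂ × ℂ →L[ℝ] ℂ × ℂ, ∀ Z W, g (S.amp Z W 0, S.amp Z W i) = (Z, W) := by
  let L : ℂ × ℂ →ₗ[ℝ] ℂ × ℂ :=
    { toFun := fun z => (S.amp z.1 z.2 0, S.amp z.1 z.2 i)
      map_add' := fun x y => Prod.ext (amp_add _ _ _ _ _) (amp_add _ _ _ _ _)
      map_smul' := fun r x => by
        refine Prod.ext ?_ ?_ <;> simp [amp_smul] }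
  obtain ⟨g, hg⟩ := L.exists_leftInverse_of_injective (LinearMap.ker_eq_bot'.2 fun z hz =>
    have h := eq_zero_of_amp hsub hadd (congrArg Prod.fst hz) (congrArg Prod.snd hz)
    Prod.ext h.1 h.2)
  exact ⟨g.toContinuousLinearMap, fun Z W => LinearMap.congr_fun hg (Z, W)⟩

theorem eq_rotC_mul (C : ℂ) (t : ℝ) : C = S.rotC C t * expi (-(lam S.α / 2)) t := by
  rw [rotC, mul_assoc, ← expi_add, add_neg_cancel, expi_zero_left, mul_one]

theorem eq_rotD_mul (D : ℂ) (t : ℝ) : D = S.rotD D t * expi (-(3 * lam S.α / 2)) t := by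
  rw [rotD, mul_assoc, ← expi_add, add_neg_cancel, expi_zero_left, mul_one]

theorem phase_ne_zero (j : Fin 3) : phase j ≠ 0 := by
  fin_cases j <;> simp [phase]

/-- Cancellation of the common phase from a linear relation between the functions `w_j`, `p_j`
and `q_j`. -/
theorem amp_eq_of_linear {j : Fin 3} {t x r s : ℝ} {C D C' D' : ℂ}
    (h : x * S.w j t + r * S.p C D j t + s * S.p C' D' j t = 0) :
    r * S.amp (S.rotC C t) (S.rotD D t) j + s * S.amp (S.rotC C' t) (S.rotD D' t) j =
      ((-(x * √(S.α j)) : ℝ) : ℂ) := by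
  rw [p_eq, p_eq, w] at h
  refine mul_left_cancel₀ (mul_ne_zero (phase_ne_zero j) (expi_ne_zero (freq S.α j) t)) ?_
  push_cast
  linear_combination h

section Exceptional

variable (S) (g₁ g₂ : ℂ × ℂ →L[ℝ] ℂ × ℂ)

/-- The values of `(C, D)` for which `∂Φ/∂y₁` has vanishing first and second components. -/
noncomputable def excPair (y t : ℝ) : ℂ × ℂ :=
  let x := g₁ ((-(y * √(S.α 0)) : ℝ), (-(y * √(S.α 1)) : ℝ))
  (x.1 * expi (-(lam S.α / 2)) t, x.2 * expi (-(3 * lam S.α / 2)) t)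

/-- Parametrization of the parameters for which `∂Φ/∂y₁` has a zero. -/
noncomputable def excFst (x : (Fin 3 → ℂ) × (ℂ × ℂ) × ℝ × ℝ) : Params :=
  (x.1, ![(S.excPair g₁ x.2.2.1 x.2.2.2).1, (S.excPair g₁ x.2.2.1 x.2.2.2).2, x.2.1.1, x.2.1.2])

/-- Parametrization of the parameters for which `∂Φ/∂y₂` has a zero. -/
noncomputable def excSnd (x : (Fin 3 → ℂ) × (ℂ × ℂ) × ℝ × ℝ) : Params :=
  (x.1, ![x.2.1.1, x.2.1.2, (S.excPair g₁ x.2.2.1 x.2.2.2).1, (S.excPair g₁ x.2.2.1 x.2.2.2).2])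

/-- The difference `(C - σ C', D - σ D')`, up to rotation, at the parameters for which
`∂Φ/∂y₁ + σ ∂Φ/∂y₂` has a zero. -/
noncomputable def excSub (m : ℂ) (σ y₁ y₂ : ℝ) : ℂ × ℂ :=
  g₁ (m, (-((y₁ - σ * y₂) * √(S.α 1)) : ℝ))

/-- The sum `(C + σ C', D + σ D')`, up to rotation, at the parameters for which
`∂Φ/∂y₁ + σ ∂Φ/∂y₂` has a zero. -/
noncomputable def excAdd (m : ℂ) (σ y₁ y₂ : ℝ) : ℂ × ℂ :=
  g₂ ((-((y₁ + σ * y₂) * √(S.α 0)) : ℝ),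
    ((σ ^ 2 + 1)⁻¹ : ℝ) * (((2 * σ * -((y₂ + σ * y₁) * √(S.α 2)) : ℝ) : ℂ) -
      ((σ ^ 2 - 1 : ℝ) : ℂ) * S.amp (S.excSub g₁ m σ y₁ y₂).1 (S.excSub g₁ m σ y₁ y₂).2 2))

/-- Parametrization of the parameters for which `∂Φ/∂y₁ + σ ∂Φ/∂y₂` has a zero, with
`σ = ε e^ρ`. -/
noncomputable def excMix (ε : ℝ) (x : (Fin 3 → ℂ) × ℂ × ℝ × ℝ × ℝ × ℝ) : Params :=
  let σ := ε * Real.exp x.2.2.1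
  let τ := ε * Real.exp (-x.2.2.1)
  let X := S.excAdd g₁ g₂ x.2.1 σ x.2.2.2.1 x.2.2.2.2.1
  let Y := S.excSub g₁ x.2.1 σ x.2.2.2.1 x.2.2.2.2.1
  let t := x.2.2.2.2.2
  (x.1, ![(X.1 + Y.1) / 2 * expi (-(lam S.α / 2)) t,
    (X.2 + Y.2) / 2 * expi (-(3 * lam S.α / 2)) t,
    τ * (X.1 - Y.1) / 2 * expi (-(lam S.α / 2)) t,
    τ * (X.2 - Y.2) / 2 * expi (-(3 * lam S.α / 2)) t])

variable {S}

theorem contDiff_params {E : Type*} [NormedAddCommGroup E] [NormedSpace ℝ E] {f : E → Fin 3 → ℂ}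
    {g₀ g₁ g₂ g₃ : E → ℂ} (hf : ContDiff ℝ 1 f) (h₀ : ContDiff ℝ 1 g₀) (h₁ : ContDiff ℝ 1 g₁)
    (h₂ : ContDiff ℝ 1 g₂) (h₃ : ContDiff ℝ 1 g₃) :
    ContDiff ℝ 1 fun x => ((f x, ![g₀ x, g₁ x, g₂ x, g₃ x]) : Params) := by
  refine hf.prodMk (contDiff_pi.2 fun j => ?_)
  fin_cases j
  exacts [h₀, h₁, h₂, h₃]

theorem contDiff_excPair : ContDiff ℝ 1 fun x : ℝ × ℝ => S.excPair g₁ x.1 x.2 := by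
  have hg := g₁.contDiff (n := 1)
  unfold excPair
  fun_prop

theorem contDiff_excFst : ContDiff ℝ 1 (S.excFst g₁) := by
  have h := (contDiff_excPair (S := S) g₁).comp (f := fun x : (Fin 3 → ℂ) × (ℂ × ℂ) × ℝ × ℝ =>
    x.2.2) (by fun_prop)
  exact contDiff_params (by fun_prop) h.fst h.snd (by fun_prop) (by fun_prop)

theorem contDiff_excSnd : ContDiff ℝ 1 (S.excSnd g₁) := by
  have h := (contDiff_excPair (S := S) g₁).comp (f := fun x : (Fin 3 → ℂ) × (ℂ × ℂ) × ℝ × ℝ =>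
    x.2.2) (by fun_prop)
  exact contDiff_params (by fun_prop) (by fun_prop) (by fun_prop) h.fst h.snd

theorem contDiff_excMix (ε : ℝ) : ContDiff ℝ 1 (S.excMix g₁ g₂ ε) := by
  have hg₁ := g₁.contDiff (n := 1)
  have hg₂ := g₂.contDiff (n := 1)
  have hY : ContDiff ℝ 1 fun x : (Fin 3 → ℂ) × ℂ × ℝ × ℝ × ℝ × ℝ =>
      S.excSub g₁ x.2.1 (ε * Real.exp x.2.2.1) x.2.2.2.1 x.2.2.2.2.1 := by
    unfold excSub
    fun_prop
  have hinv : ContDiff ℝ 1 fun x : (Fin 3 → ℂ) × ℂ × ℝ × ℝ × ℝ × ℝ =>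
      ((ε * Real.exp x.2.2.1) ^ 2 + 1)⁻¹ :=
    ContDiff.inv (by fun_prop) fun x => by positivity
  have hX : ContDiff ℝ 1 fun x : (Fin 3 → ℂ) × ℂ × ℝ × ℝ × ℝ × ℝ =>
      S.excAdd g₁ g₂ x.2.1 (ε * Real.exp x.2.2.1) x.2.2.2.1 x.2.2.2.2.1 := by
    unfold excAdd amp
    fun_prop
  unfold excMix
  refine contDiff_params ?_ ?_ ?_ ?_ ?_ <;> fun_prop

theorem dimH_range_excFst_le : dimH (Set.range (S.excFst g₁)) ≤ 12 :=
  (contDiff_excFst g₁).dimH_range_le.trans_eq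
    (by simp [Complex.finrank_real_complex, Module.finrank_pi_fintype])

theorem dimH_range_excSnd_le : dimH (Set.range (S.excSnd g₁)) ≤ 12 :=
  (contDiff_excSnd g₁).dimH_range_le.trans_eq
    (by simp [Complex.finrank_real_complex, Module.finrank_pi_fintype])

/-- The real dimensions are 6 for the constants `E`, 2 for the free component `m`, and 4 for `ρ, y₁,
y₂, t`. -/
theorem dimH_range_excMix_le (ε : ℝ) : dimH (Set.range (S.excMix g₁ g₂ ε)) ≤ 12 :=
  (contDiff_excMix g₁ g₂ ε).dimH_range_le.trans_eq
    (by simp [Complex.finrank_real_complex, Module.finrank_pi_fintype])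

variable {g₁ g₂}

theorem eq_excPair (hg₁ : ∀ Z W, g₁ (S.amp Z W 0, S.amp Z W 1) = (Z, W)) {C D : ℂ} {y t : ℝ}
    (h0 : y * S.w 0 t + S.p C D 0 t = 0) (h1 : y * S.w 1 t + S.p C D 1 t = 0) :
    S.excPair g₁ y t = (C, D) := by
  have e : ∀ j, y * S.w j t + S.p C D j t = 0 →
      ((-(y * √(S.α j)) : ℝ) : ℂ) = S.amp (S.rotC C t) (S.rotD D t) j := fun j h => by
    rw [← amp_eq_of_linear (x := y) (r := 1) (s := 0) (C := C) (D := D) (C' := 0) (D' := 0)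
      (by push_cast; linear_combination h)]
    push_cast
    ring
  rw [excPair, e 0 h0, e 1 h1, hg₁]
  simp only
  rw [← eq_rotC_mul, ← eq_rotD_mul]

theorem params_ext {k k' : Params} (h : k.1 = k'.1) (h0 : k.2 0 = k'.2 0) (h1 : k.2 1 = k'.2 1)
    (h2 : k.2 2 = k'.2 2) (h3 : k.2 3 = k'.2 3) : k = k' := by
  refine Prod.ext h (funext fun j => ?_)
  fin_cases j <;> assumption

/-- Two components of `∂Φ/∂y₁ = 0` already determine `(C, D)` from `y₁` and `t`. What stays free is
`E`, `C'`, `D'`, `y₁`, `t`, of real dimension `6 + 4 + 2`; the third component is not needed for an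
upper bound. -/
theorem mem_range_excFst (hg₁ : ∀ Z W, g₁ (S.amp Z W 0, S.amp Z W 1) = (Z, W)) {k : Params}
    {x : ℝ × ℝ × ℝ} (h : S.dPhi₁ k x = 0) : k ∈ Set.range (S.excFst g₁) := by
  have e := eq_excPair hg₁ (congrArg (fun z : C3 => z 0) h) (congrArg (fun z : C3 => z 1) h)
  refine ⟨(k.1, (k.2 2, k.2 3), x.1, x.2.2), params_ext rfl ?_ ?_ rfl rfl⟩
  · exact congrArg Prod.fst e
  · exact congrArg Prod.snd e

theorem mem_range_excSnd (hg₁ : ∀ Z W, g₁ (S.amp Z W 0, S.amp Z W 1) = (Z, W)) {k : Params}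
    {x : ℝ × ℝ × ℝ} (h : S.dPhi₂ k x = 0) : k ∈ Set.range (S.excSnd g₁) := by
  have h1 : -x.2.1 * S.w 1 x.2.2 - S.p (k.2 2) (k.2 3) 1 x.2.2 = 0 :=
    congrArg (fun z : C3 => z 1) h
  have e := eq_excPair hg₁ (y := x.2.1) (congrArg (fun z : C3 => z 0) h)
    (by linear_combination -h1)
  refine ⟨(k.1, (k.2 0, k.2 1), x.2.1, x.2.2), params_ext rfl rfl rfl ?_ ?_⟩
  · exact congrArg Prod.fst e
  · exact congrArg Prod.snd e

/-- The combinations `Y = (Z - σZ', W - σW')` and `X = (Z + σZ', W + σW')` diagonalize the first two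
component equations. The second equation and the free value `m` of component 0 determine `Y`; then
the first and third determine `X`. Together they give back all four constants. -/
theorem mem_range_excMix (hg₁ : ∀ Z W, g₁ (S.amp Z W 0, S.amp Z W 1) = (Z, W))
    (hg₂ : ∀ Z W, g₂ (S.amp Z W 0, S.amp Z W 2) = (Z, W)) {k : Params}
    {x : ℝ × ℝ × ℝ} {σ : ℝ} (hσ : σ ≠ 0) (h : S.dPhi₁ k x + σ • S.dPhi₂ k x = 0) :
    k ∈ Set.range (S.excMix g₁ g₂ 1) ∪ Set.range (S.excMix g₁ g₂ (-1)) := by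
  obtain ⟨y₁, y₂, t⟩ := x
  have h0 : y₁ * S.w 0 t + S.p (k.2 0) (k.2 1) 0 t +
      σ * (y₂ * S.w 0 t + S.p (k.2 2) (k.2 3) 0 t) = 0 := congrArg (fun z : C3 => z 0) h
  have h1 : y₁ * S.w 1 t + S.p (k.2 0) (k.2 1) 1 t +
      σ * (-y₂ * S.w 1 t - S.p (k.2 2) (k.2 3) 1 t) = 0 := congrArg (fun z : C3 => z 1) h
  have h2 : y₂ * S.w 2 t + S.p (k.2 2) (k.2 3) 2 t +
      σ * (y₁ * S.w 2 t + S.p (k.2 0) (k.2 1) 2 t) = 0 := congrArg (fun z : C3 => z 2) h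
  replace h0 := amp_eq_of_linear (x := y₁ + σ * y₂) (r := 1) (s := σ) (C := k.2 0) (D := k.2 1)
    (C' := k.2 2) (D' := k.2 3) (by push_cast; linear_combination h0)
  replace h1 := amp_eq_of_linear (x := y₁ - σ * y₂) (r := 1) (s := -σ) (C := k.2 0) (D := k.2 1)
    (C' := k.2 2) (D' := k.2 3) (by push_cast; linear_combination h1)
  replace h2 := amp_eq_of_linear (x := y₂ + σ * y₁) (r := σ) (s := 1) (C := k.2 0) (D := k.2 1)
    (C' := k.2 2) (D' := k.2 3) (by push_cast; linear_combination h2)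
  set Z := S.rotC (k.2 0) t with hZ
  set W := S.rotD (k.2 1) t with hW
  set Z' := S.rotC (k.2 2) t with hZ'
  set W' := S.rotD (k.2 3) t with hW'
  set m : ℂ := S.amp (Z + (-σ : ℝ) * Z') (W + (-σ : ℝ) * W') 0 with hm
  have hY : S.excSub g₁ m σ y₁ y₂ = (Z + (-σ : ℝ) * Z', W + (-σ : ℝ) * W') := by
    rw [excSub, ← h1, hm, ← hg₁ (Z + (-σ : ℝ) * Z') (W + (-σ : ℝ) * W'), amp_add, amp_add, amp_smul,
      amp_smul]
    push_cast
    rw [one_mul]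
  have hX : S.excAdd g₁ g₂ m σ y₁ y₂ = (Z + σ * Z', W + σ * W') := by
    rw [excAdd, hY, ← h0, ← hg₂ (Z + σ * Z') (W + σ * W')]
    congr 2
    · rw [amp_add, amp_smul]; push_cast; ring
    -- Twice `σ` times the left side of the third equation equals `(σ² + 1)` times component 2 of
    -- the amplitude of `X` plus `(σ² - 1)` times that of `Y`.
    · rw [amp_add, amp_add, amp_smul, amp_smul]
      have hne : ((σ : ℂ) ^ 2 + 1) ≠ 0 := by exact_mod_cast (by positivity : σ ^ 2 + 1 ≠ 0)
      push_cast at h2 ⊢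
      rw [inv_mul_eq_iff_eq_mul₀ hne]
      linear_combination -2 * σ * h2
  -- Writing `σ = ε e^ρ` with a sign `ε` keeps the parameter space a whole vector space and makes
  -- `1/σ = ε e^{-ρ}` smooth on it.
  have key : ∀ ε : ℝ, ε * ε = 1 → σ = ε * Real.exp (Real.log |σ|) →
      S.excMix g₁ g₂ ε (k.1, m, Real.log |σ|, y₁, y₂, t) = k := by
    intro ε hε hσε
    have hτ : ε * Real.exp (-Real.log |σ|) * σ = 1 := by
      have hne := Real.exp_ne_zero (Real.log |σ|)
      calc ε * Real.exp (-Real.log |σ|) * σ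
          = ε * (Real.exp (Real.log |σ|))⁻¹ * (ε * Real.exp (Real.log |σ|)) := by
            rw [← hσε, Real.exp_neg]
        _ = 1 := by
            field_simp
            linear_combination hε
    have hτ' : ((ε * Real.exp (-Real.log |σ|) : ℝ) : ℂ) * σ = 1 := by exact_mod_cast hτ
    refine params_ext rfl ?_ ?_ ?_ ?_ <;>
      simp only [excMix, ← hσε, hX, hY, Matrix.cons_val_zero, Matrix.cons_val_one,
        Matrix.cons_val]
    · conv_rhs => rw [eq_rotC_mul (S := S) (k.2 0) t, ← hZ]
      push_cast
      ring
    · conv_rhs => rw [eq_rotD_mul (S := S) (k.2 1) t, ← hW]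
      push_cast
      ring
    · conv_rhs => rw [eq_rotC_mul (S := S) (k.2 2) t, ← hZ']
      push_cast at hτ' ⊢
      linear_combination Z' * expi (-(lam S.α / 2)) t * hτ'
    · conv_rhs => rw [eq_rotD_mul (S := S) (k.2 3) t, ← hW']
      push_cast at hτ' ⊢
      linear_combination W' * expi (-(3 * lam S.α / 2)) t * hτ'
  rcases lt_or_gt_of_ne hσ with hneg | hpos
  · exact Or.inr ⟨_, key (-1) (by norm_num)
      (by rw [Real.exp_log (abs_pos.2 hσ), abs_of_neg hneg]; ring)⟩
  · exact Or.inl ⟨_, key 1 (by norm_num)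
      (by rw [Real.exp_log (abs_pos.2 hσ), abs_of_pos hpos]; ring)⟩

end Exceptional

theorem dimH_exceptional_le (hf : IsFreq a l) (hS : S.IsValid) (ha : ∀ j, freq S.α j = a j) :
    dimH {k ∈ S.admissible | ¬ ∀ x, conjCross (S.dPhi₁ k x) (S.dPhi₂ k x) ≠ 0} ≤ 12 := by
  have hn := hS.isNondegenerate hf ha
  obtain ⟨g₁, hg₁⟩ := exists_amp_inverse hn.sub1 hn.add1
  obtain ⟨g₂, hg₂⟩ := exists_amp_inverse hn.sub2 hn.add2
  have hsub : {k ∈ S.admissible | ¬ ∀ x, conjCross (S.dPhi₁ k x) (S.dPhi₂ k x) ≠ 0} ⊆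
      (Set.range (S.excFst g₁) ∪ Set.range (S.excSnd g₁)) ∪
        (Set.range (S.excMix g₁ g₂ 1) ∪ Set.range (S.excMix g₁ g₂ (-1))) := by
    rintro k ⟨hk, hbad⟩
    push Not at hbad
    obtain ⟨x, hx⟩ := hbad
    rcases C3.eq_zero_or_eq_smul hx ((isSLEvolution_Phi hS hk).isotropic x) with h | h | ⟨σ, hσ, h⟩
    · exact Or.inl (Or.inl (mem_range_excFst hg₁ h))
    · exact Or.inl (Or.inr (mem_range_excSnd hg₁ h))
    · exact Or.inr (mem_range_excMix hg₁ hg₂ hσ h)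
  refine (dimH_mono hsub).trans ?_
  simp only [dimH_union, sup_le_iff]
  exact ⟨⟨dimH_range_excFst_le g₁, dimH_range_excSnd_le g₁⟩,
    dimH_range_excMix_le g₁ g₂ 1, dimH_range_excMix_le g₁ g₂ (-1)⟩

end Data

namespace Data

variable {S : Data} {a : Fin 3 → ℤ} {l : ℤ}

/-! ### The dimension of the set of admissible parameters -/

theorem exists_mem_admissible_of_curve {k : Params} (hk : k ∈ S.admissible) {U : Set Params}
    (hU : IsOpen U) (hkU : k ∈ U) {C C' : ℝ → ℂ} (hC : Continuous C) (hC' : Continuous C')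
    (h0 : C 0 = k.2 0) (h0' : C' 0 = k.2 2)
    (him : ∀ ε, (C ε * conj (C' ε)).im = (k.2 0 * conj (k.2 2)).im)
    (hre : ∀ᶠ ε in 𝓝[≠] 0, (C ε).re ≠ 0) : ∃ k' ∈ S.admissible ∩ U, (k'.2 0).re ≠ 0 := by
  let γ : ℝ → Params := fun ε => (k.1, ![C ε, k.2 1, C' ε, k.2 3])
  have hγ : Continuous γ := by
    refine continuous_const.prodMk (continuous_pi fun j => ?_)
    fin_cases j
    exacts [hC, continuous_const, hC', continuous_const]
  have hγ0 : γ 0 = k := params_ext rfl h0 rfl h0' rfl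
  have hev : ∀ᶠ ε in 𝓝[≠] (0 : ℝ), γ ε ∈ U :=
    (hγ.continuousAt.eventually (hU.mem_nhds (hγ0 ▸ hkU))).filter_mono nhdsWithin_le_nhds
  obtain ⟨ε, h1, h2⟩ := (hev.and hre).exists
  refine ⟨γ ε, ⟨?_, h1⟩, h2⟩
  have : _ = (0 : ℝ) := hk
  rw [← him ε] at this
  exact this

/-- The chart needs `Re C ≠ 0`. An admissible point is moved there by changing only `C` and `C'`,
along a curve that keeps `Im(C conj C')` and hence admissibility. -/
theorem exists_mem_admissible_re_ne_zero {U : Set Params} (hU : IsOpen U)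
    (hne : (S.admissible ∩ U).Nonempty) : ∃ k ∈ S.admissible ∩ U, (k.2 0).re ≠ 0 := by
  obtain ⟨k, hk, hkU⟩ := hne
  by_cases h0 : (k.2 0).re = 0
  swap
  · exact ⟨k, ⟨hk, hkU⟩, h0⟩
  by_cases h2 : (k.2 2).re = 0
  · refine exists_mem_admissible_of_curve hk hU hkU
      -- Both constants are purely imaginary here. Real multiples of the common factor `i + ε` keep
      -- `Im(C conj C') = 0`, and the extra `+ ε` covers the case `C = 0`.
      (C := fun ε => ((k.2 0).im + ε) * (Complex.I + ε))
      (C' := fun ε => (k.2 2).im * (Complex.I + ε))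
      (by fun_prop) (by fun_prop) ?_ ?_ ?_ ?_
    · apply Complex.ext <;> simp [h0]
    · apply Complex.ext <;> simp [h2]
    · intro ε
      simp [h0, h2]
      ring
    · have hne : ∀ᶠ ε : ℝ in 𝓝[≠] 0, (k.2 0).im + ε ≠ 0 := by
        by_cases hx : (k.2 0).im = 0
        · filter_upwards [self_mem_nhdsWithin] with ε hε
          rwa [hx, zero_add]
        · refine Filter.Eventually.filter_mono nhdsWithin_le_nhds ?_
          exact (by fun_prop : Continuous fun ε : ℝ => (k.2 0).im + ε).continuousAt.eventually_ne
            (by simpa using hx)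
      filter_upwards [hne, self_mem_nhdsWithin] with ε h1 h3
      simp only [Complex.mul_re, Complex.add_re, Complex.add_im, Complex.ofReal_re,
        Complex.ofReal_im, Complex.I_re, Complex.I_im]
      simpa using ⟨h1, h3⟩
  · refine exists_mem_admissible_of_curve hk hU hkU
      -- Adding a real multiple of `C'` to `C` changes `C conj C'` by a real number.
      (C := fun ε => k.2 0 + ε * k.2 2) (C' := fun _ => k.2 2)
      (by fun_prop) (by fun_prop) (by simp) rfl ?_ ?_
    · intro ε
      simp
      ring
    · filter_upwards [self_mem_nhdsWithin] with ε hε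
      simpa [h0, h2] using hε

/-- Coordinates on the part of the admissible set where `Re C ≠ 0`. -/
def chart (k : Params) : (Fin 3 → ℂ) × ℂ × ℂ × ℂ × ℝ :=
  (k.1, k.2 0, k.2 1, k.2 3, (k.2 2).re)

/-- The inverse of `chart`, which solves the equation of the admissible set for `Im C'`; `b` is
the quotient of the two coefficients of this equation. -/
noncomputable def unchart (b : ℝ) (x : (Fin 3 → ℂ) × ℂ × ℂ × ℂ × ℝ) : Params :=
  (x.1, ![x.2.1, x.2.2.1,
    x.2.2.2.2 + ((x.2.1.im * x.2.2.2.2 + b * (x.2.2.1 * conj x.2.2.2.1).im) / x.2.1.re : ℝ) *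
      Complex.I, x.2.2.2.1])

theorem chart_unchart (b : ℝ) (x : (Fin 3 → ℂ) × ℂ × ℂ × ℂ × ℝ) : chart (unchart b x) = x := by
  obtain ⟨E, C, D, D', s⟩ := x
  simp [chart, unchart, -Complex.ofReal_div]

theorem contDiff_chart : ContDiff ℝ 1 chart := by
  have hre : ContDiff ℝ 1 fun k : Params => (k.2 2).re :=
    Complex.reCLM.contDiff.comp (by fun_prop)
  unfold chart
  fun_prop

/-- Near a point with `Re C ≠ 0`, the coefficient `A ≠ 0` allows solving for `Im C'`, so `chart`
carries the set onto a neighbourhood in a space of dimension 13. As a `C¹` map does not raise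
Hausdorff dimension, the bound follows. -/
theorem thirteen_le_dimH_admissible (hA : S.c 0 ^ 2 - S.c 1 ^ 2 - S.c 2 ^ 2 - S.d 0 ^ 2 +
    S.d 1 ^ 2 + S.d 2 ^ 2 ≠ 0) {U : Set Params} (hU : IsOpen U)
    (hne : (S.admissible ∩ U).Nonempty) : 13 ≤ dimH (S.admissible ∩ U) := by
  obtain ⟨k, ⟨hk, hkU⟩, hre⟩ := exists_mem_admissible_re_ne_zero hU hne
  set A := S.c 0 ^ 2 - S.c 1 ^ 2 - S.c 2 ^ 2 - S.d 0 ^ 2 + S.d 1 ^ 2 + S.d 2 ^ 2 with hAd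
  set B := S.e 0 ^ 2 - S.e 1 ^ 2 - S.e 2 ^ 2 - S.f 0 ^ 2 + S.f 1 ^ 2 + S.f 2 ^ 2 with hBd
  have hadm : ∀ k : Params, k ∈ S.admissible ↔
      (k.2 0 * conj (k.2 2)).im * A + (k.2 1 * conj (k.2 3)).im * B = 0 := fun _ => Iff.rfl
  have hmem : ∀ x, x.2.1.re ≠ 0 → unchart (B / A) x ∈ S.admissible := by
    rintro ⟨E, C, D, D', s⟩ hx
    have hx' : C.re ≠ 0 := hx
    rw [hadm]
    simp [unchart, -Complex.ofReal_div]
    field_simp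
    ring
  have hkk : unchart (B / A) (chart k) = k := by
    refine params_ext rfl rfl rfl ?_ rfl
    have h1 := (hadm k).1 hk
    simp only [unchart, chart, Matrix.cons_val]
    apply Complex.ext
    · simp [-Complex.ofReal_div]
    · simp only [Complex.mul_im, Complex.conj_re, Complex.conj_im] at h1 ⊢
      simp [-Complex.ofReal_div]
      field_simp
      linear_combination h1
  have hcont : ContinuousAt (unchart (B / A)) (chart k) := by
    have hq : ContinuousAt (fun x : (Fin 3 → ℂ) × ℂ × ℂ × ℂ × ℝ =>
        (x.2.1.im * x.2.2.2.2 + B / A * (x.2.2.1 * conj x.2.2.2.1).im) / x.2.1.re) (chart k) := by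
      refine ContinuousAt.div ?_ ?_ hre
      · have := Complex.continuous_conj
        have := Complex.continuous_im
        fun_prop
      · have := Complex.continuous_re
        fun_prop
    refine ContinuousAt.prodMk (by fun_prop) (continuousAt_pi.2 fun j => ?_)
    fin_cases j
    · change ContinuousAt (fun x : (Fin 3 → ℂ) × ℂ × ℂ × ℂ × ℝ => x.2.1) _
      fun_prop
    · change ContinuousAt (fun x : (Fin 3 → ℂ) × ℂ × ℂ × ℂ × ℝ => x.2.2.1) _
      fun_prop
    · refine ContinuousAt.add (by fun_prop) (ContinuousAt.mul ?_ continuousAt_const)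
      exact Complex.continuous_ofReal.continuousAt.comp hq
    · change ContinuousAt (fun x : (Fin 3 → ℂ) × ℂ × ℂ × ℂ × ℝ => x.2.2.2.1) _
      fun_prop
  have hnhds : chart '' (S.admissible ∩ U) ∈ 𝓝 (chart k) := by
    have h1 : ∀ᶠ x in 𝓝 (chart k), unchart (B / A) x ∈ U :=
      hcont.eventually (hU.mem_nhds (by rwa [hkk]))
    have h2 : ∀ᶠ x : (Fin 3 → ℂ) × ℂ × ℂ × ℂ × ℝ in 𝓝 (chart k), x.2.1.re ≠ 0 :=
      (by have := Complex.continuous_re; fun_prop : Continuous fun x :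
        (Fin 3 → ℂ) × ℂ × ℂ × ℂ × ℝ =>
        x.2.1.re).continuousAt.eventually_ne hre
    filter_upwards [h1, h2] with x hx1 hx2
    exact ⟨_, ⟨hmem x hx2, hx1⟩, chart_unchart _ x⟩
  calc (13 : ENNReal) = dimH (chart '' (S.admissible ∩ U)) := by
        rw [Real.dimH_of_mem_nhds hnhds]
        simp [Complex.finrank_real_complex, Module.finrank_pi_fintype]
    _ ≤ dimH (S.admissible ∩ U) :=
        contDiff_chart.contDiffOn.dimH_image_le convex_univ (Set.subset_univ _)

/-- Compares 12 with 13: this gives the codimension, and also density, since a nonempty relatively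
open set of dimension at least 13 cannot consist of exceptional parameters. -/
theorem holdsGenerically_isSLImmersionOn (hf : IsFreq a l) (hS : S.IsValid)
    (ha : ∀ j, freq S.α j = a j) :
    HoldsGenerically S.admissible fun k => IsSLImmersionOn cylModel (S.F k) Set.univ := by
  have hl := lam_eq hf hS ha
  have hA := (hS.isNondegenerate hf ha).quad
  have hiff : ∀ k ∈ S.admissible, (IsSLImmersionOn cylModel (S.F k) Set.univ ↔
      ∀ x, conjCross (S.dPhi₁ k x) (S.dPhi₂ k x) ≠ 0) := fun k hk =>
    isSLImmersionOn_F_iff hf hS ha hk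
  have hbad : dimH {k ∈ S.admissible | ¬ IsSLImmersionOn cylModel (S.F k) Set.univ} ≤ 12 := by
    refine (dimH_mono ?_).trans (dimH_exceptional_le hf hS ha)
    rintro k ⟨hk, hk'⟩
    exact ⟨hk, fun h => hk' ((hiff k hk).2 h)⟩
  refine ⟨⟨_, isOpen_conjCross_ne_zero hf hS.1 ha hl, ?_⟩, fun k hk => ?_, fun U hU hne => ?_⟩
  · ext k
    exact and_congr_right fun hk => hiff k hk
  · rw [mem_closure_iff]
    intro U hU hkU
    by_contra hcon
    have h13 := thirteen_le_dimH_admissible hA hU ⟨k, hk, hkU⟩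
    have hsub : S.admissible ∩ U ⊆
        {k ∈ S.admissible | ¬ IsSLImmersionOn cylModel (S.F k) Set.univ} := fun k' hk' =>
      ⟨hk'.1, fun h => hcon ⟨k', hk'.2, hk'.1, h⟩⟩
    exact absurd (h13.trans ((dimH_mono hsub).trans hbad)) (by norm_num)
  · refine le_trans ?_ (thirteen_le_dimH_admissible hA hU hne)
    calc dimH {k ∈ S.admissible | ¬ IsSLImmersionOn cylModel (S.F k) Set.univ} + 1 ≤ 12 + 1 := by
          gcongr
      _ = 13 := by norm_num

end Data

end SLFold

open SLFold in
theorem theorem11p6 (s : ℚ) (hs₀ : 0 < s) (hs₁ : s < 1 / 2) :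
    ∃ (a : Fin 3 → ℤ) (l : ℤ),
      -- the integers attached to `s`
      IsFamilyData s.num s.den a l ∧
      Int.gcd (a 0) (Int.gcd (a 1) (a 2)) = 1 ∧
      -- they determine `α₁, α₂, α₃`, and eigenvectors exist
      (∃! α : Fin 3 → ℝ, IsAlpha α ∧ ∀ j, freq α j = a j) ∧
      (∃ S : Data, S.IsValid ∧ ∀ j, freq S.α j = a j) ∧
      -- the cone is a special Lagrangian `T²`-cone
      IsSLTorusCone (cone fun j => a j) ∧
      -- `endCover` is a double cover of `(0,∞) × T²`
      IsCoveringMapOn endCover {b | 0 < b.1} ∧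
      (∀ b : ℝ × T2, 0 < b.1 → (endCover ⁻¹' {b}).ncard = 2) ∧
      -- `toCyl` is the quotient map `ℝ³ → ℝ³/ℤ = S¹ × ℝ²`
      (∀ x : Cyl, ∃ y₁ y₂ t : ℝ, toCyl y₁ y₂ t = x) ∧
      (∀ y₁ y₂ t y₁' y₂' t' : ℝ, toCyl y₁ y₂ t = toCyl y₁' y₂' t' ↔
        ∃ n : ℤ, y₁' = (-1) ^ n * y₁ ∧ y₂' = (-1) ^ n * y₂ ∧ t' = t + 2 * Real.pi * n) ∧
      ∀ S : Data, S.IsValid → (∀ j, freq S.α j = a j) →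
        lam S.α = l ∧
        -- the cone as an immersed special Lagrangian `T²`-cone
        cone (fun j => a j) = coneMap (torus S.α a) '' {b | 0 ≤ b.1} ∧
        IsSLImmersionOn coneModel (coneMap (torus S.α a)) {b | 0 < b.1} ∧
        (∀ b b' : ℝ × T2, 0 < b.1 → 0 < b'.1 →
          (coneMap (torus S.α a) b = coneMap (torus S.α a) b' ↔
            b = b' ∨ (Even (a 0) ∧ b' = (b.1, (-b.2.1, -b.2.2))))) ∧
        -- every member of the family
        (∀ k ∈ S.admissible,
          (∀ y₁ y₂ t : ℝ, S.Phi k y₁ y₂ (t + 2 * Real.pi) = S.Phi k (-y₁) (-y₂) t) ∧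
          (∀ y₁ y₂ t : ℝ, S.Phi k y₁ y₂ (t + 4 * Real.pi) = S.Phi k y₁ y₂ t) ∧
          (k.2 ≠ 0 → ∀ T : ℝ, (∀ y₁ y₂ t : ℝ, S.Phi k y₁ y₂ (t + T) = S.Phi k y₁ y₂ t) →
            ∃ n : ℤ, T = 4 * Real.pi * n) ∧
          (∀ y₁ y₂ t : ℝ, S.F k (toCyl y₁ y₂ t) = S.Phi k y₁ y₂ t) ∧
          Set.range (S.F k) = S.N k ∧
          IsClosed (S.N k) ∧ IsProperMap (S.F k) ∧
          IsSLParametrized cylModel (S.F k) ∧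
          -- weakly asymptotic, at rate `O(r^{1/2})`, to the double cover of the cone
          (fun x => S.F k x - coneMap (torus S.α a) (endCover x))
            =O[Filter.cocompact Cyl] fun x => ‖S.F k x‖ ^ (1 / 2 : ℝ)) ∧
        -- generic members are immersed special Lagrangian copies of `S¹ × ℝ²`
        HoldsGenerically S.admissible fun k => IsSLImmersionOn cylModel (S.F k) Set.univ := by
  have hp : 0 < s.num := Rat.num_pos.2 hs₀
  have hpq : 2 * s.num < s.den := by
    have h := (Rat.lt_iff s (1 / 2)).1 hs₁
    norm_num at h
    linarith
  have hc : IsCoprime s.num (s.den : ℤ) := Int.isCoprime_iff_gcd_eq_one.2 s.reduced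
  obtain ⟨a, l, h⟩ := exists_familyData s.num s.den
  have hf := h.isFreq hp hpq hc
  obtain ⟨S₀, hS₀, ha₀⟩ := Data.exists_isValid hf
  refine ⟨a, l, h, hf.gcd,
    existsUnique_alpha (a := fun j => (a j : ℝ)) (by exact_mod_cast hf.neg)
      (by exact_mod_cast hf.pos1) (by exact_mod_cast hf.pos2) (by exact_mod_cast hf.sum),
    ⟨S₀, hS₀, ha₀⟩, isSLTorusCone_cone hS₀.1 hf ha₀, isCoveringMapOn_endCover,
    fun b hb => ncard_endCover_preimage hb, toCyl_surjective, toCyl_eq_iff, fun S hS ha => ?_⟩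
  have hl := Data.lam_eq hf hS ha
  refine ⟨hl, cone_eq_image hS.1 ha, isSLImmersionOn_torus hS.1 ha,
    fun b b' => coneMap_torus_eq_iff hS.1 hf b b', fun k hk => ?_,
    Data.holdsGenerically_isSLImmersionOn hf hS ha⟩
  have hproper := Data.isProperMap_F hf hS.1 ha hl k
  have hrange := Data.range_F hf ha hl k
  exact ⟨Data.Phi_add_two_pi hf ha hl k, Data.Phi_add_four_pi hf ha hl k,
    fun hk0 T => Data.period_of_Phi hf hS ha hk0, Data.F_toCyl hf ha hl k, hrange,
    hrange ▸ hproper.isClosed_range, hproper, Data.isSLParametrized_F hf hS ha hk,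
    Data.isBigO_F hf hS.1 ha hl k⟩
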